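/- Consider equations for one function $\psi=\psi(t,x,y)$ of the form $$\zeta_t=F(t,x,y,\psi,\psi_x,\psi_y,\zeta,\zeta_x,\zeta_y,\zeta_{xx},\zeta_{xy},\zeta_{yy}),\qquad \zeta:=\psi_{xx}+\psi_{yy},\tag{1}$$ where $F$ is a smooth function on an open set $D_F$ of values of its twelve arguments. The base of (1) is the projection of $D_F$ to the space of $(t,x,y,\psi)$. The equation is identified with the subset of the fourth-order jet space given by the arguments of $F$ lying in $D_F$ and $\zeta_t=F$. A point transformation on an open set $\Omega$ of the space of $(t,x,y,\psi)$ is an injective smooth map $\varphi=(Z^0,Z^1,Z^2,\Psi)$ of $\Omega$ into this space with nonvanishing Jacobian. A triple $(F,\tilde F,\varphi)$ is an admissible transformation if $\varphi$ is a point transformation on the base of the equation with $F$, maps this base onto the base of the equation with $\tilde F$, and its prolongation, wherever defined, maps a jet over the base of the first equation into the second equation if and only if the jet belongs to the first equation. For a set $\mathcal S$ of functions $F$, the equivalence group $G^\sim(\mathcal S)$ over $\Omega$ consists of the point transformations of the space of jets and $F$ whose projection to the jet space is the prolongation of a point transformation $\varphi$ on $\Omega$ and which map every $F\in\mathcal S$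 with base in $\Omega$ to some $\tilde F\in\mathcal S$ such that $(F,\tilde F,\varphi)$ is admissible. $\mathcal S$ is normalized if every admissible transformation $(F,\tilde F,\varphi)$ with $F,\tilde F\in\mathcal S$ is induced by an element of $G^\sim(\mathcal S)$ over the base of $F$, i.e. this element maps $F$ to $\tilde F$ and its projection to the space of $(t,x,y,\psi)$ is $\varphi$. Let $\mathcal S_0$ be the set of all smooth $F$; let $\mathcal S_1\subset\mathcal S_0$ be the set of those $F$ with $(F_{\zeta_x},F_{\zeta_y},F_{\zeta_{xx}},F_{\zeta_{xy}},F_{\zeta_{yy}})\not\equiv(0,0,0,0,0)$; and let $\mathcal S_2\subset\mathcal S_1$ be the set of those $F$ that are not everywhere locally of the form $a^1(t,x,y)\zeta_x+a^2(t,x,y)\zeta_y+b(t,x,y,\psi,\psi_x,\psi_y,\zeta)$. Below, $\Omega$ is an open set in the space of $(t,x,y,\psi)$ whose sections $t=\mathrm{const}$ and $(t,x,y)=\mathrm{const}$ are connected or empty. Let $G_1^\sim$ over $\Omega$ be the set of the injective transformations $$\tilde t=T(t),\quad \tilde x=Z^1(t,x,y),\quad \tilde y=Z^2(t,x,y),\quad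 \tilde\psi=\Upsilon(t)\psi+\Phi(t,x,y),$$ $$\tilde F=\frac1{T_t}\left(\frac\Upsilon LF+\Bigl(\frac\Upsilon L\Bigr)_t\zeta+\Bigl(\frac{\Phi_{ii}}L\Bigr)_t-\frac{Z^i_tZ^i_j}L\left(\frac\Upsilon L\zeta_j+\Bigl(\frac\Upsilon L\Bigr)_j\zeta+\Bigl(\frac{\Phi_{ii}}L\Bigr)_j\right)\right),$$ where $T,Z^i,\Upsilon,\Phi$ are smooth functions of their arguments on the projections of $\Omega$ with $Z^1_kZ^2_k=0$, $Z^1_kZ^1_k=Z^2_kZ^2_k=:L$ and $T_t\Upsilon L\ne0$; here subscripts $1,2$ denote differentiation with respect to $x,y$, and repeated indices are summed over $\{1,2\}$. Theorem. (i) The class $\mathcal S_0$ is normalized, and its equivalence group over any $\Omega$ as above is exactly $G_1^\sim$. (ii) The class $\mathcal S_2$ is normalized, and its equivalence group over any $\Omega$ as above is exactly $G_1^\sim$. (iii) Every admissible transformation $(F,\tilde F,\varphi)$ with $F,\tilde F\in\mathcal S_1$, for which the base of $F$ has connected or empty sections as above, is induced by an element of $G_1^\sim$. -/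

import Mathlib

open Set Filter Topology
open scoped ContDiff

namespace Vorticity

noncomputable section

/-- The independent variables `z = (z₀, z₁, z₂) = (t, x, y)`. -/
abbrev Indep : Type := Fin 3 → ℝ

/-- The space of independent and dependent variables `(t, x, y, ψ)`. -/
abbrev Base : Type := Indep × ℝ

/-- The space of the arguments of the arbitrary element `F`: the point `(t, x, y, ψ)` and the eight
values `(ψ_x, ψ_y, ζ, ζ_x, ζ_y, ζ_xx, ζ_xy, ζ_yy)`, numbered from `0` to `7`. -/
abbrev Args : Type := Base × (Fin 8 → ℝ)

/-- Partial derivative with respect to `z_i` of a function of `(t, x, y)`. -/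
def pd (i : Fin 3) (u : Indep → ℝ) : Indep → ℝ :=
  fun z => fderiv ℝ u z (Pi.single i 1)

/-- Multi-indices `(a, b, c)` of order at most four; `(a, b, c)` stands for `∂_t^a ∂_x^b ∂_y^c`. -/
abbrev MultiIndex : Type :=
  {α : Fin 3 → Fin 5 // (α 0 : ℕ) + (α 1 : ℕ) + (α 2 : ℕ) ≤ 4}

/-- The jet space of order four: a point `(t, x, y)` together with the values of `ψ` and of all its
partial derivatives up to order four. -/
abbrev Jet : Type := Indep × (MultiIndex → ℝ)

/-- The `4`-jet at `z` of a function `u`. -/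
def jet (u : Indep → ℝ) (z : Indep) : Jet :=
  (z, fun α => ((pd 0)^[(α.1 0 : ℕ)] ((pd 1)^[(α.1 1 : ℕ)] ((pd 2)^[(α.1 2 : ℕ)] u))) z)

/-- The coordinate of a jet which is the derivative `∂_t^a ∂_x^b ∂_y^c ψ`. -/
def Jet.d (j : Jet) (a b c : Fin 5) (h : (a : ℕ) + (b : ℕ) + (c : ℕ) ≤ 4) : ℝ :=
  j.2 ⟨![a, b, c], h⟩

/-- The point `(t, x, y, ψ)` of a jet. -/
def Jet.pt (j : Jet) : Base := (j.1, j.d 0 0 0 (by decide))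

/-- `ζ = ψ_xx + ψ_yy`. -/
def Jet.vort (j : Jet) : ℝ := j.d 0 2 0 (by decide) + j.d 0 0 2 (by decide)

/-- `ζ_t`. -/
def Jet.vortT (j : Jet) : ℝ := j.d 1 2 0 (by decide) + j.d 1 0 2 (by decide)

/-- `ζ_x`. -/
def Jet.vortX (j : Jet) : ℝ := j.d 0 3 0 (by decide) + j.d 0 1 2 (by decide)

/-- `ζ_y`. -/
def Jet.vortY (j : Jet) : ℝ := j.d 0 2 1 (by decide) + j.d 0 0 3 (by decide)

/-- `ζ_xx`. -/
def Jet.vortXX (j : Jet) : ℝ := j.d 0 4 0 (by decide) + j.d 0 2 2 (by decide)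

/-- `ζ_xy`. -/
def Jet.vortXY (j : Jet) : ℝ := j.d 0 3 1 (by decide) + j.d 0 1 3 (by decide)

/-- `ζ_yy`. -/
def Jet.vortYY (j : Jet) : ℝ := j.d 0 2 2 (by decide) + j.d 0 0 4 (by decide)

/-- The arguments of `F` at a jet. -/
def Jet.args (j : Jet) : Args :=
  (j.pt, ![j.d 0 1 0 (by decide), j.d 0 0 1 (by decide), j.vort, j.vortX, j.vortY,
    j.vortXX, j.vortXY, j.vortYY])

/-- An equation `ζ_t = F(t, x, y, ψ, ψ_x, ψ_y, ζ, ζ_x, ζ_y, ζ_xx, ζ_xy, ζ_yy)`: a smooth function `F`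
on an open set of values of its arguments (the values of `F` outside `dom` are irrelevant). -/
structure VortEq where
  dom : Set Args
  F : Args → ℝ
  isOpen_dom : IsOpen dom
  smooth : ContDiffOn ℝ ∞ F dom

/-- The set of the points `(t, x, y, ψ)` over which `F` is defined. -/
def VortEq.base (f : VortEq) : Set Base := Prod.fst '' f.dom

/-- The equation as a submanifold of the jet space. -/
def VortEq.locus (f : VortEq) : Set Jet :=
  {j | j.args ∈ f.dom ∧ j.vortT = f.F j.args}

/-- The derivative with respect to `ψ` of a function of the arguments of `F`. -/
def dpsi (F : Args → ℝ) : Args → ℝ :=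
  fun a => fderiv ℝ F a (((0 : Indep), (1 : ℝ)), (0 : Fin 8 → ℝ))

/-- The derivative with respect to the `k`-th of `ψ_x, ψ_y, ζ, ζ_x, ζ_y, ζ_xx, ζ_xy, ζ_yy`. -/
def dvert (k : Fin 8) (F : Args → ℝ) : Args → ℝ :=
  fun a => fderiv ℝ F a ((0 : Base), Pi.single k 1)

/-- All equations `ζ_t = F` with smooth `F`. -/
def fullClass : Set VortEq := univ

/-- The equations with `(F_{ζ_x}, F_{ζ_y}, F_{ζ_xx}, F_{ζ_xy}, F_{ζ_yy})` not identically zero. -/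
def nontrivialClass : Set VortEq :=
  {f | ∃ a ∈ f.dom, ∃ k : Fin 8, 3 ≤ k ∧ dvert k f.F a ≠ 0}

/-- The equations for which `F` is not locally of the form
`a¹(t,x,y) ζ_x + a²(t,x,y) ζ_y + b(t,x,y,ψ,ψ_x,ψ_y,ζ)`: among the derivatives of `F` with respect
to `ζ_xx`, `ζ_xy`, `ζ_yy` and the derivatives of `F_{ζ_x}`, `F_{ζ_y}` with respect to `ψ` and the
eight vertical arguments, at least one is not identically zero. -/
def nonremovableClass : Set VortEq :=
  {f | ∃ a ∈ f.dom, (∃ k : Fin 8, 5 ≤ k ∧ dvert k f.F a ≠ 0) ∨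
    ∃ i : Fin 8, (i = 3 ∨ i = 4) ∧
      (dpsi (dvert i f.F) a ≠ 0 ∨ ∃ k : Fin 8, dvert k (dvert i f.F) a ≠ 0)}

/-- `φ` is a point transformation with domain `Ω`: smooth, invertible, with Jacobian `J ≠ 0`. -/
structure IsPointTransformation (Ω : Set Base) (φ : Base → Base) : Prop where
  smooth : ContDiffOn ℝ ∞ φ Ω
  injOn : InjOn φ Ω
  jacobian : ∀ p ∈ Ω, (fderiv ℝ φ p).det ≠ 0

/-- `u` is smooth in a neighbourhood of `z`. -/
def SmoothNear (u : Indep → ℝ) (z : Indep) : Prop :=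
  ∀ᶠ z' in 𝓝 z, ContDiffAt ℝ ∞ u z'

/-- The prolongation of `φ` maps the jet `j` to the jet `j'`: `φ` maps the graph of a function `u`
with the jet `j`, near the point of `j`, into the graph of a function `u'` with the jet `j'`. -/
def Prolongs (φ : Base → Base) (j j' : Jet) : Prop :=
  ∃ u u' : Indep → ℝ, SmoothNear u j.1 ∧ SmoothNear u' j'.1 ∧
    jet u j.1 = j ∧ jet u' j'.1 = j' ∧
    (φ (j.1, u j.1)).1 = j'.1 ∧
    ∀ᶠ z in 𝓝 j.1, (φ (z, u z)).2 = u' (φ (z, u z)).1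

/-- The jets over `Ω` at which the prolongation of `φ` is defined. -/
def prolongDomain (Ω : Set Base) (φ : Base → Base) : Set Jet :=
  {j | j.pt ∈ Ω ∧ ∃ j', Prolongs φ j j'}

/-- `φ ∈ T(f, f')`, that is, `(f, f', φ)` is an admissible transformation: the point transformation
`φ` (on the set of points over which `f` is defined) maps the equation `f` to the equation `f'`. -/
structure IsAdmissible (f f' : VortEq) (φ : Base → Base) : Prop where
  point : IsPointTransformation f.base φ
  base_eq : f'.base = φ '' f.base
  maps : ∀ j j' : Jet, j.pt ∈ f.base → Prolongs φ j j' → (j ∈ f.locus ↔ j' ∈ f'.locus)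

/-- A transformation `Φ` of the space of `(t, x, y, ψ_(4), F)` whose projection to the jet space is
the prolongation of a point transformation `φ` is given by `φ` and by its last component `E`:
it maps `(j, s)` to `(j', E j s)` where `j'` is the prolonged image of `j`.
`IsImage φ E f f'` says that `f' = Φ f`, that is, `Φ` maps the graph of `F` to the graph of `F'`. -/
structure IsImage (φ : Base → Base) (E : Jet → ℝ → ℝ) (f f' : VortEq) : Prop where
  base_eq : f'.base = φ '' f.base
  dom_iff : ∀ j j' : Jet, j.pt ∈ f.base → Prolongs φ j j' → (j.args ∈ f.dom ↔ j'.args ∈ f'.dom)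
  value : ∀ j j' : Jet, j.args ∈ f.dom → Prolongs φ j j' → f'.F j'.args = E j (f.F j.args)

/-- `Φ = (φ, E)`, over `Ω`, belongs to the (usual) equivalence group of the class `S`: it is a point
transformation of the space of `(t, x, y, ψ_(4), F)` which is projectable as above, and for any
`f ∈ S` over a part of `Ω` we have `Φ f ∈ S` and `φ ∈ T(f, Φ f)`. -/
structure IsEquivalence (S : Set VortEq) (Ω : Set Base) (φ : Base → Base) (E : Jet → ℝ → ℝ) :
    Prop where
  point : IsPointTransformation Ω φ
  smooth : ContDiffOn ℝ ∞ (fun q : Jet × ℝ => E q.1 q.2) (prolongDomain Ω φ ×ˢ univ)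
  injective : ∀ j ∈ prolongDomain Ω φ, Function.Injective (E j)
  deriv_ne : ∀ j ∈ prolongDomain Ω φ, ∀ s : ℝ, deriv (E j) s ≠ 0
  maps : ∀ f ∈ S, f.base ⊆ Ω → ∃ f' ∈ S, IsImage φ E f f' ∧ IsAdmissible f f' φ

/-- The class `S` is normalized: any admissible transformation `(f, f', φ)` of `S` is induced by
an element `Φ` of the equivalence group, `f' = Φ f` and `φ = Φ|_(t,x,y,ψ)`. -/
def IsNormalized (S : Set VortEq) : Prop :=
  ∀ f ∈ S, ∀ f' ∈ S, ∀ φ : Base → Base, IsAdmissible f f' φ →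
    ∃ E : Jet → ℝ → ℝ, IsEquivalence S f.base φ E ∧ IsImage φ E f f'

/-- Domains in the space of `(t, x, y, ψ)` on which functions with vanishing derivatives in
`x, y, ψ` (or in `ψ`) are functions of `t` (or of `t, x, y`) alone: open, with connected sections
`t = const` and `(t, x, y) = const`. Every open convex set is of this kind. -/
structure IsBaseDomain (Ω : Set Base) : Prop where
  isOpen : IsOpen Ω
  section_t : ∀ t : ℝ, IsPreconnected {p : Base | p ∈ Ω ∧ p.1 0 = t}
  section_z : ∀ z : Indep, IsPreconnected {s : ℝ | (z, s) ∈ Ω}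

/-- The Laplacian with respect to `x, y`. -/
def laplacian (u : Indep → ℝ) : Indep → ℝ :=
  fun z => pd 1 (pd 1 u) z + pd 2 (pd 2 u) z

/-- `L = Z¹_k Z¹_k`. -/
def confFactor (Z₁ : Indep → ℝ) : Indep → ℝ :=
  fun z => pd 1 Z₁ z ^ 2 + pd 2 Z₁ z ^ 2

/-- The expression of the transformed arbitrary element at a jet `j`, where `s` is the value of `F`:
with `A = Υ / L`, `B = Φ_ii / L`, this is
`(A s + A_t ζ + B_t - (Z^i_t Z^i_j / L) (A ζ_j + A_j ζ + B_j)) / T_t`. -/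
def newF (T Υ : ℝ → ℝ) (Z₁ Z₂ Φ : Indep → ℝ) (j : Jet) (s : ℝ) : ℝ :=
  let z : Indep := j.1
  let L : Indep → ℝ := confFactor Z₁
  let A : Indep → ℝ := fun w => Υ (w 0) / L w
  let B : Indep → ℝ := fun w => laplacian Φ w / L w
  1 / deriv T (z 0) *
    (A z * s + pd 0 A z * j.vort + pd 0 B z
      - (pd 0 Z₁ z * pd 1 Z₁ z + pd 0 Z₂ z * pd 1 Z₂ z) / L z
          * (A z * j.vortX + pd 1 A z * j.vort + pd 1 B z)
      - (pd 0 Z₁ z * pd 2 Z₁ z + pd 0 Z₂ z * pd 2 Z₂ z) / L z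
          * (A z * j.vortY + pd 2 A z * j.vort + pd 2 B z))

/-- The explicit family of transformations `G^∼_1` over `Ω`. -/
def IsExplicit (Ω : Set Base) (φ : Base → Base) (E : Jet → ℝ → ℝ) : Prop :=
  InjOn φ Ω ∧
  ∃ (T Υ : ℝ → ℝ) (Z₁ Z₂ Φ : Indep → ℝ),
    ContDiffOn ℝ ∞ T ((fun p : Base => p.1 0) '' Ω) ∧
    ContDiffOn ℝ ∞ Υ ((fun p : Base => p.1 0) '' Ω) ∧
    ContDiffOn ℝ ∞ Z₁ (Prod.fst '' Ω) ∧
    ContDiffOn ℝ ∞ Z₂ (Prod.fst '' Ω) ∧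
    ContDiffOn ℝ ∞ Φ (Prod.fst '' Ω) ∧
    (∀ p ∈ Ω,
      pd 1 Z₁ p.1 * pd 1 Z₂ p.1 + pd 2 Z₁ p.1 * pd 2 Z₂ p.1 = 0 ∧
      pd 1 Z₁ p.1 ^ 2 + pd 2 Z₁ p.1 ^ 2 = pd 1 Z₂ p.1 ^ 2 + pd 2 Z₂ p.1 ^ 2 ∧
      deriv T (p.1 0) * Υ (p.1 0) * confFactor Z₁ p.1 ≠ 0 ∧
      φ p = (![T (p.1 0), Z₁ p.1, Z₂ p.1], Υ (p.1 0) * p.2 + Φ p.1)) ∧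
    ∀ j : Jet, j.pt ∈ Ω → ∀ s : ℝ, E j s = newF T Υ Z₁ Z₂ Φ j s

end

end Vorticity

/-! Apart from `ψ` itself, the arguments of `F` are derivatives in `x, y` only, whereas `ζ_t`
contains one derivative in `t`. The description of admissible transformations exploits this
asymmetry. Let the jet of `u` at `z₀` lie in the first equation, let `v` be the image of `u`, and
let `τ` be the new time along the graph of `u`. Replacing `u` by `u + (τ - τ(z₀)) g` does not move
the graph over the level set of `τ` through `z₀`. The images `v` and `v₁` therefore agree on a slice
of constant new time, and the arguments of `F̃` coincide for them (`SliceZero.jet_args_eq`). If the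
perturbed jet still lies in the first equation, both images satisfy the second one, so the new
Laplacian of the new time derivative of `v₁ - v` vanishes at the image point. On the slice this time
derivative equals `g c / (1 + g m)` near that point, where `c ≠ 0` at the point itself
(`exists_perturbed_prolongation`, `psiDeriv_transversal`).

Every admissible choice of `g` is thus a condition on `φ`. The choice `(t - t₀)²` forces the new
time to depend on `t` only (`time_of_admissible`). Harmonic quadratic forms in `x, y` force the new
space variables to be conformal and independent of `ψ` (`conformal_of_admissible`). Linear functions
of `x, y` force `Ψ_ψ` to depend on `t` only (`scale_of_admissible`). The slopes of `u` vary in an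
open set, and splitting with respect to them separates the `ψ`-derivatives of `φ` from the others.
Connectedness of the sections integrates these conditions to the explicit form
(`exists_represents`).

Conversely, conformality gives `ζ̃ = A ζ + B` with `A = Υ/L`, `B = Φ_ii/L`. Differentiating this
relation expresses the old arguments injectively through the new ones, and makes `ζ̃_t` an affine
function of `ζ_t` with nonzero slope `A/T_t` (`transformation_formulas`). Hence the image of every
equation is an equation of the same kind, with `F` transformed by the same affine function
(`VortEq.push`). Nonremovability is preserved because the vertical arguments change by an affine
map, triangular in the order of derivatives, with coefficients depending on `t, x, y` only
(`IsImage.removableAt`).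

An element of the equivalence group has no other last component: applied to `ζ_t = ζ_xx + c`, it is
tested at every value of `F`, since `c` is free. Normalization concerns arbitrary bases, whose
sections may be disconnected. There the form is only local, and the transformation of `F` is glued
from local expressions, which agree by `Represents.germ_unique`. -/

namespace Vorticity

/-! ### Calculus of partial derivatives -/

@[fun_prop]
theorem contDiff_pd {i : Fin 3} {u : Indep → ℝ} (hu : ContDiff ℝ ∞ u) :
    ContDiff ℝ ∞ (fun z => pd i u z) :=
  (hu.fderiv_right (m := ∞) (by simp)).clm_apply contDiff_const

theorem pd_add {i : Fin 3} {f g : Indep → ℝ} (hf : ContDiff ℝ ∞ f) (hg : ContDiff ℝ ∞ g) :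
    pd i (fun z => f z + g z) = fun z => pd i f z + pd i g z := by
  funext z
  have h1 := (hf.differentiable (by simp)) z
  have h2 := (hg.differentiable (by simp)) z
  simp only [pd]
  rw [fderiv_fun_add h1 h2]; rfl

theorem pd_sub {i : Fin 3} {f g : Indep → ℝ} (hf : ContDiff ℝ ∞ f) (hg : ContDiff ℝ ∞ g) :
    pd i (fun z => f z - g z) = fun z => pd i f z - pd i g z := by
  funext z
  have h1 := (hf.differentiable (by simp)) z
  have h2 := (hg.differentiable (by simp)) z
  simp only [pd]
  rw [fderiv_fun_sub h1 h2]; rfl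

theorem pd_mul {i : Fin 3} {f g : Indep → ℝ} (hf : ContDiff ℝ ∞ f) (hg : ContDiff ℝ ∞ g) :
    pd i (fun z => f z * g z) = fun z => pd i f z * g z + f z * pd i g z := by
  funext z
  have h1 := (hf.differentiable (by simp)) z
  have h2 := (hg.differentiable (by simp)) z
  simp only [pd]
  rw [fderiv_fun_mul h1 h2]; simp; ring

@[simp] theorem pd_const {i : Fin 3} (c : ℝ) : pd i (fun _ => c) = fun _ => 0 := by
  funext z; simp [pd]

@[simp] theorem pd_coord {i k : Fin 3} :
    pd i (fun z => z k) = fun _ => if k = i then 1 else 0 := by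
  funext z
  simp only [pd]
  rw [(hasFDerivAt_apply k z).fderiv]
  simp [Pi.single_apply]

theorem pd_congr {i : Fin 3} {f g : Indep → ℝ} {z : Indep} (h : f =ᶠ[𝓝 z] g) :
    pd i f =ᶠ[𝓝 z] pd i g := by
  filter_upwards [h.eventuallyEq_nhds] with w hw
  simp only [pd, hw.fderiv_eq]

theorem fderiv_eq_sum_pd (v : Indep → ℝ) (z w : Indep) :
    fderiv ℝ v z w = pd 0 v z * w 0 + pd 1 v z * w 1 + pd 2 v z * w 2 := by
  have : w = w 0 • Pi.single (0 : Fin 3) (1:ℝ) + w 1 • Pi.single (1 : Fin 3) (1:ℝ)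
      + w 2 • Pi.single (2 : Fin 3) (1:ℝ) := by
    ext k; fin_cases k <;> simp
  conv_lhs => rw [this]
  simp only [map_add, map_smul, pd, smul_eq_mul]; ring

theorem pd_comp {i : Fin 3} {v : Indep → ℝ} {Z : Indep → Indep} (hv : ContDiff ℝ ∞ v)
    (hZ : ContDiff ℝ ∞ Z) :
    pd i (fun z => v (Z z)) = fun z => pd 0 v (Z z) * pd i (fun z => Z z 0) z
      + pd 1 v (Z z) * pd i (fun z => Z z 1) z + pd 2 v (Z z) * pd i (fun z => Z z 2) z := by
  funext z
  have h1 := (hv.differentiable (by simp)) (Z z)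
  have h2 := (hZ.differentiable (by simp)) z
  have e : ∀ k, pd i (fun z => Z z k) z = fderiv ℝ Z z (Pi.single i 1) k := by
    intro k
    have := (hasFDerivAt_apply (𝕜 := ℝ) k (Z z)).comp z h2.hasFDerivAt
    simp only [pd]
    erw [this.fderiv]; rfl
  rw [e, e, e, ← fderiv_eq_sum_pd]
  simp only [pd]
  have := fderiv_comp z h1 h2
  erw [this]; rfl

theorem pd_comm {u : Indep → ℝ} (hu : ContDiff ℝ ∞ u) (i j : Fin 3) :
    pd i (pd j u) = pd j (pd i u) := by
  funext z
  have hs : IsSymmSndFDerivAt ℝ u z :=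
    hu.contDiffAt.isSymmSndFDerivAt (by
      simpa using (WithTop.coe_le_coe.2 le_top : ((2 : ℕ∞) : WithTop ℕ∞) ≤ ∞))
  have hd : DifferentiableAt ℝ (fderiv ℝ u) z :=
    ((hu.fderiv_right (m := ∞) (by simp)).differentiable (by simp)) z
  have key : ∀ a b : Fin 3, pd a (pd b u) z
      = fderiv ℝ (fderiv ℝ u) z (Pi.single a 1) (Pi.single b 1) := by
    intro a b
    simp only [pd]
    have := (hd.hasFDerivAt.clm_apply (hasFDerivAt_const (Pi.single b (1:ℝ)) z))
    erw [this.fderiv]; simp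
  rw [key, key]; exact hs _ _

theorem contDiff_laplacian {u : Indep → ℝ} (hu : ContDiff ℝ ∞ u) :
    ContDiff ℝ ∞ (fun z => laplacian u z) := by
  unfold laplacian; fun_prop

/-! ### Smooth extension of germs -/

/-- The germ is multiplied by a bump function equal to one near `x` and supported where `f` is
smooth. Local arguments can then use globally smooth functions, without side conditions on domains.
-/
theorem exists_contDiff_eventuallyEq {E F : Type*} [NormedAddCommGroup E] [NormedSpace ℝ E]
    [FiniteDimensional ℝ E] [NormedAddCommGroup F] [NormedSpace ℝ F] {f : E → F} {x : E}
    (hf : ∀ᶠ y in 𝓝 x, ContDiffAt ℝ ∞ f y) : ∃ g : E → F, ContDiff ℝ ∞ g ∧ g =ᶠ[𝓝 x] f := by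
  obtain ⟨r, hr, hb⟩ := Metric.eventually_nhds_iff_ball.1 hf
  let χ : ContDiffBump x := ⟨r / 3, r / 2, by positivity, by linarith⟩
  refine ⟨fun y => χ y • f y, ?_, ?_⟩
  · rw [contDiff_iff_contDiffAt]
    intro y
    by_cases hy : y ∈ Metric.ball x r
    · exact (χ.contDiff.contDiffAt).smul (hb y hy)
    · have h0 : (fun y => χ y • f y) =ᶠ[𝓝 y] fun _ => 0 := by
        have : ∀ᶠ w in 𝓝 y, w ∉ Metric.closedBall x (r / 2) := by
          refine Metric.isClosed_closedBall.isOpen_compl.mem_nhds ?_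
          simp only [Metric.mem_ball, not_lt] at hy
          simp only [mem_compl_iff, Metric.mem_closedBall, not_le]; linarith
        filter_upwards [this] with w hw
        have : χ w = 0 := χ.zero_of_le_dist (by
          simp only [Metric.mem_closedBall, not_le] at hw; exact hw.le)
        simp [this]
      exact contDiffAt_const.congr_of_eventuallyEq h0
  · filter_upwards [χ.eventuallyEq_one] with y hy
    simp [hy]

theorem SmoothNear.exists_contDiff {u : Indep → ℝ} {z : Indep} (hu : SmoothNear u z) :
    ∃ v : Indep → ℝ, ContDiff ℝ ∞ v ∧ v =ᶠ[𝓝 z] u :=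
  exists_contDiff_eventuallyEq hu

theorem _root_.ContDiff.smoothNear {u : Indep → ℝ} (hu : ContDiff ℝ ∞ u) (z : Indep) :
    SmoothNear u z :=
  Eventually.of_forall fun _ => hu.contDiffAt

/-! ### Jets of functions -/

theorem pd_iterate_congr {i : Fin 3} {f g : Indep → ℝ} {z : Indep} (h : f =ᶠ[𝓝 z] g) (n : ℕ) :
    (pd i)^[n] f =ᶠ[𝓝 z] (pd i)^[n] g := by
  induction n with
  | zero => exact h
  | succ n ih =>
    rw [Function.iterate_succ_apply', Function.iterate_succ_apply']
    exact pd_congr ih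

theorem jet_congr {u v : Indep → ℝ} {z : Indep} (h : u =ᶠ[𝓝 z] v) : jet u z = jet v z := by
  unfold jet
  congr 1
  funext α
  exact (pd_iterate_congr (pd_iterate_congr (pd_iterate_congr h _) _) _).eq_of_nhds

theorem laplacian_congr {f g : Indep → ℝ} {z : Indep} (h : f =ᶠ[𝓝 z] g) :
    laplacian f =ᶠ[𝓝 z] laplacian g := by
  filter_upwards [pd_congr (i := 1) (pd_congr (i := 1) h), pd_congr (i := 2) (pd_congr (i := 2) h)]
    with w h1 h2
  simp only [laplacian, h1, h2]

@[simp] theorem jet_vort (u : Indep → ℝ) (z : Indep) : (jet u z).vort = laplacian u z := rfl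

section
variable {u : Indep → ℝ} (hu : ContDiff ℝ ∞ u)

theorem pd_laplacian (hu : ContDiff ℝ ∞ u) (i : Fin 3) :
    pd i (laplacian u) = fun z => pd i (pd 1 (pd 1 u)) z + pd i (pd 2 (pd 2 u)) z := by
  change pd i (fun z => pd 1 (pd 1 u) z + pd 2 (pd 2 u) z) = _
  rw [pd_add] <;> fun_prop

theorem jet_vortT (hu : ContDiff ℝ ∞ u) (z : Indep) :
    (jet u z).vortT = pd 0 (laplacian u) z := by
  rw [pd_laplacian hu]; rfl

theorem jet_vortX (hu : ContDiff ℝ ∞ u) (z : Indep) :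
    (jet u z).vortX = pd 1 (laplacian u) z := by
  rw [pd_laplacian hu]; rfl

theorem jet_vortY (hu : ContDiff ℝ ∞ u) (z : Indep) :
    (jet u z).vortY = pd 2 (laplacian u) z := by
  rw [pd_laplacian hu, pd_comm (u := pd 1 u) (by fun_prop) 2 1, pd_comm hu 2 1]; rfl

theorem jet_vortXX (hu : ContDiff ℝ ∞ u) (z : Indep) :
    (jet u z).vortXX = pd 1 (pd 1 (laplacian u)) z := by
  rw [pd_laplacian hu, pd_add (by fun_prop) (by fun_prop)]; rfl

theorem jet_vortXY (hu : ContDiff ℝ ∞ u) (z : Indep) :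
    (jet u z).vortXY = pd 1 (pd 2 (laplacian u)) z := by
  rw [pd_laplacian hu, pd_add (by fun_prop) (by fun_prop),
    pd_comm (u := pd 1 u) (by fun_prop) 2 1, pd_comm hu 2 1]; rfl

theorem jet_vortYY (hu : ContDiff ℝ ∞ u) (z : Indep) :
    (jet u z).vortYY = pd 2 (pd 2 (laplacian u)) z := by
  rw [pd_laplacian hu, pd_add (by fun_prop) (by fun_prop),
    pd_comm (u := pd 1 u) (by fun_prop) 2 1, pd_comm hu 2 1,
    pd_comm (u := pd 1 (pd 2 u)) (by fun_prop) 2 1,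
    pd_comm (u := pd 2 u) (by fun_prop) 2 1]; rfl
end

/-- The arguments of `F` at the jet of `u`. -/
theorem jet_args {u : Indep → ℝ} (hu : ContDiff ℝ ∞ u) (z : Indep) :
    (jet u z).args = ((z, u z), ![pd 1 u z, pd 2 u z, laplacian u z, pd 1 (laplacian u) z,
      pd 2 (laplacian u) z, pd 1 (pd 1 (laplacian u)) z, pd 1 (pd 2 (laplacian u)) z,
      pd 2 (pd 2 (laplacian u)) z]) := by
  unfold Jet.args
  rw [jet_vortX hu, jet_vortY hu, jet_vortXX hu, jet_vortXY hu, jet_vortYY hu]; rfl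

/-! ### Prolongation -/

/-- Jets and the relation between the graphs depend on germs only. Continuity of `φ` keeps the image
points in the region where `u'` agrees with its extension. -/
theorem Prolongs.exists_contDiff {φ : Base → Base} {j j' : Jet} (h : Prolongs φ j j')
    (hφ : ContinuousAt φ j.pt) :
    ∃ u u' : Indep → ℝ, ContDiff ℝ ∞ u ∧ ContDiff ℝ ∞ u' ∧ jet u j.1 = j ∧ jet u' j'.1 = j' ∧
      (φ (j.1, u j.1)).1 = j'.1 ∧ ∀ᶠ z in 𝓝 j.1, (φ (z, u z)).2 = u' (φ (z, u z)).1 := by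
  obtain ⟨u, u', hu, hu', hj, hj', h1, h2⟩ := h
  obtain ⟨v, hv, hvu⟩ := hu.exists_contDiff
  obtain ⟨v', hv', hvu'⟩ := hu'.exists_contDiff
  have hv0 : v j.1 = u j.1 := hvu.eq_of_nhds
  have hpt : j.pt = (j.1, u j.1) := by rw [← hj]; rfl
  refine ⟨v, v', hv, hv', by rw [jet_congr hvu, hj], by rw [jet_congr hvu', hj'],
    by rw [hv0, h1], ?_⟩
  have hc : Tendsto (fun z => (φ (z, v z)).1) (𝓝 j.1) (𝓝 j'.1) := by
    have : ContinuousAt (fun z => φ (z, v z)) j.1 := by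
      refine ContinuousAt.comp (g := φ) (f := fun z => (z, v z)) ?_
        (continuous_id.prodMk hv.continuous).continuousAt
      rw [hv0, ← hpt]; exact hφ
    have := (continuous_fst.continuousAt.comp this).tendsto
    simpa [Function.comp_def, hv0, h1] using this
  filter_upwards [h2, hvu, hc.eventually hvu'] with z ha hb hd
  rw [hd, hb, ha]

theorem Prolongs.of_contDiff {φ : Base → Base} {u v : Indep → ℝ} {z z' : Indep}
    (hu : ContDiff ℝ ∞ u) (hv : ContDiff ℝ ∞ v) (hz : (φ (z, u z)).1 = z')
    (h : ∀ᶠ w in 𝓝 z, (φ (w, u w)).2 = v (φ (w, u w)).1) :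
    Prolongs φ (jet u z) (jet v z') :=
  ⟨u, v, hu.smoothNear z, hv.smoothNear z', rfl, rfl, hz, h⟩

/-! ### Realization of jets -/

/-- The polynomial function `z ↦ P(z - z₀)`. -/
noncomputable def polyFun (P : MvPolynomial (Fin 3) ℝ) (z₀ : Indep) : Indep → ℝ :=
  fun z => MvPolynomial.eval (z - z₀) P

theorem contDiff_polyFun (P : MvPolynomial (Fin 3) ℝ) (z₀ : Indep) :
    ContDiff ℝ ∞ (polyFun P z₀) := by
  unfold polyFun
  induction P using MvPolynomial.induction_on with
  | C a => simpa using contDiff_const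
  | add p q hp hq => simpa using hp.add hq
  | mul_X p i hp =>
    have : ContDiff ℝ ∞ (fun z : Indep => z i - z₀ i) := by fun_prop
    simpa using hp.mul this

theorem pd_polyFun (i : Fin 3) (P : MvPolynomial (Fin 3) ℝ) (z₀ : Indep) :
    pd i (polyFun P z₀) = polyFun (MvPolynomial.pderiv i P) z₀ := by
  induction P using MvPolynomial.induction_on with
  | C a =>
    have : polyFun (MvPolynomial.C a) z₀ = fun _ => a := by funext z; simp [polyFun]
    rw [this]; funext z; simp [polyFun]
  | add p q hp hq =>
    have : polyFun (p + q) z₀ = fun z => polyFun p z₀ z + polyFun q z₀ z := by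
      funext z; simp [polyFun]
    rw [this, pd_add (contDiff_polyFun p z₀) (contDiff_polyFun q z₀), hp, hq]
    funext z; simp [polyFun]
  | mul_X p k hp =>
    have : polyFun (p * MvPolynomial.X k) z₀ = fun z => polyFun p z₀ z * (z k - z₀ k) := by
      funext z; simp [polyFun]
    rw [this, pd_mul (contDiff_polyFun p z₀) (by fun_prop), hp,
      pd_sub (by fun_prop) (by fun_prop), pd_coord, pd_const]
    funext z
    by_cases h : k = i
    · subst h
      simp [polyFun, Derivation.leibniz]; ring
    · have h' : i ≠ k := Ne.symm h
      simp [polyFun, Derivation.leibniz, h, MvPolynomial.pderiv_X_of_ne h]; ring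

theorem pd_iterate_polyFun (i : Fin 3) (P : MvPolynomial (Fin 3) ℝ) (z₀ : Indep) (n : ℕ) :
    (pd i)^[n] (polyFun P z₀) = polyFun ((MvPolynomial.pderiv i)^[n] P) z₀ := by
  induction n with
  | zero => rfl
  | succ n ih => rw [Function.iterate_succ_apply', ih, pd_polyFun, Function.iterate_succ_apply']

theorem coeff_pderiv_iterate (i : Fin 3) (n : ℕ) (P : MvPolynomial (Fin 3) ℝ) (m : Fin 3 →₀ ℕ)
    (hm : m i = 0) :
    MvPolynomial.coeff m ((MvPolynomial.pderiv i)^[n] P)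
      = MvPolynomial.coeff (m + Finsupp.single i n) P * (n.factorial : ℝ) := by
  -- The induction needs all `k`, because each derivative raises by one the exponent of the variable
  -- `i` that has to be read off.
  have key : ∀ k : ℕ, MvPolynomial.coeff (m + Finsupp.single i k) ((MvPolynomial.pderiv i)^[n] P)
      * (k.factorial : ℝ)
      = MvPolynomial.coeff (m + Finsupp.single i (k + n)) P * ((k + n).factorial : ℝ) := by
    induction n with
    | zero => intro k; simp
    | succ n ih =>
      intro k
      rw [Function.iterate_succ_apply', MvPolynomial.coeff_pderiv, add_assoc, ← Finsupp.single_add]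
      have := ih (k + 1)
      rw [Nat.factorial_succ] at this
      rw [show k + (n + 1) = k + 1 + n by ring, ← this]
      simp [hm]; ring
  simpa using key 0

/-- Any jet is the jet of a smooth function. -/
theorem exists_jet_eq (j : Jet) : ∃ u : Indep → ℝ, ContDiff ℝ ∞ u ∧ jet u j.1 = j := by
  classical
  let e : MultiIndex → (Fin 3 →₀ ℕ) := fun α =>
    Finsupp.single 2 (α.1 2 : ℕ) + Finsupp.single 1 (α.1 1 : ℕ) + Finsupp.single 0 (α.1 0 : ℕ)
  have he : Function.Injective e := by
    intro α β h
    have h0 := DFunLike.congr_fun h 0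
    have h1 := DFunLike.congr_fun h 1
    have h2 := DFunLike.congr_fun h 2
    simp [e] at h0 h1 h2
    apply Subtype.ext
    funext k
    fin_cases k
    · exact Fin.ext h0
    · exact Fin.ext h1
    · exact Fin.ext h2
  let c : MultiIndex → ℝ := fun α => ((α.1 0 : ℕ).factorial : ℝ) * ((α.1 1 : ℕ).factorial : ℝ)
    * ((α.1 2 : ℕ).factorial : ℝ)
  have hc : ∀ α, c α ≠ 0 := fun α => by positivity
  -- The Taylor polynomial with the prescribed derivatives; `c α` is the factorial of the
  -- multi-index.
  let P : MvPolynomial (Fin 3) ℝ := ∑ α, MvPolynomial.monomial (e α) (j.2 α / c α)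
  have hP : ∀ α, MvPolynomial.coeff (e α) P = j.2 α / c α := by
    intro α
    simp only [P, MvPolynomial.coeff_sum, MvPolynomial.coeff_monomial, he.eq_iff]
    simp
  refine ⟨polyFun P j.1, contDiff_polyFun P j.1, ?_⟩
  unfold jet
  refine Prod.ext rfl ?_
  funext α
  simp only [pd_iterate_polyFun]
  simp only [polyFun, sub_self]
  rw [MvPolynomial.eval_zero, MvPolynomial.constantCoeff_eq]
  rw [coeff_pderiv_iterate 0 _ _ _ (by simp), coeff_pderiv_iterate 1 _ _ _ (by simp),
    coeff_pderiv_iterate 2 _ _ _ (by simp)]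
  have : (0 + Finsupp.single (0 : Fin 3) (α.1 0 : ℕ) + Finsupp.single 1 (α.1 1 : ℕ)
      + Finsupp.single 2 (α.1 2 : ℕ)) = e α := by
    simp only [e]; abel
  rw [this, hP]
  have := hc α
  simp only [c] at this ⊢
  field_simp

/-- A jet over `a.1` with the arguments `a` and given values of `ψ_t` and `ζ_t`. -/
noncomputable def argsJet (a : Args) (r s : ℝ) : Jet :=
  (a.1.1, fun α => match ((α.1 0 : ℕ), (α.1 1 : ℕ), (α.1 2 : ℕ)) with
    | (0, 0, 0) => a.1.2
    | (1, 0, 0) => r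
    | (0, 1, 0) => a.2 0
    | (0, 0, 1) => a.2 1
    -- Each derivative of `ζ` is a sum of two jet coordinates: one carries the value and the other
    -- is zero. In particular `ψ_xxyy`, common to `ζ_xx` and `ζ_yy`, is zero.
    | (0, 2, 0) => a.2 2
    | (0, 3, 0) => a.2 3
    | (0, 0, 3) => a.2 4
    | (0, 4, 0) => a.2 5
    | (0, 3, 1) => a.2 6
    | (0, 0, 4) => a.2 7
    | (1, 2, 0) => s
    | _ => 0)

theorem argsJet_args (a : Args) (r s : ℝ) : (argsJet a r s).args = a := by
  refine Prod.ext (Prod.ext rfl rfl) ?_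
  funext k
  fin_cases k <;>
    simp [Jet.args, Jet.vort, Jet.vortX, Jet.vortY, Jet.vortXX, Jet.vortXY, Jet.vortYY, Jet.d,
      argsJet]

theorem argsJet_vortT (a : Args) (r s : ℝ) : (argsJet a r s).vortT = s := by
  simp [Jet.vortT, Jet.d, argsJet]

theorem argsJet_dt (a : Args) (r s : ℝ) : (argsJet a r s).d 1 0 0 (by decide) = r := by
  simp [Jet.d, argsJet]


/-! ### Local inverses -/

theorem exists_local_inverse {E : Type*} [NormedAddCommGroup E] [NormedSpace ℝ E]
    [FiniteDimensional ℝ E] {f : E → E} {x : E} (hf : ∀ᶠ y in 𝓝 x, ContDiffAt ℝ ∞ f y)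
    (hinj : ∀ w, fderiv ℝ f x w = 0 → w = 0) :
    ∃ g : E → E, ContDiff ℝ ∞ g ∧ g (f x) = x ∧ (∀ᶠ y in 𝓝 x, g (f y) = y) ∧
      ∀ᶠ y in 𝓝 (f x), f (g y) = y := by
  have : CompleteSpace E := FiniteDimensional.complete ℝ E
  have hinj' : Function.Injective (fderiv ℝ f x) := by
    rw [injective_iff_map_eq_zero]; exact hinj
  let e : E ≃L[ℝ] E := (LinearEquiv.ofInjectiveEndo (fderiv ℝ f x : E →ₗ[ℝ] E)
    hinj').toContinuousLinearEquiv
  have he : (e : E →L[ℝ] E) = fderiv ℝ f x := by ext w; rfl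
  have hfx : ContDiffAt ℝ ∞ f x := hf.self_of_nhds
  have hd : HasFDerivAt f (e : E →L[ℝ] E) x := by
    rw [he]; exact (hfx.differentiableAt (by simp)).hasFDerivAt
  let h := hfx.toOpenPartialHomeomorph f hd (by simp)
  have hcoe : (h : E → E) = f := rfl
  have hx : x ∈ h.source := hfx.mem_toOpenPartialHomeomorph_source hd (by simp)
  have hfx' : f x ∈ h.target := h.map_source hx
  have hsymm : h.symm (f x) = x := h.left_inv hx
  -- Invertibility of the derivative is an open condition. It is needed near `x` and not only at
  -- `x`, since the germ of the inverse must be smooth in a neighbourhood to be extended.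
  have hinv : ∀ᶠ y in 𝓝 x, ∃ e' : E ≃L[ℝ] E, (e' : E →L[ℝ] E) = fderiv ℝ f y := by
    have hc : ContinuousAt (fderiv ℝ f) x :=
      (hfx.fderiv_right (m := ∞) (by simp)).continuousAt
    have hn := ContinuousLinearEquiv.nhds e
    rw [he] at hn
    exact hc.eventually hn
  have hcs : ContinuousAt h.symm (f x) := h.symm.continuousAt hfx'
  have hsm : ∀ᶠ y in 𝓝 (f x), ContDiffAt ℝ ∞ h.symm y := by
    have h1 : ∀ᶠ y in 𝓝 (f x), y ∈ h.target := h.open_target.mem_nhds hfx'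
    have h2 := hcs.tendsto
    rw [hsymm] at h2
    filter_upwards [h1, h2.eventually hinv, h2.eventually hf] with y hy1 ⟨e', he'⟩ hy3
    refine h.contDiffAt_symm (f₀' := e') hy1 ?_ hy3
    rw [he']
    exact (hy3.differentiableAt (by simp)).hasFDerivAt
  obtain ⟨g, hg, hgh⟩ := exists_contDiff_eventuallyEq hsm
  refine ⟨g, hg, by rw [hgh.eq_of_nhds, hsymm], ?_, ?_⟩
  · filter_upwards [h.open_source.mem_nhds hx, hfx.continuousAt.eventually hgh] with y hy hy2
    rw [hy2]; exact h.left_inv hy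
  · filter_upwards [h.open_target.mem_nhds hfx', hgh] with y hy hy2
    rw [hy2]; exact h.right_inv hy

/-! ### Graphs of functions and their images. -/

/-- The map `z ↦ (t̃, x̃, ỹ)(z, u z)` of the independent variables. -/
def baseMap (φ : Base → Base) (u : Indep → ℝ) : Indep → Indep := fun z => (φ (z, u z)).1

theorem contDiff_baseMap {φ : Base → Base} (hφ : ContDiff ℝ ∞ φ) {u : Indep → ℝ}
    (hu : ContDiff ℝ ∞ u) : ContDiff ℝ ∞ (baseMap φ u) := by
  unfold baseMap; fun_prop

theorem fderiv_graph {F : Type*} [NormedAddCommGroup F] [NormedSpace ℝ F] {H : Base → F}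
    (hH : ContDiff ℝ ∞ H) {u : Indep → ℝ} (hu : ContDiff ℝ ∞ u) (z w : Indep) :
    fderiv ℝ (fun z => H (z, u z)) z w = fderiv ℝ H (z, u z) (w, fderiv ℝ u z w) := by
  have h1 : HasFDerivAt H (fderiv ℝ H (z, u z)) (z, u z) :=
    (hH.differentiable (by simp) _).hasFDerivAt
  have h2 : HasFDerivAt u (fderiv ℝ u z) z := (hu.differentiable (by simp) _).hasFDerivAt
  have h3 := h1.comp z ((hasFDerivAt_id z).prodMk h2)
  erw [h3.fderiv]; rfl

theorem fderiv_fst_comp {φ : Base → Base} {p : Base} (hφ : DifferentiableAt ℝ φ p) (w : Base) :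
    fderiv ℝ (fun p => (φ p).1) p w = (fderiv ℝ φ p w).1 := by
  have := (hasFDerivAt_fst (𝕜 := ℝ) (p := φ p)).comp p hφ.hasFDerivAt
  erw [this.fderiv]; rfl

theorem fderiv_snd_comp {φ : Base → Base} {p : Base} (hφ : DifferentiableAt ℝ φ p) (w : Base) :
    fderiv ℝ (fun p => (φ p).2) p w = (fderiv ℝ φ p w).2 := by
  have := (hasFDerivAt_snd (𝕜 := ℝ) (p := φ p)).comp p hφ.hasFDerivAt
  erw [this.fderiv]; rfl

theorem fderiv_baseMap {φ : Base → Base} (hφ : ContDiff ℝ ∞ φ) {u : Indep → ℝ}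
    (hu : ContDiff ℝ ∞ u) (z w : Indep) :
    fderiv ℝ (baseMap φ u) z w = (fderiv ℝ φ (z, u z) (w, fderiv ℝ u z w)).1 := by
  have := fderiv_graph (H := fun p => (φ p).1) (by fun_prop) hu z w
  rw [fderiv_fst_comp (hφ.differentiable (by simp) _)] at this
  exact this

/-- Prolongation to a jet whose graph is mapped to a graph. -/
theorem exists_prolongation {φ : Base → Base} (hφ : ContDiff ℝ ∞ φ) {u : Indep → ℝ}
    (hu : ContDiff ℝ ∞ u) {z₀ : Indep} (hinj : ∀ w, fderiv ℝ (baseMap φ u) z₀ w = 0 → w = 0) :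
    ∃ (Y : Indep → Indep) (v : Indep → ℝ), ContDiff ℝ ∞ Y ∧ ContDiff ℝ ∞ v ∧
      Y (baseMap φ u z₀) = z₀ ∧ (∀ᶠ z in 𝓝 z₀, Y (baseMap φ u z) = z) ∧
      (∀ᶠ z' in 𝓝 (baseMap φ u z₀), baseMap φ u (Y z') = z') ∧
      (∀ᶠ z in 𝓝 z₀, (φ (z, u z)).2 = v (baseMap φ u z)) := by
  obtain ⟨Y, hY, h1, h2, h3⟩ := exists_local_inverse
    (Eventually.of_forall fun y => (contDiff_baseMap hφ hu).contDiffAt) hinj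
  refine ⟨Y, fun z' => (φ (Y z', u (Y z'))).2, hY, by fun_prop, h1, h2, h3, ?_⟩
  filter_upwards [h2] with z hz
  simp only [hz]

/-! ### Functions vanishing on a slice `t = const` -/

/-- `R` vanishes on the slice `t = t₀` near `z₀`. -/
def SliceZero (R : Indep → ℝ) (z₀ : Indep) : Prop :=
  ∀ᶠ z in 𝓝 z₀, z 0 = z₀ 0 → R z = 0

theorem SliceZero.self {R : Indep → ℝ} {z₀ : Indep} (h : SliceZero R z₀) : R z₀ = 0 :=
  h.self_of_nhds rfl

theorem SliceZero.eventually_nhds {R : Indep → ℝ} {z₀ : Indep} (h : SliceZero R z₀) :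
    ∀ᶠ z in 𝓝 z₀, z 0 = z₀ 0 → SliceZero R z := by
  filter_upwards [Filter.Eventually.eventually_nhds h] with z hz h0
  filter_upwards [hz] with w hw h1
  exact hw (h1.trans h0)

theorem SliceZero.pd_self {R : Indep → ℝ} {z₀ : Indep} (h : SliceZero R z₀)
    (hR : ContDiff ℝ ∞ R) {i : Fin 3} (hi : i ≠ 0) : pd i R z₀ = 0 := by
  have hl : HasDerivAt (fun s : ℝ => z₀ + s • (Pi.single i (1:ℝ) : Indep)) (Pi.single i 1) 0 := by
    simpa using ((hasDerivAt_id (0:ℝ)).smul_const (Pi.single i (1:ℝ) : Indep)).const_add z₀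
  have hd : HasFDerivAt R (fderiv ℝ R z₀) (z₀ + (0:ℝ) • (Pi.single i (1:ℝ) : Indep)) := by
    simpa using (hR.differentiable (by simp) z₀).hasFDerivAt
  have h1 := hd.comp_hasDerivAt (0:ℝ) hl
  have h2 : (R ∘ fun s : ℝ => z₀ + s • (Pi.single i (1:ℝ) : Indep)) =ᶠ[𝓝 0] fun _ => 0 := by
    have ht : Tendsto (fun s : ℝ => z₀ + s • (Pi.single i (1:ℝ) : Indep)) (𝓝 0) (𝓝 z₀) := by
      simpa using hl.continuousAt.tendsto
    filter_upwards [ht.eventually h] with s hs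
    apply hs
    simp [hi.symm]
  have h3 := h1.congr_of_eventuallyEq h2.symm
  simpa [pd] using h3.unique (hasDerivAt_const (0:ℝ) (0:ℝ))

theorem SliceZero.pd {R : Indep → ℝ} {z₀ : Indep} (h : SliceZero R z₀)
    (hR : ContDiff ℝ ∞ R) {i : Fin 3} (hi : i ≠ 0) : SliceZero (pd i R) z₀ := by
  filter_upwards [h.eventually_nhds] with z hz h0
  exact (hz h0).pd_self hR hi

theorem SliceZero.laplacian {R : Indep → ℝ} {z₀ : Indep} (h : SliceZero R z₀)
    (hR : ContDiff ℝ ∞ R) : SliceZero (laplacian R) z₀ := by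
  filter_upwards [(h.pd hR (i := 1) (by decide)).pd (i := 1) (by fun_prop) (by decide),
    (h.pd hR (i := 2) (by decide)).pd (i := 2) (by fun_prop) (by decide)] with z h1 h2 h0
  simp [Vorticity.laplacian, h1 h0, h2 h0]

theorem laplacian_add {f g : Indep → ℝ} (hf : ContDiff ℝ ∞ f) (hg : ContDiff ℝ ∞ g) :
    laplacian (fun z => f z + g z) = fun z => laplacian f z + laplacian g z := by
  funext z
  simp (disch := fun_prop) only [laplacian, pd_add]
  ring

theorem laplacian_sub {f g : Indep → ℝ} (hf : ContDiff ℝ ∞ f) (hg : ContDiff ℝ ∞ g) :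
    laplacian (fun z => f z - g z) = fun z => laplacian f z - laplacian g z := by
  funext z
  simp (disch := fun_prop) only [laplacian, pd_sub]
  ring

theorem SliceZero.laplacian_eq {f g : Indep → ℝ} {z₀ : Indep}
    (h : SliceZero (fun z => f z - g z) z₀) (hf : ContDiff ℝ ∞ f) (hg : ContDiff ℝ ∞ g) :
    Vorticity.laplacian f z₀ = Vorticity.laplacian g z₀ := by
  have := (h.laplacian (hf.sub hg)).self
  rw [laplacian_sub hf hg] at this
  linarith

attribute [fun_prop] contDiff_laplacian

theorem pd_zero_laplacian {u : Indep → ℝ} (hu : ContDiff ℝ ∞ u) :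
    pd 0 (laplacian u) = laplacian (pd 0 u) := by
  rw [pd_laplacian hu]
  funext z
  rw [laplacian, pd_comm (u := pd 1 u) (by fun_prop), pd_comm hu 0 1,
    pd_comm (u := pd 2 u) (by fun_prop), pd_comm hu 0 2]

/-- All derivatives among the arguments of `F` are taken along the slice, so they see only the
restriction of the function to it. -/
theorem SliceZero.jet_args_eq {u v : Indep → ℝ} {z₀ : Indep}
    (h : SliceZero (fun z => v z - u z) z₀) (hu : ContDiff ℝ ∞ u) (hv : ContDiff ℝ ∞ v) :
    (jet v z₀).args = (jet u z₀).args := by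
  have hR : ContDiff ℝ ∞ (fun z => v z - u z) := hv.sub hu
  have e0 := h.self
  have e1 := fun i (hi : i ≠ 0) => (h.pd hR (i := i) hi).self
  have hL : ContDiff ℝ ∞ (Vorticity.laplacian fun z => v z - u z) := contDiff_laplacian hR
  have e2 := (h.laplacian hR).self
  have e3 := fun i (hi : i ≠ 0) => ((h.laplacian hR).pd hL (i := i) hi).self
  have e4 := fun i (hi : i ≠ 0) k (hk : k ≠ 0) =>
    (((h.laplacian hR).pd hL (i := i) hi).pd (i := k) (by fun_prop) hk).self
  simp (disch := fun_prop) only [laplacian_sub, pd_sub, sub_eq_zero] at e0 e1 e2 e3 e4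
  rw [jet_args hu, jet_args hv, e0, e1 1 (by decide), e1 2 (by decide), e2, e3 1 (by decide),
    e3 2 (by decide), e4 1 (by decide) 1 (by decide), e4 2 (by decide) 1 (by decide),
    e4 2 (by decide) 2 (by decide)]

theorem jet_vortT_sub {u v : Indep → ℝ} (hu : ContDiff ℝ ∞ u) (hv : ContDiff ℝ ∞ v) (z₀ : Indep) :
    (jet v z₀).vortT - (jet u z₀).vortT = laplacian (pd 0 (fun z => v z - u z)) z₀ := by
  rw [jet_vortT hu, jet_vortT hv, pd_zero_laplacian hu, pd_zero_laplacian hv, pd_sub hv hu,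
    laplacian_sub (by fun_prop) (by fun_prop)]

/-! ### Perturbations of a function and of its image -/

/-- The derivative of `φ` with respect to `ψ`. -/
noncomputable def psiDeriv (φ : Base → Base) : Base → Base := fun p => fderiv ℝ φ p (0, 1)

@[fun_prop]
theorem contDiff_psiDeriv {φ : Base → Base} (hφ : ContDiff ℝ ∞ φ) :
    ContDiff ℝ ∞ (fun p => psiDeriv φ p) :=
  (hφ.fderiv_right (m := ∞) (by simp)).clm_apply contDiff_const

/-- The perturbation of `u` by the product of `g` with the new time along `u`. -/
noncomputable def perturb (φ : Base → Base) (u g : Indep → ℝ) (z₀ : Indep) : Indep → ℝ :=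
  fun z => u z + (baseMap φ u z 0 - baseMap φ u z₀ 0) * g z

theorem contDiff_perturb {φ : Base → Base} (hφ : ContDiff ℝ ∞ φ) {u g : Indep → ℝ}
    (hu : ContDiff ℝ ∞ u) (hg : ContDiff ℝ ∞ g) (z₀ : Indep) :
    ContDiff ℝ ∞ (perturb φ u g z₀) := by
  have := contDiff_baseMap hφ hu
  unfold perturb; fun_prop

theorem fderiv_perturb {φ : Base → Base} (hφ : ContDiff ℝ ∞ φ) {u g : Indep → ℝ}
    (hu : ContDiff ℝ ∞ u) (hg : ContDiff ℝ ∞ g) {z₀ z : Indep}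
    (h : baseMap φ u z 0 = baseMap φ u z₀ 0) (w : Indep) :
    fderiv ℝ (perturb φ u g z₀) z w = fderiv ℝ u z w + g z * fderiv ℝ (baseMap φ u) z w 0 := by
  have hB := ((contDiff_baseMap hφ hu).differentiable (by simp) z).hasFDerivAt
  have h0 := (hasFDerivAt_apply (𝕜 := ℝ) (0 : Fin 3) (baseMap φ u z)).comp z hB
  have h1 := (hu.differentiable (by simp) z).hasFDerivAt.add
    ((h0.sub_const (baseMap φ u z₀ 0)).mul ((hg.differentiable (by simp) z).hasFDerivAt))
  have h2 : HasFDerivAt (perturb φ u g z₀) _ z := h1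
  rw [h2.fderiv]
  simp [h]

theorem perturb_eq {φ : Base → Base} {u g : Indep → ℝ} {z₀ z : Indep}
    (h : baseMap φ u z 0 = baseMap φ u z₀ 0) : perturb φ u g z₀ z = u z := by
  simp [perturb, h]

theorem baseMap_perturb_eq {φ : Base → Base} {u g : Indep → ℝ} {z₀ z : Indep}
    (h : baseMap φ u z 0 = baseMap φ u z₀ 0) :
    baseMap φ (perturb φ u g z₀) z = baseMap φ u z := by
  rw [baseMap, baseMap, perturb_eq h]

/-- The derivative of the relation between a function and its image. -/
theorem fderiv_prolongation {φ : Base → Base} (hφ : ContDiff ℝ ∞ φ) {u v : Indep → ℝ}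
    (hu : ContDiff ℝ ∞ u) (hv : ContDiff ℝ ∞ v) {z : Indep}
    (hvu : ∀ᶠ z in 𝓝 z, (φ (z, u z)).2 = v (baseMap φ u z)) (w : Indep) :
    (fderiv ℝ φ (z, u z) (w, fderiv ℝ u z w)).2
      = fderiv ℝ v (baseMap φ u z) (fderiv ℝ φ (z, u z) (w, fderiv ℝ u z w)).1 := by
  have e1 := DFunLike.congr_fun (Filter.EventuallyEq.fderiv_eq (𝕜 := ℝ) hvu) w
  have e2 := fderiv_comp z (hv.differentiable (by simp) _)
    ((contDiff_baseMap hφ hu).differentiable (by simp) z)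
  have e3 := fderiv_graph (H := fun p => (φ p).2) (by fun_prop) hu z w
  rw [fderiv_snd_comp (hφ.differentiable (by simp) _)] at e3
  rw [← e3, e1, ← fderiv_baseMap hφ hu]
  erw [e2]; rfl

/-- The effect on the prolonged jet of a perturbation that vanishes for the fixed new time. -/
theorem exists_perturbed_prolongation {φ : Base → Base} (hφ : ContDiff ℝ ∞ φ) {u g : Indep → ℝ}
    (hu : ContDiff ℝ ∞ u) (hg : ContDiff ℝ ∞ g) {z₀ : Indep} (hg0 : g z₀ = 0)
    (hinj : ∀ w, fderiv ℝ (baseMap φ u) z₀ w = 0 → w = 0) :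
    ∃ (Y : Indep → Indep) (v v₁ : Indep → ℝ), ContDiff ℝ ∞ Y ∧ ContDiff ℝ ∞ v ∧ ContDiff ℝ ∞ v₁ ∧
      Y (baseMap φ u z₀) = z₀ ∧
      (∀ᶠ z in 𝓝 z₀, Y (baseMap φ u z) = z) ∧
      (∀ᶠ z' in 𝓝 (baseMap φ u z₀), baseMap φ u (Y z') = z') ∧
      (∀ᶠ z in 𝓝 z₀, (φ (z, u z)).2 = v (baseMap φ u z)) ∧
      Prolongs φ (jet u z₀) (jet v (baseMap φ u z₀)) ∧
      Prolongs φ (jet (perturb φ u g z₀) z₀) (jet v₁ (baseMap φ u z₀)) ∧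
      SliceZero (fun z' => v₁ z' - v z') (baseMap φ u z₀) ∧
      SliceZero (fun z' => pd 0 (fun z' => v₁ z' - v z') z'
          * (1 + g (Y z') * (psiDeriv φ (Y z', u (Y z'))).1 0)
        - g (Y z') * ((psiDeriv φ (Y z', u (Y z'))).2
          - fderiv ℝ v z' (psiDeriv φ (Y z', u (Y z'))).1)) (baseMap φ u z₀) := by
  obtain ⟨Y, v, hY, hv, hY0, hYl, hYr, hvu⟩ := exists_prolongation hφ hu hinj
  have hu1 := contDiff_perturb hφ hu hg z₀
  -- Since `g z₀ = 0`, the perturbation has the same first derivatives at `z₀` as `u`, so its graph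
  -- is also mapped to a graph.
  have hinj1 : ∀ w, fderiv ℝ (baseMap φ (perturb φ u g z₀)) z₀ w = 0 → w = 0 := by
    intro w hw
    apply hinj
    rw [fderiv_baseMap hφ hu1, fderiv_perturb hφ hu hg rfl, perturb_eq rfl, hg0] at hw
    rw [fderiv_baseMap hφ hu]
    simpa using hw
  obtain ⟨Y₁, v₁, hY₁, hv₁, hY0₁, hYl₁, hYr₁, hvu₁⟩ := exists_prolongation hφ hu1 hinj1
  have hYt : Tendsto Y (𝓝 (baseMap φ u z₀)) (𝓝 z₀) := by
    have := hY.continuous.continuousAt (x := baseMap φ u z₀)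
    rwa [ContinuousAt, hY0] at this
  -- Points of the slice come from the level set of the new time on which `u` and its perturbation
  -- coincide.
  have hslice : SliceZero (fun z' => v₁ z' - v z') (baseMap φ u z₀) := by
    filter_upwards [hYr, hYt.eventually hvu, hYt.eventually hvu₁] with z' h1 h2 h3 h0
    have h4 : baseMap φ u (Y z') 0 = baseMap φ u z₀ 0 := by rw [h1, h0]
    rw [h1] at h2
    rw [baseMap_perturb_eq h4, perturb_eq h4, h1, h2] at h3
    rw [h3, sub_self]
  refine ⟨Y, v, v₁, hY, hv, hv₁, hY0, hYl, hYr, hvu, Prolongs.of_contDiff hu hv rfl hvu,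
    Prolongs.of_contDiff hu1 hv₁ (baseMap_perturb_eq rfl) hvu₁, hslice, ?_⟩
  filter_upwards [hYr.eventually_nhds, hYt.eventually hvu.eventually_nhds,
    hYt.eventually hvu₁.eventually_nhds, hslice.eventually_nhds] with z' h1 h2 h3 h4 h0
  specialize h4 h0
  have hz' : baseMap φ u (Y z') = z' := h1.self_of_nhds
  have hτ : baseMap φ u (Y z') 0 = baseMap φ u z₀ 0 := by rw [hz', h0]
  -- differentiate the relations between `u` and `v`, and between their perturbations
  have d1 : ∀ w, (fderiv ℝ φ (Y z', u (Y z')) (w, fderiv ℝ u (Y z') w)).2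
      = fderiv ℝ v z' (fderiv ℝ φ (Y z', u (Y z')) (w, fderiv ℝ u (Y z') w)).1 := by
    intro w
    have := fderiv_prolongation hφ hu hv h2 w
    rwa [hz'] at this
  have d2 : ∀ w, (fderiv ℝ φ (Y z', u (Y z'))
        (w, fderiv ℝ u (Y z') w + g (Y z') * fderiv ℝ (baseMap φ u) (Y z') w 0)).2
      = fderiv ℝ v₁ z' (fderiv ℝ φ (Y z', u (Y z'))
        (w, fderiv ℝ u (Y z') w + g (Y z') * fderiv ℝ (baseMap φ u) (Y z') w 0)).1 := by
    intro w
    have := fderiv_prolongation hφ hu1 hv₁ h3 w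
    rwa [fderiv_perturb hφ hu hg hτ, perturb_eq hτ, baseMap_perturb_eq hτ, hz'] at this
  have d3 : fderiv ℝ (baseMap φ u) (Y z') (fderiv ℝ Y z' (Pi.single 0 1)) = Pi.single 0 1 := by
    have e1 := fderiv_comp z' ((contDiff_baseMap hφ hu).differentiable (by simp) (Y z'))
      (hY.differentiable (by simp) z')
    have e2 : fderiv ℝ (baseMap φ u ∘ Y) z' = fderiv ℝ id z' := Filter.EventuallyEq.fderiv_eq h1
    rw [e1, fderiv_id] at e2
    exact congrArg (fun L => L (Pi.single 0 1)) e2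
  have hR : ContDiff ℝ ∞ (fun z' => v₁ z' - v z') := hv₁.sub hv
  -- As `v₁ - v` vanishes on the slice, its differential there is a multiple of that of the new
  -- time.
  have d4 : ∀ x : Indep, fderiv ℝ v₁ z' x
      = fderiv ℝ v z' x + pd 0 (fun z' => v₁ z' - v z') z' * x 0 := by
    intro x
    have e1 := fderiv_eq_sum_pd (fun z' => v₁ z' - v z') z' x
    rw [h4.pd_self hR (i := 1) (by decide), h4.pd_self hR (i := 2) (by decide),
      fderiv_fun_sub (hv₁.differentiable (by simp) _) (hv.differentiable (by simp) _)] at e1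
    simp only [sub_apply] at e1
    linarith
  -- Along `w` the image of the graph of `u` moves in the direction of the new time axis. The
  -- perturbation adds `g ∂_ψ` to the tangent vector, and subtracting `d1` from `d2` leaves `k (1 +
  -- g m) = g c`.
  set w := fderiv ℝ Y z' (Pi.single 0 1)
  have e1 := d1 w
  have e2 := d2 w
  have e3 : ((w, fderiv ℝ u (Y z') w + g (Y z') * fderiv ℝ (baseMap φ u) (Y z') w 0) : Base)
      = (w, fderiv ℝ u (Y z') w) + g (Y z') • ((0 : Indep), (1:ℝ)) := by
    rw [d3]; simp
  rw [e3, map_add, map_smul] at e2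
  change _ = fderiv ℝ v z' (fderiv ℝ φ (Y z', u (Y z')) (w, fderiv ℝ u (Y z') w)).1 at e1
  rw [← fderiv_baseMap hφ hu, d3] at e1
  have e4 : (fderiv ℝ φ (Y z', u (Y z')) (w, fderiv ℝ u (Y z') w)).1 = Pi.single 0 1 := by
    rw [← fderiv_baseMap hφ hu, d3]
  simp only [Prod.snd_add, Prod.fst_add, Prod.smul_fst, Prod.smul_snd, map_add, map_smul,
    e4, e1, d4, smul_eq_mul, Pi.add_apply, Pi.smul_apply, Pi.single_eq_same] at e2
  simp only [psiDeriv]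
  linarith

/-- If this expression vanished, the image of the vertical vector `∂_ψ` would be tangent to the
graph of `v`, hence the image of a vector tangent to the graph of `u`. Injectivity of the
differential of `φ` would then make `∂_ψ` tangent to a graph. -/
theorem psiDeriv_transversal {φ : Base → Base} (hφ : ContDiff ℝ ∞ φ) {u v : Indep → ℝ}
    (hu : ContDiff ℝ ∞ u) (hv : ContDiff ℝ ∞ v) {z₀ : Indep}
    (hinj : ∀ w, fderiv ℝ (baseMap φ u) z₀ w = 0 → w = 0)
    (hφinj : ∀ w, fderiv ℝ φ (z₀, u z₀) w = 0 → w = 0)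
    (hvu : ∀ᶠ z in 𝓝 z₀, (φ (z, u z)).2 = v (baseMap φ u z)) :
    (psiDeriv φ (z₀, u z₀)).2
      - fderiv ℝ v (baseMap φ u z₀) (psiDeriv φ (z₀, u z₀)).1 ≠ 0 := by
  intro hc
  have d1 := fderiv_prolongation hφ hu hv hvu
  have hsurj : Function.Surjective (fderiv ℝ (baseMap φ u) z₀) :=
    LinearMap.surjective_of_injective (f := (fderiv ℝ (baseMap φ u) z₀ : Indep →ₗ[ℝ] Indep))
      ((injective_iff_map_eq_zero _).2 hinj)
  obtain ⟨w, hw⟩ := hsurj (psiDeriv φ (z₀, u z₀)).1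
  rw [fderiv_baseMap hφ hu] at hw
  have h2 := d1 w
  rw [hw] at h2
  have h3 : fderiv ℝ φ (z₀, u z₀) (w, fderiv ℝ u z₀ w) = fderiv ℝ φ (z₀, u z₀) (0, 1) := by
    refine Prod.ext hw ?_
    rw [h2]; simp only [psiDeriv] at hc ⊢; linarith
  have h4 := hφinj ((w, fderiv ℝ u z₀ w) - (0, 1)) (by rw [map_sub, h3, sub_self])
  have h5 : w = 0 := by simpa using congrArg Prod.fst h4
  subst h5
  simpa using congrArg Prod.snd h4

/-- The product `α β` vanishes to second order at `z₀`, so the denominator in `k = α β c / (1 + α β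
m)` does not contribute to second derivatives of `k` there, and only the cross terms of `α` and `β`
survive. The relation is differentiated without dividing. -/
theorem laplacian_of_slice_product {k m c α β : Indep → ℝ} {z₀ : Indep} (hk : ContDiff ℝ ∞ k)
    (hm : ContDiff ℝ ∞ m) (hc : ContDiff ℝ ∞ c) (hα : ContDiff ℝ ∞ α) (hβ : ContDiff ℝ ∞ β)
    (hα0 : α z₀ = 0) (hβ0 : β z₀ = 0)
    (h : SliceZero (fun z => k z * (1 + α z * β z * m z) - α z * β z * c z) z₀) :
    laplacian k z₀ = 2 * c z₀ * (pd 1 α z₀ * pd 1 β z₀ + pd 2 α z₀ * pd 2 β z₀) := by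
  have e0 := h.self
  have e1 := (h.pd (by fun_prop) (i := 1) (by decide)).self
  have e2 := (h.pd (by fun_prop) (i := 2) (by decide)).self
  have e11 := ((h.pd (by fun_prop) (i := 1) (by decide)).pd (by fun_prop) (i := 1) (by decide)).self
  have e22 := ((h.pd (by fun_prop) (i := 2) (by decide)).pd (by fun_prop) (i := 2) (by decide)).self
  simp (disch := fun_prop) only [pd_sub, pd_mul, pd_add, pd_const] at e1 e2 e11 e22
  simp only [hα0, hβ0] at e0 e1 e2 e11 e22
  ring_nf at e0 e1 e2 e11 e22
  simp only [e0] at e11 e22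
  simp only [laplacian]
  linarith

/-! ### Conformal changes of the space variables -/

/-- For `L = p² + q² ≠ 0` the hypotheses mean `(r, s) = ±(-q, p)`. The determinant `p s - q r`
equals `±L`, and keeping it in the identities avoids a choice of orientation. -/
theorem conformal_aux {p q r s : ℝ} (h1 : p * r + q * s = 0)
    (h2 : p ^ 2 + q ^ 2 = r ^ 2 + s ^ 2) :
    (p * s - q * r) ^ 2 = (p ^ 2 + q ^ 2) ^ 2 ∧ s * (p ^ 2 + q ^ 2) = p * (p * s - q * r) ∧
      r * (p ^ 2 + q ^ 2) = -q * (p * s - q * r) ∧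
      (p * s - q * r) * s = p * (p ^ 2 + q ^ 2) ∧ (p * s - q * r) * r = -q * (p ^ 2 + q ^ 2) := by
  refine ⟨?_, ?_, ?_, ?_, ?_⟩
  · linear_combination (-(p * r + q * s)) * h1 - (p ^ 2 + q ^ 2) * h2
  · linear_combination q * h1
  · linear_combination p * h1
  · linear_combination (-r) * h1 - p * h2
  · linear_combination s * h1 + q * h2

/-- A square matrix with orthogonal rows of equal length is a multiple of an orthogonal matrix, so
its columns have the same property. -/
theorem conformal_columns {p q r s : ℝ} (h1 : p * r + q * s = 0)
    (h2 : p ^ 2 + q ^ 2 = r ^ 2 + s ^ 2) :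
    p * q + r * s = 0 ∧ p ^ 2 + r ^ 2 = p ^ 2 + q ^ 2 ∧ q ^ 2 + s ^ 2 = p ^ 2 + q ^ 2 := by
  obtain ⟨h3, h4, h5, h6, h7⟩ := conformal_aux h1 h2
  by_cases hL : p ^ 2 + q ^ 2 = 0
  · have hp : p = 0 := by nlinarith [sq_nonneg p, sq_nonneg q]
    have hq : q = 0 := by nlinarith [sq_nonneg p, sq_nonneg q]
    have hr : r = 0 := by nlinarith [sq_nonneg r, sq_nonneg s]
    have hs : s = 0 := by nlinarith [sq_nonneg r, sq_nonneg s]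
    subst hp hq hr hs; simp
  · have hL2 : (p ^ 2 + q ^ 2) ^ 2 ≠ 0 := pow_ne_zero 2 hL
    have hr2 : r ^ 2 = q ^ 2 := by
      apply mul_left_cancel₀ hL2
      linear_combination (r * (p ^ 2 + q ^ 2) - q * (p * s - q * r)) * h5 + q ^ 2 * h3
    have hs2 : s ^ 2 = p ^ 2 := by linarith
    refine ⟨?_, by rw [hr2], by rw [hs2]; ring⟩
    apply mul_left_cancel₀ hL2
    linear_combination (r * (p ^ 2 + q ^ 2)) * h4 + p * (p * s - q * r) * h5 - p * q * h3

/-- The inverse of such a matrix is its transpose divided by `p² + q²`. -/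
theorem conformal_inverse {a b c d p q r s : ℝ} (h1 : p * r + q * s = 0)
    (h2 : p ^ 2 + q ^ 2 = r ^ 2 + s ^ 2) (e1 : a * p + b * r = 1) (e2 : a * q + b * s = 0)
    (e3 : c * p + d * r = 0) (e4 : c * q + d * s = 1) :
    a * c + b * d = 0 ∧ a ^ 2 + b ^ 2 = c ^ 2 + d ^ 2 := by
  obtain ⟨k1, k2, k3⟩ := conformal_columns h1 h2
  have hL : p ^ 2 + q ^ 2 ≠ 0 := by
    intro hL
    have hp : p = 0 := by nlinarith [sq_nonneg p, sq_nonneg q]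
    have hr : r = 0 := by nlinarith [sq_nonneg r, sq_nonneg s]
    rw [hp, hr] at e1; simp at e1
  have hL2 : (p ^ 2 + q ^ 2) ^ 2 ≠ 0 := pow_ne_zero 2 hL
  have ha : a * (p ^ 2 + q ^ 2) = p := by linear_combination p * e1 + q * e2 - b * h1
  have hb : b * (p ^ 2 + q ^ 2) = r := by linear_combination r * e1 + s * e2 - a * h1 + b * h2
  have hc : c * (p ^ 2 + q ^ 2) = q := by linear_combination p * e3 + q * e4 - d * h1
  have hd : d * (p ^ 2 + q ^ 2) = s := by linear_combination r * e3 + s * e4 - c * h1 + d * h2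
  constructor
  · apply mul_left_cancel₀ hL2
    linear_combination (c * (p ^ 2 + q ^ 2)) * ha + p * hc + d * (p ^ 2 + q ^ 2) * hb + r * hd + k1
  · apply mul_left_cancel₀ hL2
    linear_combination (a * (p ^ 2 + q ^ 2) + p) * ha + (b * (p ^ 2 + q ^ 2) + r) * hb
      - (c * (p ^ 2 + q ^ 2) + q) * hc - (d * (p ^ 2 + q ^ 2) + s) * hd + k2 - k3

/-- Near `z₀` the new time depends on `t` only and the new space variables are conformal. -/
structure ConformalNear (Z : Indep → Indep) (z₀ : Indep) : Prop where
  smooth : ContDiff ℝ ∞ Z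
  time : ∀ᶠ z in 𝓝 z₀, pd 1 (fun z => Z z 0) z = 0 ∧ pd 2 (fun z => Z z 0) z = 0
  orth : ∀ᶠ z in 𝓝 z₀, pd 1 (fun z => Z z 1) z * pd 1 (fun z => Z z 2) z
    + pd 2 (fun z => Z z 1) z * pd 2 (fun z => Z z 2) z = 0
  norm : ∀ᶠ z in 𝓝 z₀, pd 1 (fun z => Z z 1) z ^ 2 + pd 2 (fun z => Z z 1) z ^ 2
    = pd 1 (fun z => Z z 2) z ^ 2 + pd 2 (fun z => Z z 2) z ^ 2
  factor : confFactor (fun z => Z z 1) z₀ ≠ 0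

theorem contDiff_confFactor {u : Indep → ℝ} (hu : ContDiff ℝ ∞ u) :
    ContDiff ℝ ∞ (fun z => confFactor u z) := by
  unfold confFactor; fun_prop
attribute [fun_prop] contDiff_confFactor

theorem ConformalNear.eventually {Z : Indep → Indep} {z₀ : Indep} (h : ConformalNear Z z₀) :
    ∀ᶠ z in 𝓝 z₀, ConformalNear Z z := by
  have hs := h.smooth
  have hc : Continuous (fun z => confFactor (fun z => Z z 1) z) :=
    (contDiff_confFactor (u := fun z => Z z 1) (by fun_prop)).continuous
  filter_upwards [h.time.eventually_nhds, h.orth.eventually_nhds, h.norm.eventually_nhds,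
    hc.continuousAt.eventually_ne h.factor] with z h1 h2 h3 h4
  exact ⟨h.smooth, h1, h2, h3, h4⟩

/-- Up to orientation these are the Cauchy–Riemann equations in `x, y`. Differentiating the two
conformality relations gives the linear system `A1`, `A2` for the two Laplacians, whose determinant
is nonzero. -/
theorem ConformalNear.harmonic {Z : Indep → Indep} {z₀ : Indep} (h : ConformalNear Z z₀) :
    laplacian (fun z => Z z 1) z₀ = 0 ∧ laplacian (fun z => Z z 2) z₀ = 0 := by
  have hs := h.smooth
  have hu : ContDiff ℝ ∞ (fun z => Z z 1) := by fun_prop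
  have hv : ContDiff ℝ ∞ (fun z => Z z 2) := by fun_prop
  have h1 := h.orth
  have h2 := h.norm
  have h3 := h.factor
  simp only [laplacian]
  simp only [confFactor] at h3
  generalize (fun z => Z z 1) = u at *
  generalize (fun z => Z z 2) = v at *
  have h2' : (fun z => pd 1 u z * pd 1 u z + pd 2 u z * pd 2 u z)
      =ᶠ[𝓝 z₀] (fun z => pd 1 v z * pd 1 v z + pd 2 v z * pd 2 v z) := by
    filter_upwards [h2] with z hz; linear_combination hz
  have h1' : (fun z => pd 1 u z * pd 1 v z + pd 2 u z * pd 2 v z) =ᶠ[𝓝 z₀] fun _ => 0 := h1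
  have P1 := (pd_congr (i := 1) h1').eq_of_nhds
  have P2 := (pd_congr (i := 2) h1').eq_of_nhds
  have Q1 := (pd_congr (i := 1) h2').eq_of_nhds
  have Q2 := (pd_congr (i := 2) h2').eq_of_nhds
  simp (disch := fun_prop) only [pd_add, pd_mul, pd_const] at P1 P2 Q1 Q2
  rw [pd_comm hu 2 1, pd_comm hv 2 1] at P2 Q2
  obtain ⟨k1, k2, k3, k4, k5⟩ := conformal_aux h1.self_of_nhds h2.self_of_nhds
  set p := pd 1 u z₀
  set q := pd 2 u z₀
  set r := pd 1 v z₀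
  set s := pd 2 v z₀
  set p1 := pd 1 (pd 1 u) z₀
  set p2 := pd 1 (pd 2 u) z₀
  set q2 := pd 2 (pd 2 u) z₀
  set r1 := pd 1 (pd 1 v) z₀
  set r2 := pd 1 (pd 2 v) z₀
  set s2 := pd 2 (pd 2 v) z₀
  set L := p ^ 2 + q ^ 2 with hL
  have A1 : -q * (p * s - q * r) * (p1 + q2) + L * p * (r1 + s2) = 0 := by
    linear_combination L * P1 - (p * s - q * r) / 2 * Q2 - p1 * k3 - p2 * k2 - r2 * k5 - s2 * k4
  have A2 : p * (p * s - q * r) * (p1 + q2) + L * q * (r1 + s2) = 0 := by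
    linear_combination L * P2 + (p * s - q * r) / 2 * Q1 - p2 * k3 - q2 * k2 + r1 * k5 + r2 * k4
  have hD : p * s - q * r ≠ 0 := by
    intro h0; rw [h0] at k1; exact h3 (by simpa using k1.symm)
  constructor
  · have : ((p * s - q * r) * L) * (p1 + q2) = 0 := by
      rw [hL]; linear_combination p * A2 - q * A1
    exact (mul_eq_zero.1 this).resolve_left (mul_ne_zero hD h3)
  · have : (L * L) * (r1 + s2) = 0 := by
      rw [hL]; linear_combination q * A2 + p * A1
    exact (mul_eq_zero.1 this).resolve_left (mul_ne_zero h3 h3)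

/-- In the chain rule the second-order terms combine to `L Δk` by conformality, and the first-order
terms carry the Laplacians of the new variables, which vanish. -/
theorem ConformalNear.laplacian_comp {Z : Indep → Indep} {z₀ : Indep} (h : ConformalNear Z z₀)
    {k : Indep → ℝ} (hk : ContDiff ℝ ∞ k) :
    laplacian (fun z => k (Z z)) z₀ = confFactor (fun z => Z z 1) z₀ * laplacian k (Z z₀) := by
  have hs := h.smooth
  obtain ⟨a1, a2⟩ := h.harmonic
  have b1 := h.orth.self_of_nhds
  have b2 := h.norm.self_of_nhds
  have c1 : pd 1 (fun z => Z z 0) =ᶠ[𝓝 z₀] fun _ => 0 := h.time.mono fun _ h => h.1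
  have c2 : pd 2 (fun z => Z z 0) =ᶠ[𝓝 z₀] fun _ => 0 := h.time.mono fun _ h => h.2
  have c11 := (pd_congr (i := 1) c1).eq_of_nhds
  have c22 := (pd_congr (i := 2) c2).eq_of_nhds
  have hcomm := pd_comm hk 2 1
  simp only [pd_const] at c11 c22
  simp only [laplacian, confFactor] at a1 a2 ⊢
  have d1 := c1.eq_of_nhds
  have d2 := c2.eq_of_nhds
  rw [pd_comp hk hs, pd_comp hk hs]
  simp (disch := fun_prop) only [pd_add, pd_mul]
  rw [pd_comp (contDiff_pd (i := 0) hk) hs, pd_comp (contDiff_pd (i := 1) hk) hs,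
    pd_comp (contDiff_pd (i := 2) hk) hs, pd_comp (contDiff_pd (i := 0) hk) hs,
    pd_comp (contDiff_pd (i := 1) hk) hs, pd_comp (contDiff_pd (i := 2) hk) hs]
  simp only [d1, d2, c11, c22, hcomm]
  linear_combination pd 1 k (Z z₀) * a1 + pd 2 k (Z z₀) * a2
    + 2 * pd 1 (pd 2 k) (Z z₀) * b1 - pd 2 (pd 2 k) (Z z₀) * b2

/-! ### Testing an admissible transformation on perturbed functions -/

theorem Prolongs.congr {φ φ' : Base → Base} {j j' : Jet} (h : Prolongs φ j j')
    (hφ : φ' =ᶠ[𝓝 j.pt] φ) : Prolongs φ' j j' := by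
  obtain ⟨u, u', hu, hu', hj, hj', h1, h2⟩ := h
  have hpt : j.pt = (j.1, u j.1) := by rw [← hj]; rfl
  have hc : ContinuousAt (fun z => (z, u z)) j.1 :=
    continuousAt_id.prodMk hu.self_of_nhds.continuousAt
  rw [hpt] at hφ
  have h3 := hc.eventually hφ
  refine ⟨u, u', hu, hu', hj, hj', by rw [hφ.eq_of_nhds, h1], ?_⟩
  filter_upwards [h2, h3] with z ha hb
  rw [hb, ha]

/-- Both images have the same arguments of `F̃`, hence the same `ζ_t` by the second equation. The
difference of the two values of `ζ_t` is the Laplacian in question. -/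
theorem laplacian_eq_zero_of_locus {f f' : VortEq} {φ : Base → Base} {p₀ : Base}
    (hmaps : ∀ j j' : Jet, j.pt = p₀ → Prolongs φ j j' → j ∈ f.locus → j' ∈ f'.locus)
    {u u₁ v v₁ : Indep → ℝ} {z₀ z' : Indep} (hj : jet u z₀ ∈ f.locus) (hj₁ : jet u₁ z₀ ∈ f.locus)
    (hu : (z₀, u z₀) = p₀) (hu₁ : (z₀, u₁ z₀) = p₀)
    (hv : ContDiff ℝ ∞ v) (hv₁ : ContDiff ℝ ∞ v₁) (P : Prolongs φ (jet u z₀) (jet v z'))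
    (P₁ : Prolongs φ (jet u₁ z₀) (jet v₁ z')) (hs : SliceZero (fun z' => v₁ z' - v z') z') :
    laplacian (pd 0 (fun z' => v₁ z' - v z')) z' = 0 := by
  have h1 := hmaps (jet u z₀) (jet v z') hu P hj
  have h2 := hmaps (jet u₁ z₀) (jet v₁ z') hu₁ P₁ hj₁
  rw [← jet_vortT_sub hv hv₁, h1.2, h2.2, hs.jet_args_eq hv hv₁, sub_self]

/-- A perturbation by a product of two linear forms that stays in the equation. -/
theorem quadratic_test {f f' : VortEq} {φ : Base → Base} (hφ : ContDiff ℝ ∞ φ)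
    {u : Indep → ℝ} (hu : ContDiff ℝ ∞ u) {z₀ : Indep}
    (hmaps : ∀ j j' : Jet, j.pt = (z₀, u z₀) → Prolongs φ j j' → j ∈ f.locus → j' ∈ f'.locus)
    (hφinj : ∀ w, fderiv ℝ φ (z₀, u z₀) w = 0 → w = 0)
    (hinj : ∀ w, fderiv ℝ (baseMap φ u) z₀ w = 0 → w = 0) (a b : Indep →L[ℝ] ℝ)
    (hj : jet u z₀ ∈ f.locus)
    (hj₁ : jet (perturb φ u (fun z => a (z - z₀) * b (z - z₀)) z₀) z₀ ∈ f.locus)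
    {w₁ w₂ : Indep} (hw₁ : fderiv ℝ (baseMap φ u) z₀ w₁ = Pi.single 1 1)
    (hw₂ : fderiv ℝ (baseMap φ u) z₀ w₂ = Pi.single 2 1) :
    a w₁ * b w₁ + a w₂ * b w₂ = 0 := by
  have hg : ContDiff ℝ ∞ (fun z => a (z - z₀) * b (z - z₀)) := by fun_prop
  obtain ⟨Y, v, v₁, hY, hv, hv₁, hY0, hYl, hYr, hvu, P, P₁, hs, hk⟩ :=
    exists_perturbed_prolongation hφ hu hg (by simp) hinj
  have hlap := laplacian_eq_zero_of_locus hmaps hj hj₁ rfl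
    (by rw [perturb_eq rfl]) hv hv₁ P P₁ hs
  have hψ : ContDiff ℝ ∞ (fun z' => psiDeriv φ (Y z', u (Y z'))) := by
    have := contDiff_psiDeriv hφ; fun_prop
  have hc : ContDiff ℝ ∞ (fun z' => (psiDeriv φ (Y z', u (Y z'))).2
      - fderiv ℝ v z' (psiDeriv φ (Y z', u (Y z'))).1) := by
    refine ContDiff.sub (by fun_prop) ?_
    exact (hv.fderiv_right (m := ∞) (by simp)).clm_apply (by fun_prop)
  have hm : ContDiff ℝ ∞ (fun z' => (psiDeriv φ (Y z', u (Y z'))).1 0) := by fun_prop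
  have hα : ContDiff ℝ ∞ (fun z' => a (Y z' - z₀)) := by fun_prop
  have hβ : ContDiff ℝ ∞ (fun z' => b (Y z' - z₀)) := by fun_prop
  have hk' := laplacian_of_slice_product (contDiff_pd (i := 0) (hv₁.sub hv)) hm hc hα hβ
    (by simp [hY0]) (by simp [hY0]) hk
  rw [hlap] at hk'
  have hc0 := psiDeriv_transversal hφ hu hv hinj hφinj hvu
  rw [← hY0] at hc0
  -- Since `Y` inverts the map of the independent variables, its derivative takes the new space
  -- directions to `w₁` and `w₂`. The new gradients of the two linear forms are therefore their
  -- values on these vectors.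
  have hw : ∀ w x, fderiv ℝ (baseMap φ u) z₀ w = x → fderiv ℝ Y (baseMap φ u z₀) x = w := by
    intro w x hwx
    have e1 := fderiv_comp z₀ (hY.differentiable (by simp) (baseMap φ u z₀))
      ((contDiff_baseMap hφ hu).differentiable (by simp) z₀)
    have e2 : fderiv ℝ (Y ∘ baseMap φ u) z₀ = fderiv ℝ id z₀ := Filter.EventuallyEq.fderiv_eq hYl
    rw [e1, fderiv_id] at e2
    rw [← hwx]
    exact DFunLike.congr_fun e2 w
  have hpd : ∀ (l : Indep →L[ℝ] ℝ) (i : Fin 3), pd i (fun z' => l (Y z' - z₀)) (baseMap φ u z₀)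
      = l (fderiv ℝ Y (baseMap φ u z₀) (Pi.single i 1)) := by
    intro l i
    have e := l.hasFDerivAt.comp (baseMap φ u z₀)
      ((hY.differentiable (by simp) (baseMap φ u z₀)).hasFDerivAt.sub_const z₀)
    simp only [pd]
    erw [e.fderiv]; rfl
  rw [hpd, hpd, hpd, hpd, hw _ _ hw₁, hw _ _ hw₂] at hk'
  rw [hY0] at hk'
  rw [hY0] at hc0
  have := hk'.symm
  rcases mul_eq_zero.1 this with h | h
  · rcases mul_eq_zero.1 h with h | h
    · norm_num at h
    · exact absurd h hc0
  · exact h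

/-! ### Splitting with respect to the slopes of a function. -/

/-- A property that depends continuously on the first derivatives and holds whenever the
independent variables remain independent along the graph holds always. -/
theorem eq_zero_of_generic {L : Base →L[ℝ] Base} (hL : ∀ w, L w = 0 → w = 0)
    {Q : Indep → ℝ} (hQ : Continuous Q) {x : Indep}
    (h : ∀ᶠ y in 𝓝 x, (∀ w : Indep, (L (w, ∑ i, y i * w i)).1 = 0 → w = 0) → Q y = 0) :
    ∀ᶠ y in 𝓝 x, Q y = 0 := by
  have hsurj : Function.Surjective L :=
    LinearMap.surjective_of_injective (f := (L : Base →ₗ[ℝ] Base))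
      ((injective_iff_map_eq_zero _).2 hL)
  -- The vector mapped to the vertical one. The image of a graph with slopes `y` fails to be a graph
  -- only if `n` is tangent to that graph.
  obtain ⟨n, hn⟩ := hsurj (0, 1)
  have hgood : ∀ y : Indep, ∑ i, y i * n.1 i ≠ n.2 →
      ∀ w : Indep, (L (w, ∑ i, y i * w i)).1 = 0 → w = 0 := by
    intro y hy w hw
    set l := (L (w, ∑ i, y i * w i)).2
    have h1 : L ((w, ∑ i, y i * w i) - l • n) = 0 := by
      rw [map_sub, map_smul, hn]
      refine Prod.ext ?_ ?_
      · simp [hw]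
      · simp [l]
    have h2 := sub_eq_zero.1 (hL _ h1)
    have h3 : w = l • n.1 := congrArg Prod.fst h2
    have h4 : ∑ i, y i * w i = l * n.2 := congrArg Prod.snd h2
    have h5 : ∑ i, y i * w i = l * ∑ i, y i * n.1 i := by
      rw [h3, Finset.mul_sum]
      refine Finset.sum_congr rfl fun i _ => ?_
      simp; ring
    have h6 : l * (∑ i, y i * n.1 i - n.2) = 0 := by rw [mul_sub, ← h5, h4, sub_self]
    have h7 : l = 0 := (mul_eq_zero.1 h6).resolve_right (sub_ne_zero.2 hy)
    rw [h3, h7, zero_smul]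
  -- As `n ≠ 0`, the excluded slopes form an affine hyperplane or the empty set, so the good slopes
  -- are dense.
  have hfreq : ∀ y : Indep, ∃ᶠ y' in 𝓝 y, ∑ i, y' i * n.1 i ≠ n.2 := by
    intro y hy
    simp only [not_not] at hy
    have hl : Tendsto (fun s : ℝ => y + s • n.1) (𝓝 0) (𝓝 y) := by
      have : Continuous (fun s : ℝ => y + s • n.1) := by fun_prop
      simpa using this.tendsto 0
    have h1 := hl.eventually hy
    have h2 := hy.self_of_nhds
    have h3 : ∀ᶠ s : ℝ in 𝓝[≠] 0, s * ∑ i, n.1 i * n.1 i = 0 := by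
      filter_upwards [h1.filter_mono nhdsWithin_le_nhds] with s hs
      simp only [Pi.add_apply, Pi.smul_apply, smul_eq_mul, add_mul, Finset.sum_add_distrib, h2,
        add_eq_left] at hs
      rw [Finset.mul_sum, ← hs]
      exact Finset.sum_congr rfl fun i _ => by ring
    obtain ⟨s, hs, hs0⟩ := (h3.and self_mem_nhdsWithin).exists
    have h4 := (mul_eq_zero.1 hs).resolve_left hs0
    have h5 : n.1 = 0 := by
      funext i
      have := (Finset.sum_eq_zero_iff_of_nonneg (fun i _ => mul_self_nonneg (n.1 i))).1 h4 i
        (Finset.mem_univ i)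
      simpa using this
    have h6 : n.2 = 0 := by rw [← h2, h5]; simp
    have h7 : n = 0 := Prod.ext h5 h6
    rw [h7, map_zero] at hn
    simpa using congrArg Prod.snd hn
  filter_upwards [h.eventually_nhds] with y hy
  by_contra hne
  have := (hQ.continuousAt (x := y)).eventually_ne hne
  obtain ⟨y', h1, h2, h3⟩ := ((hfreq y).and_eventually (hy.and this)).exists
  exact h3 (h2 (hgood y' h1))

/-- Functions with prescribed generic jets in the equation. -/
theorem exists_locus_function {f : VortEq} {p₀ : Base} (hp : p₀ ∈ f.base) :
    ∃ x : Indep, ∀ᶠ y in 𝓝 x, ∃ u : Indep → ℝ, ContDiff ℝ ∞ u ∧ u p₀.1 = p₀.2 ∧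
      (∀ w, fderiv ℝ u p₀.1 w = ∑ i, y i * w i) ∧ (∀ i, pd i u p₀.1 = y i) ∧
      jet u p₀.1 ∈ f.locus := by
  obtain ⟨a, ha, rfl⟩ := hp
  -- The slopes in `x, y` replace two arguments of `F`, which is possible near `a` because the
  -- domain is open. The slope in `t` is not an argument and is free, and `ζ_t` is set to the value
  -- of `F`.
  let A : Indep → Args := fun y =>
    (a.1, ![y 1, y 2, a.2 2, a.2 3, a.2 4, a.2 5, a.2 6, a.2 7])
  have hA : Continuous A := by
    refine continuous_const.prodMk (continuous_pi fun k => ?_)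
    fin_cases k <;> simp <;> fun_prop
  have hx : A ![0, a.2 0, a.2 1] = a := by
    refine Prod.ext rfl ?_
    funext k
    fin_cases k <;> simp [A]
  refine ⟨![0, a.2 0, a.2 1], ?_⟩
  have hev : ∀ᶠ y in 𝓝 (![0, a.2 0, a.2 1] : Indep), A y ∈ f.dom :=
    hA.continuousAt.eventually (by rw [hx]; exact f.isOpen_dom.mem_nhds ha)
  filter_upwards [hev] with y hy
  obtain ⟨u, hu, hj⟩ := exists_jet_eq (argsJet (A y) (y 0) (f.F (A y)))
  have hz : (argsJet (A y) (y 0) (f.F (A y))).1 = a.1.1 := rfl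
  rw [hz] at hj
  have hargs := jet_args hu a.1.1
  rw [hj, argsJet_args] at hargs
  have h0 : pd 0 u a.1.1 = y 0 := by
    have : (jet u a.1.1).d 1 0 0 (by decide) = pd 0 u a.1.1 := rfl
    rw [← this, hj, argsJet_dt]
  have h1 : pd 1 u a.1.1 = y 1 := (congrArg (fun c : Args => c.2 0) hargs).symm
  have h2 : pd 2 u a.1.1 = y 2 := (congrArg (fun c : Args => c.2 1) hargs).symm
  refine ⟨u, hu, (congrArg (fun c : Args => c.1.2) hargs).symm, ?_, ?_, ?_, ?_⟩
  · intro w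
    rw [fderiv_eq_sum_pd, Fin.sum_univ_three, h0, h1, h2]
  · intro i
    fin_cases i
    · exact h0
    · exact h1
    · exact h2
  · rw [hj, argsJet_args]; exact hy
  · rw [hj, argsJet_args, argsJet_vortT]

theorem coeff_eq_zero_of_eventually {A B C : ℝ} (h : ∀ᶠ s in 𝓝 (0 : ℝ), A + B * s + C * s ^ 2 = 0) :
    A = 0 ∧ B = 0 ∧ C = 0 := by
  obtain ⟨r, hr, hb⟩ := Metric.eventually_nhds_iff.1 h
  have h0 := hb (y := 0) (by simpa using hr)
  have h1 := hb (y := r / 2) (by simp [abs_of_pos hr]; linarith)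
  have h2 := hb (y := -(r / 2)) (by simp [abs_of_pos hr]; linarith)
  have hA : A = 0 := by simpa using h0
  have hr2 : r / 2 ≠ 0 := by positivity
  subst hA
  refine ⟨rfl, ?_, ?_⟩
  · have : (r / 2) * B = 0 := by linear_combination (h1 - h2) / 2
    exact (mul_eq_zero.1 this).resolve_left hr2
  · have : (r / 2) ^ 2 * C = 0 := by linear_combination (h1 + h2) / 2
    exact (mul_eq_zero.1 this).resolve_left (pow_ne_zero 2 hr2)

theorem eventually_shift {Q : Indep → ℝ} {x : Indep} (h : ∀ᶠ y in 𝓝 x, Q y = 0) (i : Fin 3) :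
    ∀ᶠ s in 𝓝 (0 : ℝ), Q (x + s • Pi.single i 1) = 0 := by
  have hl : Tendsto (fun s : ℝ => x + s • (Pi.single i (1:ℝ) : Indep)) (𝓝 0) (𝓝 x) := by
    have : Continuous (fun s : ℝ => x + s • (Pi.single i (1:ℝ) : Indep)) := by fun_prop
    simpa using this.tendsto 0
  exact hl.eventually h

/-! ### The form of admissible transformations -/

theorem base_decomp (w : Base) (hw : w.1 0 = 0) :
    w = w.1 1 • ((Pi.single 1 1 : Indep), (0:ℝ)) + w.1 2 • ((Pi.single 2 1 : Indep), (0:ℝ))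
      + w.2 • ((0 : Indep), (1:ℝ)) := by
  refine Prod.ext ?_ ?_
  · funext k; fin_cases k <;> simp [hw]
  · simp

theorem indep_decomp (w : Indep) :
    w = w 0 • (Pi.single 0 1 : Indep) + w 1 • (Pi.single 1 1 : Indep)
      + w 2 • (Pi.single 2 1 : Indep) := by
  funext k; fin_cases k <;> simp

theorem eq_comb_of_images {D : Indep →L[ℝ] Indep} (hD : ∀ w, D w = 0 → w = 0)
    {w₀ w₁ w₂ : Indep} (h0 : D w₀ = Pi.single 0 1) (h1 : D w₁ = Pi.single 1 1)
    (h2 : D w₂ = Pi.single 2 1) (x : Indep) :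
    x = D x 0 • w₀ + D x 1 • w₁ + D x 2 • w₂ := by
  rw [← sub_eq_zero]
  apply hD
  simp only [map_sub, map_add, map_smul, h0, h1, h2]
  rw [← indep_decomp, sub_self]

theorem locus_of_args_eq {f : VortEq} {j j₁ : Jet} (hj : j ∈ f.locus) (ha : j₁.args = j.args)
    (ht : j₁.vortT - j.vortT = 0) : j₁ ∈ f.locus := by
  refine ⟨by rw [ha]; exact hj.1, ?_⟩
  rw [ha, ← hj.2]; linarith

theorem perturb_sub (φ : Base → Base) (u g : Indep → ℝ) (z₀ : Indep) :
    (fun z => perturb φ u g z₀ z - u z)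
      = fun z => (baseMap φ u z 0 - baseMap φ u z₀ 0) * g z := by
  funext z; simp [perturb]

theorem fderiv_baseMap_of_slopes {φ : Base → Base} (hφ : ContDiff ℝ ∞ φ) {u : Indep → ℝ}
    (hu : ContDiff ℝ ∞ u) {p₀ : Base} {y : Indep} (hu0 : u p₀.1 = p₀.2)
    (hy : ∀ w, fderiv ℝ u p₀.1 w = ∑ i, y i * w i) (w : Indep) :
    fderiv ℝ (baseMap φ u) p₀.1 w = (fderiv ℝ φ p₀ (w, ∑ i, y i * w i)).1 := by
  rw [fderiv_baseMap hφ hu, hy, hu0]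

/-- The value `l (e_j, y_j) = l (e_j, 0) + y_j l (0, 1)` is affine in the slope, so vanishing for an
open set of slopes kills both coefficients. -/
theorem eq_zero_of_eventually_slopes {l : Base →L[ℝ] ℝ} {x : Indep}
    (key : ∀ j : Fin 3, j ≠ 0 → ∀ᶠ y : Indep in 𝓝 x, l (Pi.single j 1, y j) = 0)
    (w : Base) (hw : w.1 0 = 0) : l w = 0 := by
  have coef : ∀ j : Fin 3, j ≠ 0 → l (Pi.single j 1, 0) = 0 ∧ l (0, 1) = 0 := by
    intro j hj
    have e : ∀ r : ℝ, l (Pi.single j 1, r) = l (Pi.single j 1, 0) + r * l (0, 1) := by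
      intro r
      have : ((Pi.single j 1, r) : Base) = (Pi.single j 1, 0) + r • ((0 : Indep), (1:ℝ)) :=
        Prod.ext (by simp) (by simp)
      rw [this, map_add, map_smul]; rfl
    have h1 := eventually_shift (key j hj) j
    obtain ⟨hA, hB, -⟩ := coeff_eq_zero_of_eventually
      (A := l (Pi.single j 1, 0) + x j * l (0, 1)) (B := l (0, 1)) (C := 0) (by
        filter_upwards [h1] with s hs
        rw [e] at hs
        simp only [Pi.add_apply, Pi.smul_apply, Pi.single_eq_same, smul_eq_mul, mul_one] at hs
        linear_combination hs)
    rw [hB] at hA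
    exact ⟨by simpa using hA, hB⟩
  rw [base_decomp w hw, map_add, map_add, map_smul, map_smul, map_smul]
  simp only [(coef 1 (by decide)).1, (coef 2 (by decide)).1, (coef 1 (by decide)).2, smul_zero,
    add_zero]

/-- The new time depends on `t` only. -/
theorem time_of_admissible {f f' : VortEq} {φ : Base → Base} (hφ : ContDiff ℝ ∞ φ) {p₀ : Base}
    (hp : p₀ ∈ f.base) (hφinj : ∀ w, fderiv ℝ φ p₀ w = 0 → w = 0)
    (hmaps : ∀ j j' : Jet, j.pt = p₀ → Prolongs φ j j' → j ∈ f.locus → j' ∈ f'.locus)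
    (w : Base) (hw : w.1 0 = 0) : (fderiv ℝ φ p₀ w).1 0 = 0 := by
  obtain ⟨x, hx⟩ := exists_locus_function hp
  have key : ∀ j : Fin 3, j ≠ 0 →
      ∀ᶠ y : Indep in 𝓝 x, (fderiv ℝ φ p₀ (Pi.single j 1, y j)).1 0 = 0 := by
    intro j hj0
    refine eq_zero_of_generic hφinj (Q := fun y => (fderiv ℝ φ p₀ (Pi.single j 1, y j)).1 0)
      (by fun_prop) ?_
    filter_upwards [hx] with y ⟨u, hu, hu0, hy, hyi, hj⟩ hgood
    have hp0 : (p₀.1, u p₀.1) = p₀ := by rw [hu0]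
    have hD := fderiv_baseMap_of_slopes hφ hu hu0 hy
    have hinj : ∀ w, fderiv ℝ (baseMap φ u) p₀.1 w = 0 → w = 0 := by
      intro w hw; rw [hD] at hw; exact hgood w hw
    let a : Indep →L[ℝ] ℝ := ContinuousLinearMap.proj 0
    have hB := contDiff_baseMap hφ hu
    have hg : ContDiff ℝ ∞ (fun z => a (z - p₀.1) * a (z - p₀.1)) := by fun_prop
    have hP := contDiff_perturb hφ hu hg p₀.1
    -- The factor `(t - t₀)²` vanishes on the old slice together with its `t`-derivative, so neither
    -- the arguments of `F` nor `ζ_t` change.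
    have hj₁ : jet (perturb φ u (fun z => a (z - p₀.1) * a (z - p₀.1)) p₀.1) p₀.1 ∈ f.locus := by
      refine locus_of_args_eq hj ?_ ?_
      · refine SliceZero.jet_args_eq ?_ hu hP
        rw [perturb_sub]
        exact Eventually.of_forall fun z hz => by simp [a, hz]
      · rw [jet_vortT_sub hu hP, perturb_sub, pd_mul (by fun_prop) hg, pd_mul (by fun_prop)
          (by fun_prop)]
        refine SliceZero.self (SliceZero.laplacian ?_ (by fun_prop))
        exact Eventually.of_forall fun z hz => by simp [a, hz]
    have hsurj : Function.Surjective (fderiv ℝ (baseMap φ u) p₀.1) :=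
      LinearMap.surjective_of_injective
        (f := (fderiv ℝ (baseMap φ u) p₀.1 : Indep →ₗ[ℝ] Indep))
        ((injective_iff_map_eq_zero _).2 hinj)
    obtain ⟨w₀, h0⟩ := hsurj (Pi.single 0 1)
    obtain ⟨w₁, h1⟩ := hsurj (Pi.single 1 1)
    obtain ⟨w₂, h2⟩ := hsurj (Pi.single 2 1)
    have ht := quadratic_test hφ hu (by rwa [hp0]) (by rwa [hp0]) hinj a a hj hj₁ h1 h2
    simp only [a, ContinuousLinearMap.proj_apply] at ht
    -- The test is a sum of two squares: the old time has zero derivative in the new space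
    -- directions.
    have hw1 : w₁ 0 = 0 := by nlinarith [mul_self_nonneg (w₁ 0), mul_self_nonneg (w₂ 0)]
    have hw2 : w₂ 0 = 0 := by nlinarith [mul_self_nonneg (w₁ 0), mul_self_nonneg (w₂ 0)]
    -- In the time component only `w₀` contributes. The direction `e₀` shows `w₀ 0 ≠ 0`, so the
    -- new-time component of the image of `e_j` is zero.
    have c0 := congrFun (eq_comb_of_images hinj h0 h1 h2 (Pi.single 0 1)) 0
    have cj := congrFun (eq_comb_of_images hinj h0 h1 h2 (Pi.single j 1)) 0
    simp [hw1, hw2, hj0.symm] at c0 cj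
    rcases cj with cj | cj
    · rw [hD] at cj
      simpa [Pi.single_apply] using cj
    · rw [cj] at c0; simp at c0
  exact eq_zero_of_eventually_slopes (l := (ContinuousLinearMap.proj (0 : Fin 3)).comp
    ((ContinuousLinearMap.fst ℝ Indep ℝ).comp (fderiv ℝ φ p₀))) key w hw

/-! ### Perturbations by functions with harmonic coefficient -/

/-- The segment from `z₀` to a point with the same time stays in the slice, and `τ` has zero
derivative along it. -/
theorem sliceZero_of_pd_eq_zero {τ : Indep → ℝ} (hτ : ContDiff ℝ ∞ τ) {z₀ : Indep} (h0 : τ z₀ = 0)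
    (h1 : pd 1 τ =ᶠ[𝓝 z₀] fun _ => 0) (h2 : pd 2 τ =ᶠ[𝓝 z₀] fun _ => 0) : SliceZero τ z₀ := by
  obtain ⟨r, hr, hb⟩ := Metric.eventually_nhds_iff_ball.1 (h1.and h2)
  filter_upwards [Metric.ball_mem_nhds z₀ hr] with z hz hz0
  have hl : ∀ s : ℝ, HasDerivAt (fun s : ℝ => τ (z₀ + s • (z - z₀)))
      (fderiv ℝ τ (z₀ + s • (z - z₀)) (z - z₀)) s := by
    intro s
    have : HasDerivAt (fun s : ℝ => z₀ + s • (z - z₀)) (z - z₀) s := by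
      simpa using ((hasDerivAt_id s).smul_const (z - z₀)).const_add z₀
    exact (hτ.differentiable (by simp) _).hasFDerivAt.comp_hasDerivAt s this
  have := constant_of_has_deriv_right_zero (f := fun s : ℝ => τ (z₀ + s • (z - z₀))) (a := 0)
    (b := 1) (fun s _ => (hl s).continuousAt.continuousWithinAt) (by
      intro s hs
      have hmem : z₀ + s • (z - z₀) ∈ Metric.ball z₀ r := by
        rw [Metric.mem_ball, dist_eq_norm] at hz ⊢
        rw [add_sub_cancel_left, norm_smul, Real.norm_of_nonneg hs.1]
        nlinarith [hs.2, norm_nonneg (z - z₀)]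
      obtain ⟨k1, k2⟩ := hb _ hmem
      have h3 := (hl s).hasDerivWithinAt (s := Ici s)
      rw [fderiv_eq_sum_pd, k1, k2] at h3
      simpa [hz0] using h3) 1 (by simp)
  simpa [h0] using this

/-- When the new time depends on `t` only, the perturbation vanishes on the old slice, so the
arguments of `F` are unchanged. Its Laplacian is the time increment times `Δg`, hence zero near
`z₀`, so `ζ_t` is unchanged as well. -/
theorem perturb_harmonic_mem_locus {f : VortEq} {φ : Base → Base} (hφ : ContDiff ℝ ∞ φ)
    {u g : Indep → ℝ} (hu : ContDiff ℝ ∞ u) (hg : ContDiff ℝ ∞ g) {z₀ : Indep}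
    (h1 : ∀ᶠ z in 𝓝 z₀, pd 1 (fun z => baseMap φ u z 0) z = 0 ∧
      pd 2 (fun z => baseMap φ u z 0) z = 0)
    (hh : laplacian g = fun _ => 0) (hj : jet u z₀ ∈ f.locus) :
    SliceZero (fun z => baseMap φ u z 0 - baseMap φ u z₀ 0) z₀ ∧
      jet (perturb φ u g z₀) z₀ ∈ f.locus := by
  have hB := contDiff_baseMap hφ hu
  have hP := contDiff_perturb hφ hu hg z₀
  have hτ : ContDiff ℝ ∞ (fun z => baseMap φ u z 0 - baseMap φ u z₀ 0) := by fun_prop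
  have t1 : pd 1 (fun z => baseMap φ u z 0 - baseMap φ u z₀ 0) =ᶠ[𝓝 z₀] fun _ => 0 := by
    filter_upwards [h1] with z hz
    rw [pd_sub (by fun_prop) (by fun_prop), pd_const]; simp only [hz.1, sub_zero]
  have t2 : pd 2 (fun z => baseMap φ u z 0 - baseMap φ u z₀ 0) =ᶠ[𝓝 z₀] fun _ => 0 := by
    filter_upwards [h1] with z hz
    rw [pd_sub (by fun_prop) (by fun_prop), pd_const]; simp only [hz.2, sub_zero]
  have hs := sliceZero_of_pd_eq_zero hτ (sub_self _) t1 t2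
  refine ⟨hs, locus_of_args_eq hj ?_ ?_⟩
  · refine SliceZero.jet_args_eq ?_ hu hP
    rw [perturb_sub]
    filter_upwards [hs] with z hz h0
    rw [hz h0, zero_mul]
  · rw [jet_vortT_sub hu hP, perturb_sub, ← pd_zero_laplacian (by fun_prop)]
    have key : ∀ τ : Indep → ℝ, ContDiff ℝ ∞ τ → pd 1 τ =ᶠ[𝓝 z₀] (fun _ => 0) →
        pd 2 τ =ᶠ[𝓝 z₀] (fun _ => 0) → laplacian (fun z => τ z * g z) =ᶠ[𝓝 z₀] fun _ => 0 := by
      intro τ hτ t1 t2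
      filter_upwards [t1, t2, pd_congr (i := 1) t1, pd_congr (i := 2) t2] with z k1 k2 k11 k22
      simp only [pd_const] at k11 k22
      have hz := congrFun hh z
      simp only [laplacian] at hz ⊢
      simp (disch := fun_prop) only [pd_mul, pd_add]
      rw [k1, k2, k11, k22]
      linear_combination τ z * hz
    rw [(pd_congr (key _ hτ t1 t2)).eq_of_nhds, pd_const]

/-- The conformality relations are quadratic in the slope in `x`. The coefficient of `s ^ 2`
contains only `p` and `q`, the `ψ`-derivatives of the two new space variables. -/
theorem slope_coeff_of_orth {a b p q x K : ℝ}
    (h : ∀ᶠ s in 𝓝 (0 : ℝ), (a + (x + s) * p) * (b + (x + s) * q) + K = 0) : p * q = 0 :=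
  (coeff_eq_zero_of_eventually (A := (a + x * p) * (b + x * q) + K)
    (B := (a + x * p) * q + (b + x * q) * p)
    (by filter_upwards [h] with s hs; linear_combination hs)).2.2

theorem slope_coeff_of_norm {a b p q x K K' : ℝ}
    (h : ∀ᶠ s in 𝓝 (0 : ℝ), (a + (x + s) * p) ^ 2 + K - ((b + (x + s) * q) ^ 2 + K') = 0) :
    p ^ 2 - q ^ 2 = 0 :=
  (coeff_eq_zero_of_eventually (A := (a + x * p) ^ 2 + K - ((b + x * q) ^ 2 + K'))
    (B := 2 * ((a + x * p) * p - (b + x * q) * q))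
    (by filter_upwards [h] with s hs; linear_combination hs)).2.2

theorem pd_baseMap {φ : Base → Base} (hφ : ContDiff ℝ ∞ φ) {u : Indep → ℝ}
    (hu : ContDiff ℝ ∞ u) (i k : Fin 3) (z : Indep) :
    pd i (fun z => baseMap φ u z k) z = (fderiv ℝ φ (z, u z) (Pi.single i 1, pd i u z)).1 k := by
  have h := fderiv_baseMap hφ hu z (Pi.single i 1)
  have e := (hasFDerivAt_apply (𝕜 := ℝ) k (baseMap φ u z)).comp z
    ((contDiff_baseMap hφ hu).differentiable (by simp) z).hasFDerivAt
  simp only [pd]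
  erw [e.fderiv, ContinuousLinearMap.comp_apply, h]; rfl

theorem eventually_graph {u : Indep → ℝ} (hu : ContDiff ℝ ∞ u) {p₀ : Base} (hu0 : u p₀.1 = p₀.2)
    {P : Base → Prop} (hP : ∀ᶠ p in 𝓝 p₀, P p) : ∀ᶠ z in 𝓝 p₀.1, P (z, u z) := by
  have hc : ContinuousAt (fun z => (z, u z)) p₀.1 :=
    continuousAt_id.prodMk hu.continuous.continuousAt
  have h : (p₀.1, u p₀.1) = p₀ := by rw [hu0]
  exact hc.eventually (by simpa only [h] using hP)

/-! ### Conformality of the space variables and the scale of `ψ`. -/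

/-- The new space variables do not depend on `ψ` and are conformal. -/
theorem conformal_of_admissible {f f' : VortEq} {φ : Base → Base} (hφ : ContDiff ℝ ∞ φ)
    {p₀ : Base} (hp : p₀ ∈ f.base) (hφinj : ∀ w, fderiv ℝ φ p₀ w = 0 → w = 0)
    (hmaps : ∀ j j' : Jet, j.pt = p₀ → Prolongs φ j j' → j ∈ f.locus → j' ∈ f'.locus)
    (htime : ∀ᶠ p in 𝓝 p₀, ∀ w : Base, w.1 0 = 0 → (fderiv ℝ φ p w).1 0 = 0) :
    (psiDeriv φ p₀).1 = 0 ∧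
    (fderiv ℝ φ p₀ (Pi.single 1 1, 0)).1 1 * (fderiv ℝ φ p₀ (Pi.single 1 1, 0)).1 2
      + (fderiv ℝ φ p₀ (Pi.single 2 1, 0)).1 1 * (fderiv ℝ φ p₀ (Pi.single 2 1, 0)).1 2 = 0 ∧
    (fderiv ℝ φ p₀ (Pi.single 1 1, 0)).1 1 ^ 2 + (fderiv ℝ φ p₀ (Pi.single 2 1, 0)).1 1 ^ 2
      = (fderiv ℝ φ p₀ (Pi.single 1 1, 0)).1 2 ^ 2
        + (fderiv ℝ φ p₀ (Pi.single 2 1, 0)).1 2 ^ 2 := by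
  obtain ⟨x, hx⟩ := exists_locus_function hp
  have key : ∀ᶠ y : Indep in 𝓝 x, (∀ w : Indep,
      (fderiv ℝ φ p₀ (w, ∑ i, y i * w i)).1 = 0 → w = 0) →
      ((fderiv ℝ φ p₀ (Pi.single 1 1, y 1)).1 1 * (fderiv ℝ φ p₀ (Pi.single 1 1, y 1)).1 2
      + (fderiv ℝ φ p₀ (Pi.single 2 1, y 2)).1 1 * (fderiv ℝ φ p₀ (Pi.single 2 1, y 2)).1 2 = 0 ∧
      (fderiv ℝ φ p₀ (Pi.single 1 1, y 1)).1 1 ^ 2 + (fderiv ℝ φ p₀ (Pi.single 2 1, y 2)).1 1 ^ 2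
      = (fderiv ℝ φ p₀ (Pi.single 1 1, y 1)).1 2 ^ 2
        + (fderiv ℝ φ p₀ (Pi.single 2 1, y 2)).1 2 ^ 2) := by
    filter_upwards [hx] with y ⟨u, hu, hu0, hy, hyi, hj⟩ hgood
    have hp0 : (p₀.1, u p₀.1) = p₀ := by rw [hu0]
    have hD := fderiv_baseMap_of_slopes hφ hu hu0 hy
    have hinj : ∀ w, fderiv ℝ (baseMap φ u) p₀.1 w = 0 → w = 0 := by
      intro w hw; rw [hD] at hw; exact hgood w hw
    have hB := contDiff_baseMap hφ hu
    have ht : ∀ᶠ z in 𝓝 p₀.1, pd 1 (fun z => baseMap φ u z 0) z = 0 ∧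
        pd 2 (fun z => baseMap φ u z 0) z = 0 := by
      filter_upwards [eventually_graph hu hu0 htime] with z hz
      rw [pd_baseMap hφ hu, pd_baseMap hφ hu]
      exact ⟨hz _ (by simp), hz _ (by simp)⟩
    have hsurj : Function.Surjective (fderiv ℝ (baseMap φ u) p₀.1) :=
      LinearMap.surjective_of_injective
        (f := (fderiv ℝ (baseMap φ u) p₀.1 : Indep →ₗ[ℝ] Indep))
        ((injective_iff_map_eq_zero _).2 hinj)
    obtain ⟨w₁, h1⟩ := hsurj (Pi.single 1 1)
    obtain ⟨w₂, h2⟩ := hsurj (Pi.single 2 1)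
    have test : ∀ a b : Indep →L[ℝ] ℝ,
        a (Pi.single 1 1) * b (Pi.single 1 1) + a (Pi.single 2 1) * b (Pi.single 2 1) = 0 →
        a w₁ * b w₁ + a w₂ * b w₂ = 0 := by
      intro a b hab
      have hg : ContDiff ℝ ∞ (fun z => a (z - p₀.1) * b (z - p₀.1)) := by fun_prop
      have hpl : ∀ (l : Indep →L[ℝ] ℝ) (i : Fin 3), pd i (fun z => l (z - p₀.1))
          = fun _ => l (Pi.single i 1) := by
        intro l i
        funext z
        have e := l.hasFDerivAt.comp z ((hasFDerivAt_id z).sub_const p₀.1)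
        simp only [pd]
        erw [e.fderiv]; rfl
      have hh : laplacian (fun z => a (z - p₀.1) * b (z - p₀.1)) = fun _ => 0 := by
        funext z
        simp only [laplacian]
        have ha : ContDiff ℝ ∞ (fun z => a (z - p₀.1)) := by fun_prop
        have hb : ContDiff ℝ ∞ (fun z => b (z - p₀.1)) := by fun_prop
        rw [pd_mul ha hb, pd_mul ha hb, hpl, hpl, hpl, hpl]
        rw [pd_add (by fun_prop) (by fun_prop), pd_add (by fun_prop) (by fun_prop),
          pd_mul (by fun_prop) (by fun_prop), pd_mul (by fun_prop) (by fun_prop),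
          pd_mul (by fun_prop) (by fun_prop), pd_mul (by fun_prop) (by fun_prop)]
        simp only [hpl, pd_const]
        linear_combination 2 * hab
      have hj₁ := (perturb_harmonic_mem_locus hφ hu hg ht hh hj).2
      exact quadratic_test hφ hu (by rwa [hp0]) (by rwa [hp0]) hinj a b hj hj₁ h1 h2
    let a₁ : Indep →L[ℝ] ℝ := ContinuousLinearMap.proj 1
    let a₂ : Indep →L[ℝ] ℝ := ContinuousLinearMap.proj 2
    -- The products `x y` and `(x - y)(x + y)` span the harmonic quadratic forms. They show that the
    -- new spatial gradients of the old `x` and `y` are orthogonal and of equal length.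
    have t1 : w₁ 1 * w₁ 2 + w₂ 1 * w₂ 2 = 0 := test a₁ a₂ (by simp [a₁, a₂])
    have t2 : (w₁ 1 - w₁ 2) * (w₁ 1 + w₁ 2) + (w₂ 1 - w₂ 2) * (w₂ 1 + w₂ 2) = 0 :=
      test (a₁ - a₂) (a₁ + a₂) (by simp [a₁, a₂, sub_apply, add_apply])
    have hz : ∀ j : Fin 3, j ≠ 0 → fderiv ℝ (baseMap φ u) p₀.1 (Pi.single j 1) 0 = 0 := by
      intro j hj0
      rw [fderiv_baseMap hφ hu, hp0]
      exact htime.self_of_nhds _ (by simp [hj0.symm])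
    have hcomp : ∀ (w : Indep) (k : Fin 3), fderiv ℝ (baseMap φ u) p₀.1 w k
        = w 0 * fderiv ℝ (baseMap φ u) p₀.1 (Pi.single 0 1) k
        + w 1 * fderiv ℝ (baseMap φ u) p₀.1 (Pi.single 1 1) k
        + w 2 * fderiv ℝ (baseMap φ u) p₀.1 (Pi.single 2 1) k := by
      intro w k
      conv_lhs => rw [indep_decomp w]
      simp only [map_add, map_smul, Pi.add_apply, Pi.smul_apply, smul_eq_mul]
    obtain ⟨w₀, h0⟩ := hsurj (Pi.single 0 1)
    have hne : fderiv ℝ (baseMap φ u) p₀.1 (Pi.single 0 1) 0 ≠ 0 := by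
      intro h
      have := hcomp w₀ 0
      rw [h0, h, hz 1 (by decide), hz 2 (by decide)] at this
      simp at this
    have hw0 : ∀ w : Indep, fderiv ℝ (baseMap φ u) p₀.1 w 0 = 0 → w 0 = 0 := by
      intro w hw
      rw [hcomp, hz 1 (by decide), hz 2 (by decide)] at hw
      simpa [hne] using hw
    have e1 := hw0 w₁ (by rw [h1]; simp)
    have e2 := hw0 w₂ (by rw [h2]; simp)
    have c11 := hcomp w₁ 1
    have c12 := hcomp w₁ 2
    have c21 := hcomp w₂ 1
    have c22 := hcomp w₂ 2
    rw [h1, e1] at c11 c12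
    rw [h2, e2] at c21 c22
    simp only [Pi.single_apply, zero_mul, zero_add] at c11 c12 c21 c22
    simp at c11 c12 c21 c22
    have hM : ∀ j : Fin 3, fderiv ℝ (baseMap φ u) p₀.1 (Pi.single j 1)
        = (fderiv ℝ φ p₀ (Pi.single j 1, y j)).1 := by
      intro j
      rw [hD]; simp [Pi.single_apply]
    simp only [← hM]
    -- The relations found concern the old variables as functions of the new ones; inverting the
    -- matrix transfers them to the new variables.
    exact conformal_inverse (p := w₁ 1) (q := w₂ 1) (r := w₁ 2) (s := w₂ 2) t1
      (by linear_combination t2) (by linear_combination -c11) (by linear_combination -c21)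
      (by linear_combination -c12) (by linear_combination -c22)
  have hQ1 := eq_zero_of_generic hφinj (x := x)
    (Q := fun y => (fderiv ℝ φ p₀ (Pi.single 1 1, y 1)).1 1 * (fderiv ℝ φ p₀ (Pi.single 1 1, y 1)).1 2
      + (fderiv ℝ φ p₀ (Pi.single 2 1, y 2)).1 1 * (fderiv ℝ φ p₀ (Pi.single 2 1, y 2)).1 2)
    (by fun_prop) (key.mono fun y hy hg => (hy hg).1)
  have hQ2 := eq_zero_of_generic hφinj (x := x)
    (Q := fun y => (fderiv ℝ φ p₀ (Pi.single 1 1, y 1)).1 1 ^ 2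
      + (fderiv ℝ φ p₀ (Pi.single 2 1, y 2)).1 1 ^ 2
      - ((fderiv ℝ φ p₀ (Pi.single 1 1, y 1)).1 2 ^ 2
        + (fderiv ℝ φ p₀ (Pi.single 2 1, y 2)).1 2 ^ 2))
    (by fun_prop) (key.mono fun y hy hg => sub_eq_zero.2 (hy hg).2)
  have e : ∀ (j k : Fin 3) (r : ℝ), (fderiv ℝ φ p₀ (Pi.single j 1, r)).1 k
      = (fderiv ℝ φ p₀ (Pi.single j 1, 0)).1 k + r * (psiDeriv φ p₀).1 k := by
    intro j k r
    have : ((Pi.single j 1, r) : Base) = (Pi.single j 1, 0) + r • ((0 : Indep), (1:ℝ)) :=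
      Prod.ext (by simp) (by simp)
    rw [this, map_add, map_smul]; rfl
  have s1 := eventually_shift hQ1 1
  have s2 := eventually_shift hQ2 1
  have x1 : ∀ s : ℝ, (x + s • (Pi.single 1 1 : Indep)) 1 = x 1 + s := by intro s; simp
  have x2 : ∀ s : ℝ, (x + s • (Pi.single 1 1 : Indep)) 2 = x 2 := by intro s; simp
  simp only [x1, x2, e 1 _ (_ + _)] at s1 s2
  -- The two leading coefficients give `p q = 0` and `p² = q²`, so both `ψ`-derivatives vanish.
  have k1 := slope_coeff_of_orth s1
  have k2 := slope_coeff_of_norm s2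
  have P1 : (psiDeriv φ p₀).1 1 = 0 := by
    rcases mul_eq_zero.1 k1 with h | h
    · exact h
    · rw [h] at k2; simpa using k2
  have P2 : (psiDeriv φ p₀).1 2 = 0 := by rw [P1] at k2; simpa using k2
  have P0 : (psiDeriv φ p₀).1 0 = 0 := htime.self_of_nhds _ rfl
  have f1 := hQ1.self_of_nhds
  have f2 := hQ2.self_of_nhds
  rw [e 1 1 (x 1), e 1 2 (x 1), e 2 1 (x 2), e 2 2 (x 2), P1, P2] at f1 f2
  simp only [mul_zero, add_zero] at f1 f2
  refine ⟨?_, f1, sub_eq_zero.1 f2⟩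
  funext k
  fin_cases k
  · exact P0
  · exact P1
  · exact P2

/-- `Ψ_ψ` depends on `t` only. -/
theorem scale_of_admissible {f f' : VortEq} {φ : Base → Base} (hφ : ContDiff ℝ ∞ φ)
    {p₀ : Base} (hp : p₀ ∈ f.base) (hφinj : ∀ w, fderiv ℝ φ p₀ w = 0 → w = 0)
    (hmaps : ∀ j j' : Jet, j.pt = p₀ → Prolongs φ j j' → j ∈ f.locus → j' ∈ f'.locus)
    (htime : ∀ᶠ p in 𝓝 p₀, ∀ w : Base, w.1 0 = 0 → (fderiv ℝ φ p w).1 0 = 0)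
    (hconf : ∀ᶠ p in 𝓝 p₀, (psiDeriv φ p).1 = 0 ∧
      (fderiv ℝ φ p (Pi.single 1 1, 0)).1 1 * (fderiv ℝ φ p (Pi.single 1 1, 0)).1 2
        + (fderiv ℝ φ p (Pi.single 2 1, 0)).1 1 * (fderiv ℝ φ p (Pi.single 2 1, 0)).1 2 = 0 ∧
      (fderiv ℝ φ p (Pi.single 1 1, 0)).1 1 ^ 2 + (fderiv ℝ φ p (Pi.single 2 1, 0)).1 1 ^ 2
        = (fderiv ℝ φ p (Pi.single 1 1, 0)).1 2 ^ 2
          + (fderiv ℝ φ p (Pi.single 2 1, 0)).1 2 ^ 2)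
    (w : Base) (hw : w.1 0 = 0) : fderiv ℝ (fun p => (psiDeriv φ p).2) p₀ w = 0 := by
  obtain ⟨x, hx⟩ := exists_locus_function hp
  refine eq_zero_of_eventually_slopes (x := x) ?_ w hw
  intro i hi
  have hΨ : ContDiff ℝ ∞ (fun p => (psiDeriv φ p).2) := by fun_prop
  refine eq_zero_of_generic hφinj
    (Q := fun y => fderiv ℝ (fun p => (psiDeriv φ p).2) p₀ (Pi.single i 1, y i)) (by fun_prop) ?_
  filter_upwards [hx] with y ⟨u, hu, hu0, hy, hyi, hj⟩ hgood
  have hp0 : (p₀.1, u p₀.1) = p₀ := by rw [hu0]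
  have hD := fderiv_baseMap_of_slopes hφ hu hu0 hy
  have hinj : ∀ w, fderiv ℝ (baseMap φ u) p₀.1 w = 0 → w = 0 := by
    intro w hw; rw [hD] at hw; exact hgood w hw
  have hB := contDiff_baseMap hφ hu
  have ht : ∀ᶠ z in 𝓝 p₀.1, pd 1 (fun z => baseMap φ u z 0) z = 0 ∧
      pd 2 (fun z => baseMap φ u z 0) z = 0 := by
    filter_upwards [eventually_graph hu hu0 htime] with z hz
    rw [pd_baseMap hφ hu, pd_baseMap hφ hu]
    exact ⟨hz _ (by simp), hz _ (by simp)⟩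
  have hpd : ∀ z, (psiDeriv φ (z, u z)).1 = 0 → ∀ j k, pd j (fun z => baseMap φ u z k) z
      = (fderiv ℝ φ (z, u z) (Pi.single j 1, 0)).1 k := by
    intro z hz j k
    rw [pd_baseMap hφ hu]
    have : ((Pi.single j 1, pd j u z) : Base)
        = (Pi.single j 1, 0) + pd j u z • ((0 : Indep), (1:ℝ)) := Prod.ext (by simp) (by simp)
    rw [this, map_add, map_smul]
    change _ + (pd j u z • (psiDeriv φ (z, u z)).1) k = _
    rw [hz]; simp
  have hcg := eventually_graph hu hu0 hconf
  have hC : ConformalNear (baseMap φ u) p₀.1 := by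
    refine ⟨hB, ht, ?_, ?_, ?_⟩
    · filter_upwards [hcg] with z hz
      simp only [hpd z hz.1]; exact hz.2.1
    · filter_upwards [hcg] with z hz
      simp only [hpd z hz.1]; exact hz.2.2
    · intro h0
      have hz := hcg.self_of_nhds
      have h1 := hz.2.2
      simp only [confFactor] at h0
      have a1 : pd 1 (fun z => baseMap φ u z 1) p₀.1 = 0 := by
        nlinarith [sq_nonneg (pd 1 (fun z => baseMap φ u z 1) p₀.1),
          sq_nonneg (pd 2 (fun z => baseMap φ u z 1) p₀.1)]
      simp only [← hpd _ hz.1] at h1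
      rw [h0] at h1
      have a2 : pd 1 (fun z => baseMap φ u z 2) p₀.1 = 0 := by
        nlinarith [sq_nonneg (pd 1 (fun z => baseMap φ u z 2) p₀.1),
          sq_nonneg (pd 2 (fun z => baseMap φ u z 2) p₀.1)]
      have a0 := ht.self_of_nhds.1
      have : fderiv ℝ (baseMap φ u) p₀.1 (Pi.single 1 1) = 0 := by
        rw [pd_baseMap hφ hu] at a0 a1 a2
        rw [fderiv_baseMap hφ hu]
        funext k
        fin_cases k
        · exact a0
        · exact a1
        · exact a2
      have := congrFun (hinj _ this) 1
      simp at this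
  have hg : ContDiff ℝ ∞ (fun z : Indep => z i - p₀.1 i) := by fun_prop
  have hpg : ∀ j, pd j (fun z : Indep => z i - p₀.1 i) = fun _ => if i = j then 1 else 0 := by
    intro j
    rw [pd_sub (by fun_prop) (by fun_prop), pd_coord, pd_const]; simp
  have hh : laplacian (fun z : Indep => z i - p₀.1 i) = fun _ => 0 := by
    funext z
    simp only [laplacian, hpg, pd_const, add_zero]
  obtain ⟨hτ, hj₁⟩ := perturb_harmonic_mem_locus hφ hu hg ht hh hj
  obtain ⟨Y, v, v₁, hY, hv, hv₁, hY0, hYl, hYr, hvu, P, P₁, hs, hk⟩ :=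
    exists_perturbed_prolongation hφ hu hg (by simp) hinj
  have hlap := laplacian_eq_zero_of_locus hmaps hj hj₁ hp0
    (by rw [perturb_eq rfl, hp0]) hv hv₁ P P₁ hs
  have hkc := contDiff_pd (i := 0) (hv₁.sub hv)
  -- By conformality the vanishing of the new Laplacian of `k` means that `k` composed with the
  -- change of variables has zero old Laplacian at `p₀.1`.
  have h1 := hC.laplacian_comp hkc
  erw [hlap, mul_zero] at h1
  have hF : ContDiff ℝ ∞ (fun z => (psiDeriv φ (z, u z)).2) := by fun_prop
  -- The new independent variables do not involve `ψ`, so here `m = 0` and `c = Ψ_ψ`.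
  have h2 : SliceZero (fun z => (fun z => pd 0 (fun z' => v₁ z' - v z') (baseMap φ u z)) z
      - (z i - p₀.1 i) * (psiDeriv φ (z, u z)).2) p₀.1 := by
    filter_upwards [hτ, hYl, hB.continuous.continuousAt.eventually hk, hcg] with z k1 k2 k3 k4 k0
    have := k3 (sub_eq_zero.1 (k1 k0))
    rw [k2, k4.1] at this
    simpa using this
  have h3 := h2.laplacian_eq (hkc.comp hB) (by fun_prop)
  erw [h1] at h3
  have h4 := fderiv_graph hΨ hu p₀.1 (Pi.single i 1)
  rw [hp0] at h4
  have h5 : fderiv ℝ u p₀.1 (Pi.single i 1) = y i := hyi i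
  rw [h5] at h4
  rw [← h4]
  -- For `g = z_i - z_i⁰` the Laplacian of `g Ψ_ψ` at the base point is twice the derivative of
  -- `Ψ_ψ` along the graph in the direction `i`.
  change pd i (fun z => (psiDeriv φ (z, u z)).2) p₀.1 = 0
  simp only [laplacian] at h3
  rw [pd_mul hg hF, pd_mul hg hF, pd_add (by fun_prop) (by fun_prop),
    pd_add (by fun_prop) (by fun_prop), pd_mul (by fun_prop) (by fun_prop),
    pd_mul (by fun_prop) (by fun_prop), pd_mul (by fun_prop) (by fun_prop),
    pd_mul (by fun_prop) (by fun_prop)] at h3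
  simp only [hpg, pd_const] at h3
  have hi' : i = 1 ∨ i = 2 := by revert hi; fin_cases i <;> simp
  rcases hi' with rfl | rfl
  · simp at h3; linarith
  · simp at h3; linarith

/-! ### The conditions on the derivatives of an admissible transformation. -/

/-- The infinitesimal form at `p` of the transformations of the explicit family. -/
structure InfExplicit (φ : Base → Base) (p : Base) : Prop where
  time : ∀ w : Base, w.1 0 = 0 → (fderiv ℝ φ p w).1 0 = 0
  space : (psiDeriv φ p).1 = 0
  orth : (fderiv ℝ φ p (Pi.single 1 1, 0)).1 1 * (fderiv ℝ φ p (Pi.single 1 1, 0)).1 2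
    + (fderiv ℝ φ p (Pi.single 2 1, 0)).1 1 * (fderiv ℝ φ p (Pi.single 2 1, 0)).1 2 = 0
  norm : (fderiv ℝ φ p (Pi.single 1 1, 0)).1 1 ^ 2 + (fderiv ℝ φ p (Pi.single 2 1, 0)).1 1 ^ 2
    = (fderiv ℝ φ p (Pi.single 1 1, 0)).1 2 ^ 2 + (fderiv ℝ φ p (Pi.single 2 1, 0)).1 2 ^ 2
  scale : ∀ w : Base, w.1 0 = 0 → fderiv ℝ (fun p => (psiDeriv φ p).2) p w = 0

theorem VortEq.isOpen_base (f : VortEq) : IsOpen f.base :=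
  isOpenMap_fst _ f.isOpen_dom

theorem IsPointTransformation.fderiv_injective {Ω : Set Base} {φ : Base → Base}
    (h : IsPointTransformation Ω φ) {p : Base} (hp : p ∈ Ω) :
    ∀ w, fderiv ℝ φ p w = 0 → w = 0 := by
  intro w hw
  by_contra hne
  have hdet := h.jacobian p hp
  have hinj : Function.Injective (fderiv ℝ φ p : Base →ₗ[ℝ] Base) := by
    have hu : IsUnit (LinearMap.det (fderiv ℝ φ p : Base →ₗ[ℝ] Base)) := isUnit_iff_ne_zero.2 hdet
    exact ((Module.End.isUnit_iff _).1 ((LinearMap.isUnit_iff_isUnit_det _).2 hu)).1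
  exact hne (hinj (by simpa using hw))

theorem _root_.ContDiffOn.eventually_contDiffAt {E F : Type*} [NormedAddCommGroup E] [NormedSpace ℝ E]
    [NormedAddCommGroup F] [NormedSpace ℝ F] {f : E → F} {s : Set E} (hf : ContDiffOn ℝ ∞ f s)
    (hs : IsOpen s) {x : E} (hx : x ∈ s) : ∀ᶠ y in 𝓝 x, ContDiffAt ℝ ∞ f y := by
  filter_upwards [hs.mem_nhds hx] with y hy
  exact hf.contDiffAt (hs.mem_nhds hy)

/-- Admissible transformations have the explicit form infinitesimally. -/
theorem IsAdmissible.infExplicit {f f' : VortEq} {φ : Base → Base} (h : IsAdmissible f f' φ)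
    {p : Base} (hp : p ∈ f.base) : InfExplicit φ p := by
  have hopen := f.isOpen_base
  have hglob : ∀ q ∈ f.base, ∃ φ' : Base → Base, ContDiff ℝ ∞ φ' ∧ φ' =ᶠ[𝓝 q] φ ∧
      (∀ w, fderiv ℝ φ' q w = 0 → w = 0) ∧
      ∀ j j' : Jet, j.pt = q → Prolongs φ' j j' → j ∈ f.locus → j' ∈ f'.locus := by
    intro q hq
    obtain ⟨φ', h1, h2⟩ := exists_contDiff_eventuallyEq
      (h.point.smooth.eventually_contDiffAt hopen hq)
    refine ⟨φ', h1, h2, ?_, ?_⟩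
    · rw [h2.fderiv_eq]; exact h.point.fderiv_injective hq
    · intro j j' hj hP
      have hP' : Prolongs φ j j' := hP.congr (by rw [hj]; exact h2.symm)
      exact (h.maps j j' (by rw [hj]; exact hq) hP').1
  have htime : ∀ q ∈ f.base, ∀ w : Base, w.1 0 = 0 → (fderiv ℝ φ q w).1 0 = 0 := by
    intro q hq
    obtain ⟨φ', h1, h2, h3, h4⟩ := hglob q hq
    rw [← h2.fderiv_eq]
    exact time_of_admissible h1 hq h3 h4
  have hconf : ∀ q ∈ f.base, (psiDeriv φ q).1 = 0 ∧
      (fderiv ℝ φ q (Pi.single 1 1, 0)).1 1 * (fderiv ℝ φ q (Pi.single 1 1, 0)).1 2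
        + (fderiv ℝ φ q (Pi.single 2 1, 0)).1 1 * (fderiv ℝ φ q (Pi.single 2 1, 0)).1 2 = 0 ∧
      (fderiv ℝ φ q (Pi.single 1 1, 0)).1 1 ^ 2 + (fderiv ℝ φ q (Pi.single 2 1, 0)).1 1 ^ 2
        = (fderiv ℝ φ q (Pi.single 1 1, 0)).1 2 ^ 2
          + (fderiv ℝ φ q (Pi.single 2 1, 0)).1 2 ^ 2 := by
    intro q hq
    obtain ⟨φ', h1, h2, h3, h4⟩ := hglob q hq
    have := conformal_of_admissible h1 hq h3 h4 (by
      filter_upwards [h2.eventuallyEq_nhds, hopen.mem_nhds hq] with q' e1 e2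
      rw [e1.fderiv_eq]; exact htime q' e2)
    simpa only [psiDeriv, h2.fderiv_eq] using this
  obtain ⟨φ', h1, h2, h3, h4⟩ := hglob p hp
  have hc := hconf p hp
  refine ⟨htime p hp, hc.1, hc.2.1, hc.2.2, ?_⟩
  have := scale_of_admissible h1 hp h3 h4 (by
      filter_upwards [h2.eventuallyEq_nhds, hopen.mem_nhds hp] with q' e1 e2
      rw [e1.fderiv_eq]; exact htime q' e2) (by
      filter_upwards [h2.eventuallyEq_nhds, hopen.mem_nhds hp] with q' e1 e2
      simp only [psiDeriv, e1.fderiv_eq]; exact hconf q' e2)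
  have e : (fun p => (psiDeriv φ' p).2) =ᶠ[𝓝 p] fun p => (psiDeriv φ p).2 := by
    filter_upwards [h2.eventuallyEq_nhds] with q e1
    simp only [psiDeriv, e1.fderiv_eq]
  rw [← e.fderiv_eq]
  exact this

/-! ### From the infinitesimal to the explicit form -/

theorem eq_of_fderiv_segment {E : Type*} [NormedAddCommGroup E] [NormedSpace ℝ E] {h : E → ℝ}
    {p q : E} (hd : ∀ s ∈ Icc (0:ℝ) 1, DifferentiableAt ℝ h (p + s • (q - p)))
    (h0 : ∀ s ∈ Icc (0:ℝ) 1, fderiv ℝ h (p + s • (q - p)) (q - p) = 0) : h q = h p := by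
  have hl : ∀ s ∈ Icc (0:ℝ) 1, HasDerivAt (fun s : ℝ => h (p + s • (q - p))) 0 s := by
    intro s hs
    have : HasDerivAt (fun s : ℝ => p + s • (q - p)) (q - p) s := by
      simpa using ((hasDerivAt_id s).smul_const (q - p)).const_add p
    rw [← h0 s hs]
    exact (hd s hs).hasFDerivAt.comp_hasDerivAt s this
  have := constant_of_has_deriv_right_zero (f := fun s : ℝ => h (p + s • (q - p))) (a := 0)
    (b := 1) (fun s hs => (hl s hs).continuousAt.continuousWithinAt)
    (fun s hs => (hl s (Ico_subset_Icc_self hs)).hasDerivWithinAt) 1 (by simp)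
  simpa using this

/-- The set `S` will be a section of `Ω` without interior points. Hence only derivatives along
differences of points of `S` are assumed to vanish, at all points of `Ω` on the connecting lines.
Segments inside a ball in `Ω` give local constancy on `S`. -/
theorem eq_of_fderiv_of_isPreconnected {E : Type*} [NormedAddCommGroup E] [NormedSpace ℝ E]
    {Ω S : Set E} (hS : IsPreconnected S) (hΩ : IsOpen Ω) (hSΩ : S ⊆ Ω) {h : E → ℝ}
    (hd : ∀ x ∈ Ω, DifferentiableAt ℝ h x)
    (h0 : ∀ p ∈ S, ∀ q ∈ S, ∀ s : ℝ, p + s • (q - p) ∈ Ω →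
      fderiv ℝ h (p + s • (q - p)) (q - p) = 0) {p q : E} (hp : p ∈ S) (hq : q ∈ S) :
    h p = h q := by
  have : PreconnectedSpace S := isPreconnected_iff_preconnectedSpace.1 hS
  have hloc : IsLocallyConstant (fun x : S => h x) := by
    rw [IsLocallyConstant.iff_eventually_eq]
    intro x
    obtain ⟨r, hr, hb⟩ := Metric.isOpen_iff.1 hΩ x (hSΩ x.2)
    filter_upwards [Metric.ball_mem_nhds x hr] with y hy
    have hmem : ∀ s ∈ Icc (0:ℝ) 1, (x : E) + s • ((y : E) - x) ∈ Ω := by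
      intro s hs
      apply hb
      have hy' : dist (y : E) x < r := hy
      rw [Metric.mem_ball, dist_eq_norm, add_sub_cancel_left, norm_smul, Real.norm_of_nonneg hs.1]
      rw [dist_eq_norm] at hy'
      nlinarith [hs.2, norm_nonneg ((y : E) - x)]
    exact eq_of_fderiv_segment (fun s hs => hd _ (hmem s hs))
      (fun s hs => h0 x x.2 y y.2 s (hmem s hs))
  exact hloc.apply_eq_of_preconnectedSpace ⟨p, hp⟩ ⟨q, hq⟩

/-- The functions that determine a transformation of the explicit family. -/
structure Data where
  T : ℝ → ℝ
  Υ : ℝ → ℝ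
  Z₁ : Indep → ℝ
  Z₂ : Indep → ℝ
  Φ : Indep → ℝ

/-- `φ` has over `Ω` the explicit form with the functions `D`. -/
structure Represents (D : Data) (Ω : Set Base) (φ : Base → Base) : Prop where
  smooth_T : ContDiffOn ℝ ∞ D.T ((fun p : Base => p.1 0) '' Ω)
  smooth_Υ : ContDiffOn ℝ ∞ D.Υ ((fun p : Base => p.1 0) '' Ω)
  smooth_Z₁ : ContDiffOn ℝ ∞ D.Z₁ (Prod.fst '' Ω)
  smooth_Z₂ : ContDiffOn ℝ ∞ D.Z₂ (Prod.fst '' Ω)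
  smooth_Φ : ContDiffOn ℝ ∞ D.Φ (Prod.fst '' Ω)
  form : ∀ p ∈ Ω,
    pd 1 D.Z₁ p.1 * pd 1 D.Z₂ p.1 + pd 2 D.Z₁ p.1 * pd 2 D.Z₂ p.1 = 0 ∧
    pd 1 D.Z₁ p.1 ^ 2 + pd 2 D.Z₁ p.1 ^ 2 = pd 1 D.Z₂ p.1 ^ 2 + pd 2 D.Z₂ p.1 ^ 2 ∧
    deriv D.T (p.1 0) * D.Υ (p.1 0) * confFactor D.Z₁ p.1 ≠ 0 ∧
    φ p = (![D.T (p.1 0), D.Z₁ p.1, D.Z₂ p.1], D.Υ (p.1 0) * p.2 + D.Φ p.1)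

theorem isExplicit_iff {Ω : Set Base} {φ : Base → Base} {E : Jet → ℝ → ℝ} :
    IsExplicit Ω φ E ↔ InjOn φ Ω ∧ ∃ D : Data, Represents D Ω φ ∧
      ∀ j : Jet, j.pt ∈ Ω → ∀ s : ℝ, E j s = newF D.T D.Υ D.Z₁ D.Z₂ D.Φ j s := by
  constructor
  · rintro ⟨h, T, Υ, Z₁, Z₂, Φ, h1, h2, h3, h4, h5, h6, h7⟩
    exact ⟨h, ⟨T, Υ, Z₁, Z₂, Φ⟩, ⟨h1, h2, h3, h4, h5, h6⟩, h7⟩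
  · rintro ⟨h, ⟨T, Υ, Z₁, Z₂, Φ⟩, ⟨h1, h2, h3, h4, h5, h6⟩, h7⟩
    exact ⟨h, T, Υ, Z₁, Z₂, Φ, h1, h2, h3, h4, h5, h6, h7⟩

/-- Transformations that have the explicit form infinitesimally have it over domains with
connected sections. -/
theorem exists_represents {Ω : Set Base} (hΩ : IsBaseDomain Ω) {φ : Base → Base}
    (hφ : ContDiffOn ℝ ∞ φ Ω) (hinj : ∀ p ∈ Ω, ∀ w, fderiv ℝ φ p w = 0 → w = 0)
    (hinf : ∀ p ∈ Ω, InfExplicit φ p) : ∃ D : Data, Represents D Ω φ := by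
  have hopen := hΩ.isOpen
  have hcd : ∀ p ∈ Ω, ContDiffAt ℝ ∞ φ p := fun p hp => hφ.contDiffAt (hopen.mem_nhds hp)
  have hdiff : ∀ p ∈ Ω, DifferentiableAt ℝ φ p := fun p hp =>
    (hcd p hp).differentiableAt (by simp)
  have hcdψ : ∀ p ∈ Ω, ContDiffAt ℝ ∞ (psiDeriv φ) p := fun p hp =>
    ((hcd p hp).fderiv_right (m := ∞) (by simp)).clm_apply contDiffAt_const
  have hdk : ∀ k : Fin 3, ∀ p ∈ Ω, DifferentiableAt ℝ (fun p => (φ p).1 k) p := by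
    intro k p hp; have := hdiff p hp; fun_prop
  have hfk : ∀ k : Fin 3, ∀ p ∈ Ω, ∀ w, fderiv ℝ (fun p => (φ p).1 k) p w
      = (fderiv ℝ φ p w).1 k := by
    intro k p hp w
    have e := (hasFDerivAt_apply (𝕜 := ℝ) k (φ p).1).comp p
      (hasFDerivAt_fst.comp p (hdiff p hp).hasFDerivAt)
    erw [e.fderiv]; rfl
  have hzconn : ∀ z : Indep, IsPreconnected {p : Base | p ∈ Ω ∧ p.1 = z} := by
    intro z
    have : {p : Base | p ∈ Ω ∧ p.1 = z} = (fun s : ℝ => (z, s)) '' {s : ℝ | (z, s) ∈ Ω} := by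
      ext ⟨a, b⟩
      simp only [mem_ofPred_eq, mem_image, Prod.mk.injEq]
      constructor
      · rintro ⟨h, rfl⟩; exact ⟨b, h, rfl, rfl⟩
      · rintro ⟨s, h, rfl, rfl⟩; exact ⟨h, rfl⟩
    rw [this]
    exact (hΩ.section_z z).image _ (by fun_prop)
  -- the functions are constant on the sections
  have cT : ∀ p ∈ Ω, ∀ q ∈ Ω, p.1 0 = q.1 0 → (φ p).1 0 = (φ q).1 0 := by
    intro p hp q hq h
    refine eq_of_fderiv_of_isPreconnected (hΩ.section_t (q.1 0)) hopen (fun x hx => hx.1) (hdk 0) ?_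
      ⟨hp, h⟩ ⟨hq, rfl⟩
    intro a ha b hb s hs
    rw [hfk 0 _ hs]
    exact (hinf _ hs).time _ (by simp [ha.2, hb.2])
  have cΥ : ∀ p ∈ Ω, ∀ q ∈ Ω, p.1 0 = q.1 0 → (psiDeriv φ p).2 = (psiDeriv φ q).2 := by
    intro p hp q hq h
    refine eq_of_fderiv_of_isPreconnected (h := fun p => (psiDeriv φ p).2)
      (hΩ.section_t (q.1 0)) hopen (fun x hx => hx.1) ?_ ?_ ⟨hp, h⟩ ⟨hq, rfl⟩
    · intro x hx; have := (hcdψ x hx).differentiableAt (by simp); fun_prop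
    · intro a ha b hb s hs
      exact (hinf _ hs).scale _ (by simp [ha.2, hb.2])
  have hvert : ∀ a b : Base, a.1 = b.1 → b - a = (b.2 - a.2) • ((0 : Indep), (1:ℝ)) := by
    intro a b h; exact Prod.ext (by simp [h]) (by simp)
  have cZ : ∀ k, ∀ p ∈ Ω, ∀ q ∈ Ω, p.1 = q.1 → (φ p).1 k = (φ q).1 k := by
    intro k p hp q hq h
    refine eq_of_fderiv_of_isPreconnected (hzconn q.1) hopen (fun x hx => hx.1) (hdk k) ?_
      ⟨hp, h⟩ ⟨hq, rfl⟩
    intro a ha b hb s hs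
    rw [hfk k _ hs, hvert a b (by rw [ha.2, hb.2]), map_smul]
    have := (hinf _ hs).space
    rw [psiDeriv, hvert a b (by rw [ha.2, hb.2])] at this
    rw [Prod.smul_fst, this]; simp
  have cΦ : ∀ p ∈ Ω, ∀ q ∈ Ω, p.1 = q.1 →
      (φ p).2 - (psiDeriv φ p).2 * p.2 = (φ q).2 - (psiDeriv φ q).2 * q.2 := by
    intro p hp q hq h
    have hpq := cΥ p hp q hq (by rw [h])
    rw [hpq]
    refine eq_of_fderiv_of_isPreconnected (h := fun x => (φ x).2 - (psiDeriv φ q).2 * x.2)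
      (hzconn q.1) hopen (fun x hx => hx.1) ?_ ?_ ⟨hp, h⟩ ⟨hq, rfl⟩
    · intro x hx; have := hdiff x hx; fun_prop
    · intro a ha b hb s hs
      have e1 := (hasFDerivAt_snd (𝕜 := ℝ)).comp _ (hdiff _ hs).hasFDerivAt
      have e2 := e1.sub ((hasFDerivAt_snd (𝕜 := ℝ) (p := a + s • (b - a))).const_mul
        (psiDeriv φ q).2)
      have e3 : HasFDerivAt (fun x => (φ x).2 - (psiDeriv φ q).2 * x.2) _ (a + s • (b - a)) := e2
      have e4 := cΥ _ hs q hq (by simp [ha.2, hb.2])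
      rw [e3.fderiv, ← e4]
      generalize a + s • (b - a) = x
      rw [hvert a b (by rw [ha.2, hb.2])]
      rw [map_smul]
      change _ • ((fderiv ℝ φ x (0, 1)).2 - (fderiv ℝ φ x (0, 1)).2 * 1) = 0
      simp
  -- By constancy on the sections these functions descend to the projections of `Ω`; elsewhere their
  -- value is the irrelevant `0`.
  let T : ℝ → ℝ := Function.extend (fun p : Ω => p.1.1 0) (fun p => (φ p.1).1 0) 0
  let Υ : ℝ → ℝ := Function.extend (fun p : Ω => p.1.1 0) (fun p => (psiDeriv φ p.1).2) 0
  let Z : Fin 3 → Indep → ℝ := fun k =>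
    Function.extend (fun p : Ω => p.1.1) (fun p => (φ p.1).1 k) 0
  let Φ : Indep → ℝ := Function.extend (fun p : Ω => p.1.1)
    (fun p => (φ p.1).2 - (psiDeriv φ p.1).2 * p.1.2) 0
  have hT : ∀ p ∈ Ω, T (p.1 0) = (φ p).1 0 := fun p hp =>
    Function.FactorsThrough.extend_apply (f := fun p : Ω => p.1.1 0)
      (g := fun p : Ω => (φ p.1).1 0) (fun a b h => cT a a.2 b b.2 h) 0 ⟨p, hp⟩
  have hΥ : ∀ p ∈ Ω, Υ (p.1 0) = (psiDeriv φ p).2 := fun p hp =>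
    Function.FactorsThrough.extend_apply (f := fun p : Ω => p.1.1 0)
      (g := fun p : Ω => (psiDeriv φ p.1).2) (fun a b h => cΥ a a.2 b b.2 h) 0 ⟨p, hp⟩
  have hZ : ∀ k, ∀ p ∈ Ω, Z k p.1 = (φ p).1 k := fun k p hp =>
    Function.FactorsThrough.extend_apply (f := fun p : Ω => p.1.1)
      (g := fun p : Ω => (φ p.1).1 k) (fun a b h => cZ k a a.2 b b.2 h) 0 ⟨p, hp⟩
  have hΦ : ∀ p ∈ Ω, Φ p.1 = (φ p).2 - (psiDeriv φ p).2 * p.2 := fun p hp =>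
    Function.FactorsThrough.extend_apply (f := fun p : Ω => p.1.1)
      (g := fun p : Ω => (φ p.1).2 - (psiDeriv φ p.1).2 * p.1.2)
      (fun a b h => cΦ a a.2 b b.2 h) 0 ⟨p, hp⟩
  -- local expressions
  have lt : ∀ p ∈ Ω, ∀ᶠ t in 𝓝 (p.1 0),
      (p.1 + (t - p.1 0) • (Pi.single 0 1 : Indep), p.2) ∈ Ω := by
    intro p hp
    have hc : Continuous (fun t : ℝ => ((p.1 + (t - p.1 0) • (Pi.single 0 1 : Indep), p.2) : Base)) := by
      fun_prop
    exact hc.continuousAt.eventually (by simpa using hopen.mem_nhds hp)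
  have lz : ∀ p ∈ Ω, ∀ᶠ z in 𝓝 p.1, ((z, p.2) : Base) ∈ Ω := by
    intro p hp
    have hc : Continuous (fun z : Indep => ((z, p.2) : Base)) := by fun_prop
    exact hc.continuousAt.eventually (hopen.mem_nhds hp)
  have lT : ∀ p ∈ Ω, T =ᶠ[𝓝 (p.1 0)]
      fun t => (φ (p.1 + (t - p.1 0) • (Pi.single 0 1 : Indep), p.2)).1 0 := by
    intro p hp
    filter_upwards [lt p hp] with t ht
    rw [← hT _ ht]; simp
  have lΥ : ∀ p ∈ Ω, Υ =ᶠ[𝓝 (p.1 0)]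
      fun t => (psiDeriv φ (p.1 + (t - p.1 0) • (Pi.single 0 1 : Indep), p.2)).2 := by
    intro p hp
    filter_upwards [lt p hp] with t ht
    rw [← hΥ _ ht]; simp
  have lZ : ∀ k, ∀ p ∈ Ω, Z k =ᶠ[𝓝 p.1] fun z => (φ (z, p.2)).1 k := by
    intro k p hp
    filter_upwards [lz p hp] with z hz
    exact hZ k _ hz
  have lΦ : ∀ p ∈ Ω, Φ =ᶠ[𝓝 p.1] fun z => (φ (z, p.2)).2 - (psiDeriv φ (z, p.2)).2 * p.2 := by
    intro p hp
    filter_upwards [lz p hp] with z hz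
    exact hΦ _ hz
  have hpt : ∀ p : Base, (p.1 + (p.1 0 - p.1 0) • (Pi.single 0 1 : Indep), p.2) = p := by
    intro p; simp
  have dT : ∀ p ∈ Ω, deriv T (p.1 0) = (fderiv ℝ φ p (Pi.single 0 1, 0)).1 0 := by
    intro p hp
    rw [(lT p hp).deriv_eq]
    have hl : HasDerivAt (fun t : ℝ => ((p.1 + (t - p.1 0) • (Pi.single 0 1 : Indep), p.2) : Base))
        (Pi.single 0 1, 0) (p.1 0) := by
      refine HasDerivAt.prodMk ?_ (hasDerivAt_const _ _)
      simpa using (((hasDerivAt_id (p.1 0)).sub_const (p.1 0)).smul_const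
        (Pi.single 0 1 : Indep)).const_add p.1
    have hd := ((hdk 0 p hp).hasFDerivAt)
    rw [← hpt p] at hd
    refine (hd.comp_hasDerivAt (p.1 0) hl).deriv.trans ?_
    rw [hpt, hfk 0 p hp]
  have dZ : ∀ k, ∀ p ∈ Ω, ∀ i, pd i (Z k) p.1 = (fderiv ℝ φ p (Pi.single i 1, 0)).1 k := by
    intro k p hp i
    rw [(pd_congr (lZ k p hp)).eq_of_nhds]
    have e0 : HasFDerivAt (fun z : Indep => ((z, p.2) : Base)) (ContinuousLinearMap.inl ℝ Indep ℝ) p.1 :=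
      hasFDerivAt_prodMk_left p.1 p.2
    have hd := ((hdk k p hp).hasFDerivAt).comp p.1 e0
    simp only [pd]
    erw [hd.fderiv, ← hfk k p hp]; rfl
  refine ⟨⟨T, Υ, Z 1, Z 2, Φ⟩, ?_, ?_, ?_, ?_, ?_, ?_⟩
  · rintro _ ⟨p, hp, rfl⟩
    refine (ContDiffAt.congr_of_eventuallyEq ?_ (lT p hp)).contDiffWithinAt
    have h1 : ContDiffAt ℝ ∞ φ (p.1 + (p.1 0 - p.1 0) • (Pi.single 0 1 : Indep), p.2) := by
      rw [hpt]; exact hcd p hp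
    fun_prop
  · rintro _ ⟨p, hp, rfl⟩
    refine (ContDiffAt.congr_of_eventuallyEq ?_ (lΥ p hp)).contDiffWithinAt
    have h1 : ContDiffAt ℝ ∞ (psiDeriv φ)
        (p.1 + (p.1 0 - p.1 0) • (Pi.single 0 1 : Indep), p.2) := by
      rw [hpt]; exact hcdψ p hp
    fun_prop
  · rintro _ ⟨p, hp, rfl⟩
    refine (ContDiffAt.congr_of_eventuallyEq ?_ (lZ 1 p hp)).contDiffWithinAt
    have h1 : ContDiffAt ℝ ∞ φ (p.1, p.2) := hcd p hp
    fun_prop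
  · rintro _ ⟨p, hp, rfl⟩
    refine (ContDiffAt.congr_of_eventuallyEq ?_ (lZ 2 p hp)).contDiffWithinAt
    have h1 : ContDiffAt ℝ ∞ φ (p.1, p.2) := hcd p hp
    fun_prop
  · rintro _ ⟨p, hp, rfl⟩
    refine (ContDiffAt.congr_of_eventuallyEq ?_ (lΦ p hp)).contDiffWithinAt
    have h1 : ContDiffAt ℝ ∞ φ (p.1, p.2) := hcd p hp
    have h2 : ContDiffAt ℝ ∞ (psiDeriv φ) (p.1, p.2) := hcdψ p hp
    fun_prop
  · intro p hp
    have hi := hinf p hp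
    refine ⟨?_, ?_, ?_, ?_⟩
    · simp only [dZ _ p hp]; exact hi.orth
    · simp only [dZ _ p hp]; exact hi.norm
    · refine mul_ne_zero (mul_ne_zero ?_ ?_) ?_
      · simp only [dT p hp]
        intro h0
        have hsurj : Function.Surjective (fderiv ℝ φ p) :=
          LinearMap.surjective_of_injective (f := (fderiv ℝ φ p : Base →ₗ[ℝ] Base))
            ((injective_iff_map_eq_zero _).2 (hinj p hp))
        obtain ⟨w, hw⟩ := hsurj (Pi.single 0 1, 0)
        have e : w = w.1 0 • ((Pi.single 0 1 : Indep), (0:ℝ))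
            + (w - w.1 0 • ((Pi.single 0 1 : Indep), (0:ℝ))) := by abel
        rw [e, map_add, map_smul] at hw
        have h1 := hi.time (w - w.1 0 • ((Pi.single 0 1 : Indep), (0:ℝ))) (by simp)
        have h2 := congrArg (fun x : Base => x.1 0) hw
        simp only [Prod.fst_add, Prod.smul_fst, Pi.add_apply, Pi.smul_apply] at h2
        rw [h1, h0] at h2
        simp at h2
      · simp only [hΥ p hp]
        intro h0
        have := hinj p hp (0, 1) (Prod.ext hi.space h0)
        simpa using congrArg Prod.snd this
      · simp only [confFactor, dZ _ p hp]
        intro h0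
        have hψ : (psiDeriv φ p).2 ≠ 0 := by
          intro h0
          have := hinj p hp (0, 1) (Prod.ext hi.space h0)
          simpa using congrArg Prod.snd this
        have h2 := hi.norm
        rw [h0] at h2
        have a0 := hi.time (Pi.single 1 1, 0) (by simp)
        have a1 : (fderiv ℝ φ p (Pi.single 1 1, 0)).1 1 = 0 := by
          nlinarith [sq_nonneg ((fderiv ℝ φ p (Pi.single 1 1, 0)).1 1),
            sq_nonneg ((fderiv ℝ φ p (Pi.single 2 1, 0)).1 1)]
        have a2 : (fderiv ℝ φ p (Pi.single 1 1, 0)).1 2 = 0 := by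
          nlinarith [sq_nonneg ((fderiv ℝ φ p (Pi.single 1 1, 0)).1 2),
            sq_nonneg ((fderiv ℝ φ p (Pi.single 2 1, 0)).1 2)]
        have a3 : (fderiv ℝ φ p (Pi.single 1 1, 0)).1 = 0 := by
          funext k; fin_cases k
          · exact a0
          · exact a1
          · exact a2
        -- If `L = 0`, then `∂_x` is mapped to a vertical vector. The multiple of `∂_ψ` subtracted
        -- here cancels it, so the difference lies in the kernel.
        have a4 := hinj p hp ((Pi.single 1 1, 0)
          - ((fderiv ℝ φ p (Pi.single 1 1, 0)).2 / (psiDeriv φ p).2) • (0, 1)) (by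
            rw [map_sub, map_smul]
            change _ - _ • psiDeriv φ p = 0
            refine Prod.ext ?_ ?_
            · simp [a3, hi.space]
            · simp; field_simp; simp)
        have := congrFun (congrArg Prod.fst a4) 1
        simp at this
    · refine Prod.ext ?_ ?_
      · funext k; fin_cases k
        · exact (hT p hp).symm
        · exact (hZ 1 p hp).symm
        · exact (hZ 2 p hp).symm
      · simp only [hΥ p hp, hΦ p hp]; ring

/-! ### The transformation of the arguments -/

/-- The coefficients, at a point, of the transformation of the arguments: the derivatives of the new
space variables, the factor `S` and the shift `Φ` of `ψ`, the factor `A` and the shift `B` of `ζ`. -/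
structure Coef where
  (p q r s : ℝ)
  (p₁ p₂ q₂ r₁ r₂ s₂ : ℝ)
  (S Φ₁ Φ₂ : ℝ)
  (A A₁ A₂ A₁₁ A₁₂ A₂₂ : ℝ)
  (B B₁ B₂ B₁₁ B₁₂ B₂₂ : ℝ)

/-- The old vertical arguments in terms of the new ones. -/
noncomputable def Coef.pull (c : Coef) (w : Fin 8 → ℝ) : Fin 8 → ℝ :=
  let ζ := (w 2 - c.B) / c.A
  let ζ₁ := (c.p * w 3 + c.r * w 4 - c.A₁ * ζ - c.B₁) / c.A
  let ζ₂ := (c.q * w 3 + c.s * w 4 - c.A₂ * ζ - c.B₂) / c.A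
  ![(c.p * w 0 + c.r * w 1 - c.Φ₁) / c.S, (c.q * w 0 + c.s * w 1 - c.Φ₂) / c.S, ζ, ζ₁, ζ₂,
    (c.p ^ 2 * w 5 + 2 * (c.p * c.r) * w 6 + c.r ^ 2 * w 7 + c.p₁ * w 3 + c.r₁ * w 4
      - c.A₁₁ * ζ - 2 * (c.A₁ * ζ₁) - c.B₁₁) / c.A,
    (c.p * c.q * w 5 + (c.p * c.s + c.q * c.r) * w 6 + c.r * c.s * w 7 + c.p₂ * w 3 + c.r₂ * w 4
      - c.A₁₂ * ζ - c.A₁ * ζ₂ - c.A₂ * ζ₁ - c.B₁₂) / c.A,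
    (c.q ^ 2 * w 5 + 2 * (c.q * c.s) * w 6 + c.s ^ 2 * w 7 + c.q₂ * w 3 + c.s₂ * w 4
      - c.A₂₂ * ζ - 2 * (c.A₂ * ζ₂) - c.B₂₂) / c.A]

/-- The new vertical arguments in terms of the old ones. -/
noncomputable def Coef.push (c : Coef) (w : Fin 8 → ℝ) : Fin 8 → ℝ :=
  let L := c.p ^ 2 + c.q ^ 2
  let h₁ := c.A₁ * w 2 + c.A * w 3 + c.B₁
  let h₂ := c.A₂ * w 2 + c.A * w 4 + c.B₂
  let η₁ := (c.p * h₁ + c.q * h₂) / L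
  let η₂ := (c.r * h₁ + c.s * h₂) / L
  let h₁₁ := c.A₁₁ * w 2 + 2 * (c.A₁ * w 3) + c.A * w 5 + c.B₁₁ - c.p₁ * η₁ - c.r₁ * η₂
  let h₁₂ := c.A₁₂ * w 2 + c.A₁ * w 4 + c.A₂ * w 3 + c.A * w 6 + c.B₁₂ - c.p₂ * η₁ - c.r₂ * η₂
  let h₂₂ := c.A₂₂ * w 2 + 2 * (c.A₂ * w 4) + c.A * w 7 + c.B₂₂ - c.q₂ * η₁ - c.s₂ * η₂
  ![(c.p * (c.S * w 0 + c.Φ₁) + c.q * (c.S * w 1 + c.Φ₂)) / L,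
    (c.r * (c.S * w 0 + c.Φ₁) + c.s * (c.S * w 1 + c.Φ₂)) / L, c.A * w 2 + c.B, η₁, η₂,
    (c.p ^ 2 * h₁₁ + 2 * (c.p * c.q) * h₁₂ + c.q ^ 2 * h₂₂) / L ^ 2,
    (c.p * c.r * h₁₁ + (c.p * c.s + c.q * c.r) * h₁₂ + c.q * c.s * h₂₂) / L ^ 2,
    (c.r ^ 2 * h₁₁ + 2 * (c.r * c.s) * h₁₂ + c.s ^ 2 * h₂₂) / L ^ 2]

/-- The coefficients are those of a conformal transformation. -/
structure Coef.Regular (c : Coef) : Prop where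
  orth : c.p * c.r + c.q * c.s = 0
  norm : c.p ^ 2 + c.q ^ 2 = c.r ^ 2 + c.s ^ 2
  factor : c.p ^ 2 + c.q ^ 2 ≠ 0
  S_ne : c.S ≠ 0
  A_ne : c.A ≠ 0

/-- The conformal matrix is inverted by its transpose over `L`, separately in each order of
derivatives. The identity makes `pull` injective, so the old arguments determine the new ones. -/
theorem Coef.Regular.push_pull {c : Coef} (h : c.Regular) (w : Fin 8 → ℝ) :
    c.push (c.pull w) = w := by
  have hL := h.factor
  have hS := h.S_ne
  have hA := h.A_ne
  have k1 := h.orth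
  have k2 := h.norm
  -- These cancellations collapse the composition order by order, without expanding the nested
  -- quotients.
  have g : ∀ a b x : ℝ, b ≠ 0 → b * ((a - x) / b) + x = a := by
    intro a b x hb; field_simp; ring
  have g1 : ∀ y x₁ x₂ b : ℝ, b ≠ 0 → x₁ + b * ((y - x₁ - x₂) / b) + x₂ = y := by
    intro y x₁ x₂ b hb; field_simp; ring
  have g2 : ∀ y x₁ x₂ x₃ x₄ x₅ b : ℝ, b ≠ 0 →
      x₁ + x₂ + b * ((y + x₄ + x₅ - x₁ - x₂ - x₃) / b) + x₃ - x₄ - x₅ = y := by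
    intro y x₁ x₂ x₃ x₄ x₅ b hb; field_simp; ring
  have g3 : ∀ y x₁ x₂ x₂' x₃ x₄ x₅ b : ℝ, b ≠ 0 →
      x₁ + x₂ + x₂' + b * ((y + x₄ + x₅ - x₁ - x₂ - x₂' - x₃) / b) + x₃ - x₄ - x₅ = y := by
    intro y x₁ x₂ x₂' x₃ x₄ x₅ b hb; field_simp; ring
  have e0 : ∀ a b : ℝ, (c.p * (c.p * a + c.r * b) + c.q * (c.q * a + c.s * b))
      / (c.p ^ 2 + c.q ^ 2) = a := by
    intro a b; field_simp; linear_combination b * k1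
  have e1 : ∀ a b : ℝ, (c.r * (c.p * a + c.r * b) + c.s * (c.q * a + c.s * b))
      / (c.p ^ 2 + c.q ^ 2) = b := by
    intro a b; field_simp; linear_combination a * k1 - b * k2
  funext k
  fin_cases k <;> simp only [Coef.pull, Coef.push, Fin.isValue, Matrix.cons_val, g _ _ _ hS,
    g _ _ _ hA, g1 _ _ _ _ hA, e0, e1, g2 _ _ _ _ _ _ _ hA, g3 _ _ _ _ _ _ _ _ hA,
    Fin.zero_eta, Fin.mk_one, Fin.reduceFinMk]
  · field_simp
    linear_combination (2 * (c.p ^ 2 + c.q ^ 2) * w 6 + (c.p * c.r + c.q * c.s) * w 7) * k1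
  · field_simp
    linear_combination ((c.p ^ 2 + c.q ^ 2) * w 5 + (c.p * c.r + c.q * c.s) * w 6
      + (c.r ^ 2 + c.s ^ 2) * w 7) * k1 - (c.p ^ 2 + c.q ^ 2) * w 6 * k2
  · field_simp
    linear_combination (2 * (c.r ^ 2 + c.s ^ 2) * w 6 + (c.p * c.r + c.q * c.s) * w 5) * k1
      - (c.p ^ 2 + c.q ^ 2 + c.r ^ 2 + c.s ^ 2) * w 7 * k2

/-- The coefficients at a point of the transformation given by functions. -/
noncomputable def coefOf (Z₁ Z₂ Φ S A B : Indep → ℝ) (z : Indep) : Coef where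
  p := pd 1 Z₁ z
  q := pd 2 Z₁ z
  r := pd 1 Z₂ z
  s := pd 2 Z₂ z
  p₁ := pd 1 (pd 1 Z₁) z
  p₂ := pd 1 (pd 2 Z₁) z
  q₂ := pd 2 (pd 2 Z₁) z
  r₁ := pd 1 (pd 1 Z₂) z
  r₂ := pd 1 (pd 2 Z₂) z
  s₂ := pd 2 (pd 2 Z₂) z
  S := S z
  Φ₁ := pd 1 Φ z
  Φ₂ := pd 2 Φ z
  A := A z
  A₁ := pd 1 A z
  A₂ := pd 2 A z
  A₁₁ := pd 1 (pd 1 A) z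
  A₁₂ := pd 1 (pd 2 A) z
  A₂₂ := pd 2 (pd 2 A) z
  B := B z
  B₁ := pd 1 B z
  B₂ := pd 2 B z
  B₁₁ := pd 1 (pd 1 B) z
  B₁₂ := pd 1 (pd 2 B) z
  B₂₂ := pd 2 (pd 2 B) z

theorem coefOf_congr {Z₁ Z₂ Φ S A B Z₁' Z₂' Φ' S' A' B' : Indep → ℝ} {z : Indep}
    (h1 : Z₁ =ᶠ[𝓝 z] Z₁') (h2 : Z₂ =ᶠ[𝓝 z] Z₂') (h3 : Φ =ᶠ[𝓝 z] Φ') (h4 : S =ᶠ[𝓝 z] S')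
    (h5 : A =ᶠ[𝓝 z] A') (h6 : B =ᶠ[𝓝 z] B') :
    coefOf Z₁ Z₂ Φ S A B z = coefOf Z₁' Z₂' Φ' S' A' B' z := by
  have f : ∀ {g g' : Indep → ℝ}, g =ᶠ[𝓝 z] g' → ∀ i, pd i g z = pd i g' z :=
    fun h i => (pd_congr h).eq_of_nhds
  simp only [coefOf, f h1, f h2, f h3, f h5, f h6, f (pd_congr h1), f (pd_congr h2),
    f (pd_congr h5), f (pd_congr h6), h4.eq_of_nhds, h5.eq_of_nhds, h6.eq_of_nhds]

/-- The relations between the jets of a function and of its image under a transformation with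
conformal change of the space variables. -/
theorem transformation_formulas {Z : Indep → Indep} {z₀ : Indep} (hZ : ConformalNear Z z₀)
    {Φ S A B u v : Indep → ℝ} (hΦ : ContDiff ℝ ∞ Φ) (hS : ContDiff ℝ ∞ S) (hA : ContDiff ℝ ∞ A)
    (hB : ContDiff ℝ ∞ B) (hu : ContDiff ℝ ∞ u) (hv : ContDiff ℝ ∞ v)
    (hS0 : ∀ᶠ z in 𝓝 z₀, pd 1 S z = 0 ∧ pd 2 S z = 0)
    (hAS : ∀ᶠ z in 𝓝 z₀, confFactor (fun z => Z z 1) z * A z = S z)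
    (hBΦ : ∀ᶠ z in 𝓝 z₀, confFactor (fun z => Z z 1) z * B z = laplacian Φ z)
    (hvu : ∀ᶠ z in 𝓝 z₀, v (Z z) = S z * u z + Φ z) (hS_ne : S z₀ ≠ 0)
    (hT : pd 0 (fun z => Z z 0) z₀ ≠ 0) :
    (coefOf (fun z => Z z 1) (fun z => Z z 2) Φ S A B z₀).Regular ∧
    (jet u z₀).args.2 = (coefOf (fun z => Z z 1) (fun z => Z z 2) Φ S A B z₀).pull
      (jet v (Z z₀)).args.2 ∧
    (jet v (Z z₀)).vortT = 1 / pd 0 (fun z => Z z 0) z₀ *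
      (A z₀ * (jet u z₀).vortT + pd 0 A z₀ * (jet u z₀).vort + pd 0 B z₀
      - (pd 0 (fun z => Z z 1) z₀ * pd 1 (fun z => Z z 1) z₀
          + pd 0 (fun z => Z z 2) z₀ * pd 1 (fun z => Z z 2) z₀) / confFactor (fun z => Z z 1) z₀
          * (A z₀ * (jet u z₀).vortX + pd 1 A z₀ * (jet u z₀).vort + pd 1 B z₀)
      - (pd 0 (fun z => Z z 1) z₀ * pd 2 (fun z => Z z 1) z₀
          + pd 0 (fun z => Z z 2) z₀ * pd 2 (fun z => Z z 2) z₀) / confFactor (fun z => Z z 1) z₀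
          * (A z₀ * (jet u z₀).vortY + pd 2 A z₀ * (jet u z₀).vort + pd 2 B z₀)) := by
  have hs := hZ.smooth
  have hL := hZ.factor
  have hA_ne : A z₀ ≠ 0 := by
    intro h0
    have := hAS.self_of_nhds
    rw [h0, mul_zero] at this
    exact hS_ne this.symm
  have orth := hZ.orth.self_of_nhds
  have norm := hZ.norm.self_of_nhds
  have hreg : (coefOf (fun z => Z z 1) (fun z => Z z 2) Φ S A B z₀).Regular :=
    ⟨orth, norm, hL, hS_ne, hA_ne⟩
  -- The Laplacian of `v ∘ Z = S u + Φ` is taken with `S` constant in space, and then `L` is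
  -- cancelled. The formulas for `ζ`, its derivatives and `ζ_t` all come from this relation.
  have hlap : ∀ᶠ z in 𝓝 z₀, laplacian v (Z z) = A z * laplacian u z + B z := by
    filter_upwards [hZ.eventually, hS0.eventually_nhds, hAS, hBΦ, hvu.eventually_nhds]
      with z k1 k2 k3 k4 k5
    have e1 := (laplacian_congr k5).eq_of_nhds
    rw [k1.laplacian_comp hv, laplacian_add (by fun_prop) hΦ] at e1
    have s1 : pd 1 S =ᶠ[𝓝 z] fun _ => 0 := k2.mono fun _ h => h.1
    have s2 : pd 2 S =ᶠ[𝓝 z] fun _ => 0 := k2.mono fun _ h => h.2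
    have s11 := (pd_congr (i := 1) s1).eq_of_nhds
    have s22 := (pd_congr (i := 2) s2).eq_of_nhds
    simp only [pd_const] at s11 s22
    have e2 : laplacian (fun z => S z * u z) z = S z * laplacian u z := by
      simp only [laplacian]
      simp (disch := fun_prop) only [pd_mul, pd_add]
      rw [s1.eq_of_nhds, s2.eq_of_nhds, s11, s22]; ring
    simp only [e2] at e1
    apply mul_left_cancel₀ k1.factor
    linear_combination e1 - laplacian u z * k3 - k4
  -- first and second derivatives of the relations
  have hW : ContDiff ℝ ∞ (laplacian v) := contDiff_laplacian hv
  have hζ : ContDiff ℝ ∞ (laplacian u) := contDiff_laplacian hu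
  have z1 := hZ.time.self_of_nhds.1
  have z2 := hZ.time.self_of_nhds.2
  have t1 : pd 1 (fun z => Z z 0) =ᶠ[𝓝 z₀] fun _ => 0 := hZ.time.mono fun _ h => h.1
  have t2 : pd 2 (fun z => Z z 0) =ᶠ[𝓝 z₀] fun _ => 0 := hZ.time.mono fun _ h => h.2
  have z11 := (pd_congr (i := 1) t1).eq_of_nhds
  have z12 := (pd_congr (i := 1) t2).eq_of_nhds
  have z22 := (pd_congr (i := 2) t2).eq_of_nhds
  simp only [pd_const] at z11 z12 z22
  have g1 := (pd_congr (i := 1) hvu).eq_of_nhds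
  have g2 := (pd_congr (i := 2) hvu).eq_of_nhds
  rw [pd_comp hv hs, pd_add (by fun_prop) hΦ, pd_mul hS hu] at g1 g2
  simp only [z1, z2, hS0.self_of_nhds.1, hS0.self_of_nhds.2, mul_zero, zero_mul, zero_add]
    at g1 g2
  have c0 := (pd_congr (i := 0) hlap).eq_of_nhds
  have c1 := (pd_congr (i := 1) hlap).eq_of_nhds
  have c2 := (pd_congr (i := 2) hlap).eq_of_nhds
  have c11 := (pd_congr (i := 1) (pd_congr (i := 1) hlap)).eq_of_nhds
  have c12 := (pd_congr (i := 1) (pd_congr (i := 2) hlap)).eq_of_nhds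
  have c22 := (pd_congr (i := 2) (pd_congr (i := 2) hlap)).eq_of_nhds
  have cc := hlap.self_of_nhds
  have hcomm := pd_comm hW 2 1
  rw [pd_comp hW hs, pd_add (by fun_prop) hB, pd_mul hA hζ] at c0 c1 c2 c11 c12 c22
  have second : ∀ i k, pd i (fun z => pd k (laplacian v) (Z z)) = _ := fun i k =>
    pd_comp (i := i) (contDiff_pd (i := k) hW) hs
  simp (disch := fun_prop) only [pd_add, pd_mul, second] at c11 c12 c22
  simp only [z1, z2, z11, z12, z22, mul_zero, zero_add, add_zero, hcomm]
    at c1 c2 c11 c12 c22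
  refine ⟨hreg, ?_, ?_⟩
  · rw [jet_args hu, jet_args hv]
    have d0 : laplacian u z₀ = (laplacian v (Z z₀) - B z₀) / A z₀ := by
      rw [eq_div_iff hA_ne]; linear_combination -cc
    have d1 : pd 1 (laplacian u) z₀ = (pd 1 (fun z => Z z 1) z₀ * pd 1 (laplacian v) (Z z₀)
        + pd 1 (fun z => Z z 2) z₀ * pd 2 (laplacian v) (Z z₀) - pd 1 A z₀ * laplacian u z₀
        - pd 1 B z₀) / A z₀ := by
      rw [eq_div_iff hA_ne]; linear_combination -c1
    have d2 : pd 2 (laplacian u) z₀ = (pd 2 (fun z => Z z 1) z₀ * pd 1 (laplacian v) (Z z₀)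
        + pd 2 (fun z => Z z 2) z₀ * pd 2 (laplacian v) (Z z₀) - pd 2 A z₀ * laplacian u z₀
        - pd 2 B z₀) / A z₀ := by
      rw [eq_div_iff hA_ne]; linear_combination -c2
    funext k
    fin_cases k <;> simp only [Coef.pull, coefOf, Fin.isValue, Matrix.cons_val, Fin.zero_eta,
      Fin.mk_one, Fin.reduceFinMk, ← d0, ← d1, ← d2]
    · rw [eq_div_iff hS_ne]; linear_combination -g1
    · rw [eq_div_iff hS_ne]; linear_combination -g2
    · rw [eq_div_iff hA_ne]; linear_combination -c11
    · rw [eq_div_iff hA_ne]; linear_combination -c12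
    · rw [eq_div_iff hA_ne]; linear_combination -c22
  · rw [jet_vortT hu, jet_vortT hv, jet_vortX hu, jet_vortY hu, jet_vort]
    -- The time derivative of the relation contains unwanted terms in the new gradient of `ζ̃`. Its
    -- two space derivatives, solved with the transpose over `L`, eliminate them; this produces the
    -- `Z^i_t Z^i_j / L` terms.
    have d1 : A z₀ * pd 1 (laplacian u) z₀ + pd 1 A z₀ * laplacian u z₀ + pd 1 B z₀
        = pd 1 (fun z => Z z 1) z₀ * pd 1 (laplacian v) (Z z₀)
          + pd 1 (fun z => Z z 2) z₀ * pd 2 (laplacian v) (Z z₀) := by linear_combination -c1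
    have d2 : A z₀ * pd 2 (laplacian u) z₀ + pd 2 A z₀ * laplacian u z₀ + pd 2 B z₀
        = pd 2 (fun z => Z z 1) z₀ * pd 1 (laplacian v) (Z z₀)
          + pd 2 (fun z => Z z 2) z₀ * pd 2 (laplacian v) (Z z₀) := by linear_combination -c2
    have d0 : A z₀ * pd 0 (laplacian u) z₀ + pd 0 A z₀ * laplacian u z₀ + pd 0 B z₀
        = pd 0 (fun z => Z z 0) z₀ * pd 0 (laplacian v) (Z z₀)
          + pd 0 (fun z => Z z 1) z₀ * pd 1 (laplacian v) (Z z₀)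
          + pd 0 (fun z => Z z 2) z₀ * pd 2 (laplacian v) (Z z₀) := by linear_combination -c0
    rw [d0, d1, d2]
    simp only [confFactor] at hL ⊢
    field_simp
    linear_combination (pd 0 (fun z => Z z 2) z₀ * pd 1 (laplacian v) (Z z₀)
      + pd 0 (fun z => Z z 1) z₀ * pd 2 (laplacian v) (Z z₀)) * orth
      - pd 0 (fun z => Z z 2) z₀ * pd 2 (laplacian v) (Z z₀) * norm

/-! ### Germs of the functions of an explicit transformation -/

theorem SmoothNear.pd {f : Indep → ℝ} {z : Indep} (hf : SmoothNear f z) (i : Fin 3) :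
    SmoothNear (pd i f) z := by
  filter_upwards [hf] with w hw
  exact (hw.fderiv_right (m := ∞) (by simp)).clm_apply contDiffAt_const

theorem _root_.ContDiffOn.smoothNear {f : Indep → ℝ} {s : Set Indep} (hf : ContDiffOn ℝ ∞ f s)
    (hs : IsOpen s) {z : Indep} (hz : z ∈ s) : SmoothNear f z :=
  hf.eventually_contDiffAt hs hz

namespace Data
variable (D : Data)

/-- The factor of `ψ` as a function of `(t, x, y)`. -/
noncomputable def S : Indep → ℝ := fun w => D.Υ (w 0)

/-- The new time as a function of `(t, x, y)`. -/
noncomputable def Z₀ : Indep → ℝ := fun w => D.T (w 0)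

/-- The factor of `ζ`. -/
noncomputable def A : Indep → ℝ := fun w => D.Υ (w 0) / confFactor D.Z₁ w

/-- The shift of `ζ`. -/
noncomputable def B : Indep → ℝ := fun w => laplacian D.Φ w / confFactor D.Z₁ w

/-- The coefficients of the transformation of the arguments. -/
noncomputable def coef (z : Indep) : Coef := coefOf D.Z₁ D.Z₂ D.Φ D.S D.A D.B z

/-- The expression of the transformed arbitrary element in terms of the arguments. -/
noncomputable def trans (a : Args) (s : ℝ) : ℝ :=
  1 / pd 0 D.Z₀ a.1.1 *
    (D.A a.1.1 * s + pd 0 D.A a.1.1 * a.2 2 + pd 0 D.B a.1.1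
      - (pd 0 D.Z₁ a.1.1 * pd 1 D.Z₁ a.1.1 + pd 0 D.Z₂ a.1.1 * pd 1 D.Z₂ a.1.1)
          / confFactor D.Z₁ a.1.1
          * (D.A a.1.1 * a.2 3 + pd 1 D.A a.1.1 * a.2 2 + pd 1 D.B a.1.1)
      - (pd 0 D.Z₁ a.1.1 * pd 2 D.Z₁ a.1.1 + pd 0 D.Z₂ a.1.1 * pd 2 D.Z₂ a.1.1)
          / confFactor D.Z₁ a.1.1
          * (D.A a.1.1 * a.2 4 + pd 2 D.A a.1.1 * a.2 2 + pd 2 D.B a.1.1))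

end Data

/-- The germs at `z` of the functions of an explicit transformation. -/
structure Data.RegularAt (D : Data) (z : Indep) : Prop where
  smooth_Z₀ : SmoothNear D.Z₀ z
  smooth_S : SmoothNear D.S z
  smooth_Z₁ : SmoothNear D.Z₁ z
  smooth_Z₂ : SmoothNear D.Z₂ z
  smooth_Φ : SmoothNear D.Φ z
  diff_T : DifferentiableAt ℝ D.T (z 0)
  const : ∀ᶠ w in 𝓝 z, pd 1 D.Z₀ w = 0 ∧ pd 2 D.Z₀ w = 0 ∧ pd 1 D.S w = 0 ∧ pd 2 D.S w = 0
  orth : ∀ᶠ w in 𝓝 z, pd 1 D.Z₁ w * pd 1 D.Z₂ w + pd 2 D.Z₁ w * pd 2 D.Z₂ w = 0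
  norm : ∀ᶠ w in 𝓝 z, pd 1 D.Z₁ w ^ 2 + pd 2 D.Z₁ w ^ 2 = pd 1 D.Z₂ w ^ 2 + pd 2 D.Z₂ w ^ 2
  factor : ∀ᶠ w in 𝓝 z, confFactor D.Z₁ w ≠ 0
  S_ne : D.S z ≠ 0
  T_ne : deriv D.T (z 0) ≠ 0

theorem pd_comp_coord_zero {h : ℝ → ℝ} {z : Indep} (hh : DifferentiableAt ℝ h (z 0)) (i : Fin 3) :
    pd i (fun w => h (w 0)) z = if i = 0 then deriv h (z 0) else 0 := by
  have e := hh.hasDerivAt.comp_hasFDerivAt z (hasFDerivAt_apply (𝕜 := ℝ) (0 : Fin 3) z)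
  simp only [pd]
  erw [e.fderiv]
  by_cases hi : i = 0
  · subst hi; simp
  · simp [hi, Ne.symm hi]

theorem Data.RegularAt.smooth_A {D : Data} {z : Indep} (h : D.RegularAt z) : SmoothNear D.A z := by
  filter_upwards [h.smooth_S, h.smooth_Z₁.pd 1, h.smooth_Z₁.pd 2, h.factor] with w h1 h2 h3 h4
  exact h1.div ((h2.pow 2).add (h3.pow 2)) h4

theorem Data.RegularAt.smooth_B {D : Data} {z : Indep} (h : D.RegularAt z) : SmoothNear D.B z := by
  filter_upwards [(h.smooth_Φ.pd 1).pd 1, (h.smooth_Φ.pd 2).pd 2, h.smooth_Z₁.pd 1,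
    h.smooth_Z₁.pd 2, h.factor] with w h0 h1 h2 h3 h4
  exact (h0.add h1).div ((h2.pow 2).add (h3.pow 2)) h4

/-- The expression depends on the jet only through the arguments of `F`. Differentiability of `T`
identifies its derivative with that of `z ↦ T (z 0)`. -/
theorem newF_eq_trans {D : Data} {j : Jet} (hD : DifferentiableAt ℝ D.T (j.1 0)) (s : ℝ) :
    newF D.T D.Υ D.Z₁ D.Z₂ D.Φ j s = D.trans j.args s := by
  have e := pd_comp_coord_zero hD 0
  rw [if_pos rfl] at e
  simp only [newF, ← e]
  rfl

theorem Represents.regularAt {D : Data} {Ω : Set Base} {φ : Base → Base} (h : Represents D Ω φ)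
    (hΩ : IsOpen Ω) {p : Base} (hp : p ∈ Ω) : D.RegularAt p.1 := by
  have o1 : IsOpen (Prod.fst '' Ω) := isOpenMap_fst _ hΩ
  have o0 : IsOpen ((fun p : Base => p.1 0) '' Ω) := by
    have : (fun p : Base => p.1 0) '' Ω = (fun z : Indep => z 0) '' (Prod.fst '' Ω) := by
      rw [image_image]
    rw [this]
    exact isOpenMap_eval 0 _ o1
  have m1 : p.1 ∈ Prod.fst '' Ω := mem_image_of_mem _ hp
  have hev : ∀ᶠ w in 𝓝 p.1, (w, p.2) ∈ Ω := by
    have hc : Continuous (fun z : Indep => ((z, p.2) : Base)) := by fun_prop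
    exact hc.continuousAt.eventually (hΩ.mem_nhds hp)
  have hs : ∀ {g : ℝ → ℝ}, ContDiffOn ℝ ∞ g ((fun p : Base => p.1 0) '' Ω) →
      ∀ w, (w, p.2) ∈ Ω → ContDiffAt ℝ ∞ g (w 0) := by
    intro g hg w hw
    exact hg.contDiffAt (o0.mem_nhds ⟨_, hw, rfl⟩)
  have hs' : ∀ {g : ℝ → ℝ}, ContDiffOn ℝ ∞ g ((fun p : Base => p.1 0) '' Ω) →
      SmoothNear (fun w => g (w 0)) p.1 := by
    intro g hg
    filter_upwards [hev] with w hw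
    have := hs hg w hw
    fun_prop
  have hf := h.form p hp
  refine ⟨hs' h.smooth_T, hs' h.smooth_Υ, h.smooth_Z₁.smoothNear o1 m1, h.smooth_Z₂.smoothNear o1 m1,
    h.smooth_Φ.smoothNear o1 m1, (hs h.smooth_T p.1 hp).differentiableAt (by simp), ?_, ?_, ?_, ?_,
    ?_, ?_⟩
  · filter_upwards [hev] with w hw
    have d1 := (hs h.smooth_T w hw).differentiableAt (by simp)
    have d2 := (hs h.smooth_Υ w hw).differentiableAt (by simp)
    have e1 := pd_comp_coord_zero d1
    have e2 := pd_comp_coord_zero d2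
    exact ⟨e1 1, e1 2, e2 1, e2 2⟩
  · filter_upwards [hev] with w hw using (h.form _ hw).1
  · filter_upwards [hev] with w hw using (h.form _ hw).2.1
  · filter_upwards [hev] with w hw using right_ne_zero_of_mul (h.form _ hw).2.2.1
  · exact right_ne_zero_of_mul (left_ne_zero_of_mul hf.2.2.1)
  · exact left_ne_zero_of_mul (left_ne_zero_of_mul hf.2.2.1)

theorem Represents.contDiffAt {D : Data} {Ω : Set Base} {φ : Base → Base} (h : Represents D Ω φ)
    (hΩ : IsOpen Ω) {p : Base} (hp : p ∈ Ω) : ContDiffAt ℝ ∞ φ p := by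
  have hr := h.regularAt hΩ hp
  have e : φ =ᶠ[𝓝 p] fun p => (![D.Z₀ p.1, D.Z₁ p.1, D.Z₂ p.1], D.S p.1 * p.2 + D.Φ p.1) := by
    filter_upwards [hΩ.mem_nhds hp] with q hq
    exact (h.form q hq).2.2.2
  refine ContDiffAt.congr_of_eventuallyEq ?_ e
  have h0 := hr.smooth_Z₀.self_of_nhds
  have h1 := hr.smooth_Z₁.self_of_nhds
  have h2 := hr.smooth_Z₂.self_of_nhds
  have h3 := hr.smooth_S.self_of_nhds
  have h4 := hr.smooth_Φ.self_of_nhds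
  refine ContDiffAt.prodMk ?_ (by fun_prop)
  rw [contDiffAt_pi]
  intro k
  fin_cases k
  · change ContDiffAt ℝ ∞ (fun p : Base => D.Z₀ p.1) p; fun_prop
  · change ContDiffAt ℝ ∞ (fun p : Base => D.Z₁ p.1) p; fun_prop
  · change ContDiffAt ℝ ∞ (fun p : Base => D.Z₂ p.1) p; fun_prop

/-- The transformation of the jets by an explicit transformation. -/
theorem Represents.prolongs {D : Data} {Ω : Set Base} {φ : Base → Base} (h : Represents D Ω φ)
    (hΩ : IsOpen Ω) {j j' : Jet} (hj : j.pt ∈ Ω) (hP : Prolongs φ j j') :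
    j'.pt = φ j.pt ∧ (D.coef j.1).Regular ∧ j.args.2 = (D.coef j.1).pull j'.args.2 ∧
      j'.vortT = D.trans j.args j.vortT := by
  have hr := h.regularAt hΩ hj
  change D.RegularAt j.1 at hr
  obtain ⟨u, v, hu, hv, hju, hjv, h1, h2⟩ :=
    hP.exists_contDiff (h.contDiffAt hΩ hj).continuousAt
  have hpt : (j.1, u j.1) = j.pt := by rw [← hju]; rfl
  -- Global extensions of the germs satisfy the hypotheses of `transformation_formulas`, and all
  -- derivatives at the point are those of the original functions.
  obtain ⟨Z0, s0, e0⟩ := hr.smooth_Z₀.exists_contDiff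
  obtain ⟨Z1, s1, e1⟩ := hr.smooth_Z₁.exists_contDiff
  obtain ⟨Z2, s2, e2⟩ := hr.smooth_Z₂.exists_contDiff
  obtain ⟨S, sS, eS⟩ := hr.smooth_S.exists_contDiff
  obtain ⟨Φ, sΦ, eΦ⟩ := hr.smooth_Φ.exists_contDiff
  obtain ⟨A, sA, eA⟩ := hr.smooth_A.exists_contDiff
  obtain ⟨B, sB, eB⟩ := hr.smooth_B.exists_contDiff
  have hc : ContinuousAt (fun z => ((z, u z) : Base)) j.1 :=
    (continuous_id.prodMk hu.continuous).continuousAt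
  have hform : ∀ᶠ z in 𝓝 j.1, φ (z, u z)
      = (![D.Z₀ z, D.Z₁ z, D.Z₂ z], D.S z * u z + D.Φ z) := by
    have : ∀ᶠ z in 𝓝 j.1, (z, u z) ∈ Ω :=
      hc.eventually_mem (by simpa only [hpt] using hΩ.mem_nhds hj)
    filter_upwards [this] with z hz
    exact (h.form _ hz).2.2.2
  let Z : Indep → Indep := fun z => ![Z0 z, Z1 z, Z2 z]
  have hZs : ContDiff ℝ ∞ Z := by
    rw [contDiff_pi]
    intro k
    fin_cases k
    · exact s0
    · exact s1
    · exact s2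
  have p0 := fun i => pd_congr (i := i) e0
  have p1 := fun i => pd_congr (i := i) e1
  have p2 := fun i => pd_congr (i := i) e2
  have pS := fun i => pd_congr (i := i) eS
  have hL : confFactor Z1 =ᶠ[𝓝 j.1] confFactor D.Z₁ := by
    filter_upwards [p1 1, p1 2] with z k1 k2
    simp only [confFactor, k1, k2]
  have hC : ConformalNear Z j.1 := by
    refine ⟨hZs, ?_, ?_, ?_, ?_⟩
    · filter_upwards [hr.const, p0 1, p0 2] with z k k1 k2
      exact ⟨k1.trans k.1, k2.trans k.2.1⟩
    · filter_upwards [hr.orth, p1 1, p1 2, p2 1, p2 2] with z k k1 k2 k3 k4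
      change pd 1 Z1 z * pd 1 Z2 z + pd 2 Z1 z * pd 2 Z2 z = 0
      rw [k1, k2, k3, k4, k]
    · filter_upwards [hr.norm, p1 1, p1 2, p2 1, p2 2] with z k k1 k2 k3 k4
      change pd 1 Z1 z ^ 2 + pd 2 Z1 z ^ 2 = pd 1 Z2 z ^ 2 + pd 2 Z2 z ^ 2
      rw [k1, k2, k3, k4, k]
    · change confFactor Z1 j.1 ≠ 0
      rw [hL.eq_of_nhds]; exact hr.factor.self_of_nhds
  have hZφ : ∀ᶠ z in 𝓝 j.1, (φ (z, u z)).1 = Z z := by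
    filter_upwards [hform, e0, e1, e2] with z k k0 k1 k2
    rw [k]; simp only [Z, k0, k1, k2]
  have hZj : Z j.1 = j'.1 := by rw [← hZφ.self_of_nhds, h1]
  have hvu : ∀ᶠ z in 𝓝 j.1, v (Z z) = S z * u z + Φ z := by
    filter_upwards [hform, h2, hZφ, eS, eΦ] with z k k1 k2 k3 k4
    rw [← k2, ← k1, k, k3, k4]
  have hT : pd 0 Z0 j.1 = deriv D.T (j.1 0) := by
    rw [(p0 0).eq_of_nhds]
    exact pd_comp_coord_zero hr.diff_T 0
  obtain ⟨c1, c2, c3⟩ := transformation_formulas hC sΦ sS sA sB hu hv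
    (by filter_upwards [hr.const, pS 1, pS 2] with z k k1 k2
        exact ⟨k1.trans k.2.2.1, k2.trans k.2.2.2⟩)
    (by filter_upwards [hL, eA, eS, hr.factor] with z k1 k2 k3 k4
        change confFactor Z1 z * A z = S z
        rw [k1, k2, k3, Data.A, mul_div_cancel₀ _ k4]; rfl)
    (by filter_upwards [hL, eB, laplacian_congr eΦ, hr.factor] with z k1 k2 k3 k4
        change confFactor Z1 z * B z = laplacian Φ z
        rw [k1, k2, k3, Data.B, mul_div_cancel₀ _ k4])
    hvu (by rw [eS.eq_of_nhds]; exact hr.S_ne)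
    (by change pd 0 Z0 j.1 ≠ 0; rw [hT]; exact hr.T_ne)
  have hcoef : coefOf Z1 Z2 Φ S A B j.1 = D.coef j.1 := coefOf_congr e1 e2 eΦ eS eA eB
  change (coefOf Z1 Z2 Φ S A B j.1).Regular at c1
  change (jet u j.1).args.2 = (coefOf Z1 Z2 Φ S A B j.1).pull _ at c2
  rw [hZj, hjv, hju, hcoef] at c2
  rw [hcoef] at c1
  refine ⟨?_, c1, c2, ?_⟩
  · rw [← hpt]
    refine Prod.ext h1.symm ?_
    rw [h2.self_of_nhds, h1, ← hjv]; rfl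
  · rw [hZj, hjv, hju] at c3
    rw [c3]
    have f0 := (p0 0).eq_of_nhds
    have f1 := fun i => (p1 i).eq_of_nhds
    have f2 := fun i => (p2 i).eq_of_nhds
    have fA := fun i => (pd_congr (i := i) eA).eq_of_nhds
    have fB := fun i => (pd_congr (i := i) eB).eq_of_nhds
    change 1 / pd 0 Z0 j.1 * (A j.1 * j.vortT + pd 0 A j.1 * j.vort + pd 0 B j.1
      - (pd 0 Z1 j.1 * pd 1 Z1 j.1 + pd 0 Z2 j.1 * pd 1 Z2 j.1) / confFactor Z1 j.1
          * (A j.1 * j.vortX + pd 1 A j.1 * j.vort + pd 1 B j.1)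
      - (pd 0 Z1 j.1 * pd 2 Z1 j.1 + pd 0 Z2 j.1 * pd 2 Z2 j.1) / confFactor Z1 j.1
          * (A j.1 * j.vortY + pd 2 A j.1 * j.vort + pd 2 B j.1)) = _
    rw [f0, f1, f1, f1, f2, f2, f2, fA, fA, fA, fB, fB, fB, hL.eq_of_nhds, eA.eq_of_nhds]
    rfl

/-! ### Independence of the choice of the functions -/

/-- Openness provides two values of `ψ` over every nearby `z`. An affine function of `ψ` is
determined by its values at two points, which fixes both `S` and `Φ`. -/
theorem Represents.germ_unique {D D' : Data} {U U' : Set Base} {φ : Base → Base}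
    (h : Represents D U φ) (h' : Represents D' U' φ) (hU : IsOpen U) (hU' : IsOpen U') {p : Base}
    (hp : p ∈ U) (hp' : p ∈ U') :
    D.Z₀ =ᶠ[𝓝 p.1] D'.Z₀ ∧ D.Z₁ =ᶠ[𝓝 p.1] D'.Z₁ ∧ D.Z₂ =ᶠ[𝓝 p.1] D'.Z₂ ∧
      D.S =ᶠ[𝓝 p.1] D'.S ∧ D.Φ =ᶠ[𝓝 p.1] D'.Φ := by
  have hmem : U ∩ U' ∈ 𝓝 p := (hU.inter hU').mem_nhds ⟨hp, hp'⟩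
  have hev : ∀ᶠ z in 𝓝 p.1, (z, p.2) ∈ U ∩ U' := by
    have hc : Continuous (fun z : Indep => ((z, p.2) : Base)) := by fun_prop
    exact hc.continuousAt.eventually_mem hmem
  obtain ⟨δ, hδ, hδ0⟩ : ∃ δ : ℝ, (p.1, p.2 + δ) ∈ U ∩ U' ∧ δ ≠ 0 := by
    have hc : Continuous (fun δ : ℝ => ((p.1, p.2 + δ) : Base)) := by fun_prop
    have h1 : ∀ᶠ δ in 𝓝 (0 : ℝ), (p.1, p.2 + δ) ∈ U ∩ U' :=
      hc.continuousAt.eventually_mem (by simpa using hmem)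
    have h2 : ∀ᶠ δ in 𝓝[≠] (0 : ℝ), (p.1, p.2 + δ) ∈ U ∩ U' := h1.filter_mono nhdsWithin_le_nhds
    exact (h2.and self_mem_nhdsWithin).exists
  have hev2 : ∀ᶠ z in 𝓝 p.1, (z, p.2 + δ) ∈ U ∩ U' := by
    have hc : Continuous (fun z : Indep => ((z, p.2 + δ) : Base)) := by fun_prop
    exact hc.continuousAt.eventually_mem ((hU.inter hU').mem_nhds hδ)
  have key : ∀ᶠ z in 𝓝 p.1, D.Z₀ z = D'.Z₀ z ∧ D.Z₁ z = D'.Z₁ z ∧ D.Z₂ z = D'.Z₂ z ∧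
      D.S z = D'.S z ∧ D.Φ z = D'.Φ z := by
    filter_upwards [hev, hev2] with z h1 h2
    have e1 := (h.form _ h1.1).2.2.2.symm.trans (h'.form _ h1.2).2.2.2
    have e2 := (h.form _ h2.1).2.2.2.symm.trans (h'.form _ h2.2).2.2.2
    have a0 := congrFun (congrArg Prod.fst e1) 0
    have a1 := congrFun (congrArg Prod.fst e1) 1
    have a2 := congrFun (congrArg Prod.fst e1) 2
    have b1 : D.S z * p.2 + D.Φ z = D'.S z * p.2 + D'.Φ z := congrArg Prod.snd e1
    have b2 : D.S z * (p.2 + δ) + D.Φ z = D'.S z * (p.2 + δ) + D'.Φ z := congrArg Prod.snd e2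
    have hS : D.S z = D'.S z := by
      apply mul_left_cancel₀ hδ0
      linear_combination b2 - b1
    refine ⟨a0, a1, a2, hS, ?_⟩
    rw [hS] at b1; linarith
  exact ⟨key.mono fun _ h => h.1, key.mono fun _ h => h.2.1, key.mono fun _ h => h.2.2.1,
    key.mono fun _ h => h.2.2.2.1, key.mono fun _ h => h.2.2.2.2⟩

theorem Represents.A_B_unique {D D' : Data} {U U' : Set Base} {φ : Base → Base}
    (h : Represents D U φ) (h' : Represents D' U' φ) (hU : IsOpen U) (hU' : IsOpen U') {p : Base}
    (hp : p ∈ U) (hp' : p ∈ U') :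
    D.A =ᶠ[𝓝 p.1] D'.A ∧ D.B =ᶠ[𝓝 p.1] D'.B ∧
      confFactor D.Z₁ =ᶠ[𝓝 p.1] confFactor D'.Z₁ := by
  obtain ⟨e0, e1, e2, e3, e4⟩ := h.germ_unique h' hU hU' hp hp'
  have hL : confFactor D.Z₁ =ᶠ[𝓝 p.1] confFactor D'.Z₁ := by
    filter_upwards [pd_congr (i := 1) e1, pd_congr (i := 2) e1] with z k1 k2
    simp only [confFactor, k1, k2]
  refine ⟨?_, ?_, hL⟩
  · filter_upwards [hL, e3] with z k1 k2
    change D.S z / _ = D'.S z / _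
    rw [k1, k2]
  · filter_upwards [hL, laplacian_congr e4] with z k1 k2
    simp only [Data.B, k1, k2]

theorem Represents.coef_eq {D D' : Data} {U U' : Set Base} {φ : Base → Base}
    (h : Represents D U φ) (h' : Represents D' U' φ) (hU : IsOpen U) (hU' : IsOpen U') {p : Base}
    (hp : p ∈ U) (hp' : p ∈ U') : D.coef p.1 = D'.coef p.1 := by
  obtain ⟨e0, e1, e2, e3, e4⟩ := h.germ_unique h' hU hU' hp hp'
  obtain ⟨e5, e6, e7⟩ := h.A_B_unique h' hU hU' hp hp'
  exact coefOf_congr e1 e2 e4 e3 e5 e6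

theorem Represents.trans_eq {D D' : Data} {U U' : Set Base} {φ : Base → Base}
    (h : Represents D U φ) (h' : Represents D' U' φ) (hU : IsOpen U) (hU' : IsOpen U') {a : Args}
    (hp : a.1 ∈ U) (hp' : a.1 ∈ U') (s : ℝ) : D.trans a s = D'.trans a s := by
  obtain ⟨e0, e1, e2, e3, e4⟩ := h.germ_unique h' hU hU' hp hp'
  obtain ⟨e5, e6, e7⟩ := h.A_B_unique h' hU hU' hp hp'
  have f : ∀ {g g' : Indep → ℝ}, g =ᶠ[𝓝 a.1.1] g' → ∀ i, pd i g a.1.1 = pd i g' a.1.1 :=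
    fun h i => (pd_congr h).eq_of_nhds
  simp only [Data.trans, f e0, f e1, f e2, f e5, f e6, e5.eq_of_nhds, e7.eq_of_nhds]

/-! ### Smoothness of the transformation of the arguments -/

theorem Data.RegularAt.A_ne {D : Data} {z : Indep} (h : D.RegularAt z) : D.A z ≠ 0 :=
  div_ne_zero h.S_ne h.factor.self_of_nhds

theorem Data.RegularAt.contDiffAt_pull {D : Data} {z : Indep} (h : D.RegularAt z)
    (w : Fin 8 → ℝ) :
    ContDiffAt ℝ ∞ (fun x : Indep × (Fin 8 → ℝ) => (D.coef x.1).pull x.2) (z, w) := by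
  obtain ⟨Z1, s1, e1⟩ := h.smooth_Z₁.exists_contDiff
  obtain ⟨Z2, s2, e2⟩ := h.smooth_Z₂.exists_contDiff
  obtain ⟨S, sS, eS⟩ := h.smooth_S.exists_contDiff
  obtain ⟨Φ, sΦ, eΦ⟩ := h.smooth_Φ.exists_contDiff
  obtain ⟨A, sA, eA⟩ := h.smooth_A.exists_contDiff
  obtain ⟨B, sB, eB⟩ := h.smooth_B.exists_contDiff
  have hev : ∀ᶠ z' in 𝓝 z, coefOf Z1 Z2 Φ S A B z' = D.coef z' := by
    filter_upwards [e1.eventuallyEq_nhds, e2.eventuallyEq_nhds, eS.eventuallyEq_nhds,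
      eΦ.eventuallyEq_nhds, eA.eventuallyEq_nhds, eB.eventuallyEq_nhds] with z' k1 k2 k3 k4 k5 k6
    exact coefOf_congr k1 k2 k4 k3 k5 k6
  have e : (fun x : Indep × (Fin 8 → ℝ) => (D.coef x.1).pull x.2) =ᶠ[𝓝 (z, w)]
      fun x => (coefOf Z1 Z2 Φ S A B x.1).pull x.2 := by
    have ht : Tendsto (fun x : Indep × (Fin 8 → ℝ) => x.1) (𝓝 (z, w)) (𝓝 z) :=
      continuousAt_fst
    filter_upwards [ht.eventually hev] with x hx
    rw [hx]
  refine ContDiffAt.congr_of_eventuallyEq ?_ e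
  have hS : S z ≠ 0 := by rw [eS.eq_of_nhds]; exact h.S_ne
  have hA : A z ≠ 0 := by rw [eA.eq_of_nhds]; exact h.A_ne
  rw [contDiffAt_pi]
  intro k
  fin_cases k <;> simp only [Coef.pull, coefOf, Fin.isValue, Matrix.cons_val, Fin.zero_eta,
      Fin.mk_one, Fin.reduceFinMk] <;> fun_prop (disch := assumption)

theorem Data.RegularAt.contDiffAt_trans {D : Data} {a : Args} (h : D.RegularAt a.1.1) (s : ℝ) :
    ContDiffAt ℝ ∞ (fun x : Args × ℝ => D.trans x.1 x.2) (a, s) := by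
  obtain ⟨Z0, s0, e0⟩ := h.smooth_Z₀.exists_contDiff
  obtain ⟨Z1, s1, e1⟩ := h.smooth_Z₁.exists_contDiff
  obtain ⟨Z2, s2, e2⟩ := h.smooth_Z₂.exists_contDiff
  obtain ⟨A, sA, eA⟩ := h.smooth_A.exists_contDiff
  obtain ⟨B, sB, eB⟩ := h.smooth_B.exists_contDiff
  have hT : pd 0 D.Z₀ a.1.1 = deriv D.T (a.1.1 0) := pd_comp_coord_zero h.diff_T 0
  have hT0 : pd 0 Z0 a.1.1 ≠ 0 := by
    rw [(pd_congr e0).eq_of_nhds, hT]; exact h.T_ne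
  have hL : confFactor Z1 =ᶠ[𝓝 a.1.1] confFactor D.Z₁ := by
    filter_upwards [pd_congr (i := 1) e1, pd_congr (i := 2) e1] with z k1 k2
    simp only [confFactor, k1, k2]
  have hL0 : confFactor Z1 a.1.1 ≠ 0 := by rw [hL.eq_of_nhds]; exact h.factor.self_of_nhds
  have f : ∀ {g g' : Indep → ℝ}, g =ᶠ[𝓝 a.1.1] g' →
      ∀ᶠ z in 𝓝 a.1.1, ∀ i, pd i g z = pd i g' z := by
    intro g g' hg
    filter_upwards [hg.eventuallyEq_nhds] with z hz i
    exact (pd_congr hz).eq_of_nhds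
  have hev : ∀ᶠ x : Args × ℝ in 𝓝 (a, s), D.trans x.1 x.2 = 1 / pd 0 Z0 x.1.1.1 *
      (A x.1.1.1 * x.2 + pd 0 A x.1.1.1 * x.1.2 2 + pd 0 B x.1.1.1
      - (pd 0 Z1 x.1.1.1 * pd 1 Z1 x.1.1.1 + pd 0 Z2 x.1.1.1 * pd 1 Z2 x.1.1.1)
          / confFactor Z1 x.1.1.1
          * (A x.1.1.1 * x.1.2 3 + pd 1 A x.1.1.1 * x.1.2 2 + pd 1 B x.1.1.1)
      - (pd 0 Z1 x.1.1.1 * pd 2 Z1 x.1.1.1 + pd 0 Z2 x.1.1.1 * pd 2 Z2 x.1.1.1)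
          / confFactor Z1 x.1.1.1
          * (A x.1.1.1 * x.1.2 4 + pd 2 A x.1.1.1 * x.1.2 2 + pd 2 B x.1.1.1)) := by
    have hc : Continuous (fun x : Args × ℝ => x.1.1.1) := by fun_prop
    have ht : Tendsto (fun x : Args × ℝ => x.1.1.1) (𝓝 (a, s)) (𝓝 a.1.1) := hc.tendsto (a, s)
    filter_upwards [ht.eventually
      ((((f e0).and (f e1)).and ((f e2).and (f eA))).and ((f eB).and (eA.and hL)))]
      with x ⟨⟨⟨k0, k1⟩, k2, k3⟩, k4, k5, k6⟩
    simp only [Data.trans, k0, k1, k2, k3, k4, k5, k6]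
  refine ContDiffAt.congr_of_eventuallyEq ?_ hev
  fun_prop (disch := assumption)

theorem Data.trans_sub (D : Data) (a : Args) (s s' : ℝ) :
    D.trans a s - D.trans a s' = D.A a.1.1 / pd 0 D.Z₀ a.1.1 * (s - s') := by
  simp only [Data.trans]; ring

theorem Data.RegularAt.slope_ne {D : Data} {z : Indep} (h : D.RegularAt z) :
    D.A z / pd 0 D.Z₀ z ≠ 0 := by
  refine div_ne_zero h.A_ne ?_
  have : pd 0 D.Z₀ z = deriv D.T (z 0) := pd_comp_coord_zero h.diff_T 0
  rw [this]; exact h.T_ne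

theorem Data.RegularAt.trans_injective {D : Data} {a : Args} (h : D.RegularAt a.1.1) :
    Function.Injective (D.trans a) := by
  intro s s' hs
  have := D.trans_sub a s s'
  rw [hs, sub_self] at this
  exact sub_eq_zero.1 ((mul_eq_zero.1 this.symm).resolve_left h.slope_ne)

theorem Data.hasDerivAt_trans (D : Data) (a : Args) (s : ℝ) :
    HasDerivAt (D.trans a) (D.A a.1.1 / pd 0 D.Z₀ a.1.1) s := by
  have e : D.trans a = fun s' => D.A a.1.1 / pd 0 D.Z₀ a.1.1 * (s' - s) + D.trans a s := by
    funext s'; rw [← D.trans_sub]; ring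
  rw [e]
  simpa using (((hasDerivAt_id s).sub_const s).const_mul
    (D.A a.1.1 / pd 0 D.Z₀ a.1.1)).add_const (D.trans a s)

/-! ### Locally explicit transformations -/

/-- `φ` has the explicit form near every point of `Ω`. -/
def LocallyExplicit (Ω : Set Base) (φ : Base → Base) : Prop :=
  ∀ p ∈ Ω, ∃ (D : Data) (U : Set Base), IsOpen U ∧ p ∈ U ∧ Represents D U φ

open Classical in
/-- Functions that represent `φ` near `p`. -/
noncomputable def dataAt (φ : Base → Base) (p : Base) : Data :=
  if h : ∃ (D : Data) (U : Set Base), IsOpen U ∧ p ∈ U ∧ Represents D U φ then h.choose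
  else ⟨0, 0, 0, 0, 0⟩

theorem LocallyExplicit.dataAt_spec {Ω : Set Base} {φ : Base → Base} (h : LocallyExplicit Ω φ)
    {p : Base} (hp : p ∈ Ω) : ∃ U : Set Base, IsOpen U ∧ p ∈ U ∧ Represents (dataAt φ p) U φ := by
  have hp' := h p hp
  rw [dataAt, dif_pos hp']
  exact hp'.choose_spec

theorem LocallyExplicit.regularAt {Ω : Set Base} {φ : Base → Base} (h : LocallyExplicit Ω φ)
    {p : Base} (hp : p ∈ Ω) : (dataAt φ p).RegularAt p.1 := by
  obtain ⟨U, hU, hpU, hD⟩ := h.dataAt_spec hp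
  exact hD.regularAt hU hpU

/-- The last component of the transformation of the jets and the arbitrary element. -/
noncomputable def lastComponent (φ : Base → Base) (j : Jet) (s : ℝ) : ℝ :=
  (dataAt φ j.pt).trans j.args s

/-- The functions chosen by `dataAt` vary with the point in no controlled way. A single `D` replaces
them at all points of `U`, which gives smoothness of everything built from them. -/
theorem Represents.dataAt_eq {D : Data} {U : Set Base} {φ : Base → Base} (h : Represents D U φ)
    (hU : IsOpen U) {p : Base} (hp : p ∈ U) : (dataAt φ p).coef p.1 = D.coef p.1 ∧
      ∀ a : Args, a.1 = p → ∀ s, (dataAt φ p).trans a s = D.trans a s := by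
  have hl : LocallyExplicit U φ := fun q hq => ⟨D, U, hU, hq, h⟩
  obtain ⟨V, hV, hpV, hD⟩ := hl.dataAt_spec hp
  refine ⟨hD.coef_eq h hV hU hpV hp, ?_⟩
  rintro a rfl s
  exact hD.trans_eq h hV hU hpV hp s

theorem LocallyExplicit.prolongs {Ω : Set Base} {φ : Base → Base} (h : LocallyExplicit Ω φ)
    {j j' : Jet} (hj : j.pt ∈ Ω) (hP : Prolongs φ j j') :
    j'.pt = φ j.pt ∧ ((dataAt φ j.pt).coef j.1).Regular ∧
      j.args.2 = ((dataAt φ j.pt).coef j.1).pull j'.args.2 ∧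
      j'.vortT = lastComponent φ j j.vortT := by
  obtain ⟨U, hU, hpU, hD⟩ := h.dataAt_spec hj
  exact hD.prolongs hU hpU hP

theorem isBaseDomain_of_convex {Ω : Set Base} (ho : IsOpen Ω) (hc : Convex ℝ Ω) :
    IsBaseDomain Ω := by
  refine ⟨ho, fun t => Convex.isPreconnected ?_, fun z => Convex.isPreconnected ?_⟩
  · rintro p ⟨hp, hp0⟩ q ⟨hq, hq0⟩ a b ha hb hab
    refine ⟨hc hp hq ha hb hab, ?_⟩
    change a * p.1 0 + b * q.1 0 = t
    rw [hp0, hq0, ← add_mul, hab, one_mul]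
  · intro s hs s' hs' a b ha hb hab
    have := hc hs hs' ha hb hab
    rwa [Prod.smul_mk, Prod.smul_mk, Prod.mk_add_mk, ← add_smul, hab, one_smul] at this

/-- Transformations that have the explicit form infinitesimally have it locally. -/
theorem locallyExplicit_of_infExplicit {Ω : Set Base} (hΩ : IsOpen Ω) {φ : Base → Base}
    (hφ : IsPointTransformation Ω φ) (hinf : ∀ p ∈ Ω, InfExplicit φ p) : LocallyExplicit Ω φ := by
  intro p hp
  obtain ⟨r, hr, hb⟩ := Metric.isOpen_iff.1 hΩ p hp
  obtain ⟨D, hD⟩ := exists_represents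
    (isBaseDomain_of_convex Metric.isOpen_ball (convex_ball p r)) (hφ.smooth.mono hb)
    (fun q hq => hφ.fderiv_injective (hb hq)) (fun q hq => hinf q (hb hq))
  exact ⟨D, _, Metric.isOpen_ball, Metric.mem_ball_self hr, hD⟩

theorem IsAdmissible.locallyExplicit {f f' : VortEq} {φ : Base → Base} (h : IsAdmissible f f' φ) :
    LocallyExplicit f.base φ :=
  locallyExplicit_of_infExplicit f.isOpen_base h.point fun _ hp => h.infExplicit hp

/-! ### Nondegeneracy of explicit transformations and their action on jets. -/

theorem Represents.fderiv_apply {D : Data} {Ω : Set Base} {φ : Base → Base} (h : Represents D Ω φ)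
    (hΩ : IsOpen Ω) {p : Base} (hp : p ∈ Ω) (w : Base) :
    (fderiv ℝ φ p w).1 0 = fderiv ℝ D.Z₀ p.1 w.1 ∧
    (fderiv ℝ φ p w).1 1 = fderiv ℝ D.Z₁ p.1 w.1 ∧
    (fderiv ℝ φ p w).1 2 = fderiv ℝ D.Z₂ p.1 w.1 ∧
    (fderiv ℝ φ p w).2 = D.S p.1 * w.2 + p.2 * fderiv ℝ D.S p.1 w.1 + fderiv ℝ D.Φ p.1 w.1 := by
  have hr := h.regularAt hΩ hp
  have hd : DifferentiableAt ℝ φ p := (h.contDiffAt hΩ hp).differentiableAt (by simp)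
  have hform : ∀ᶠ q in 𝓝 p, φ q = (![D.Z₀ q.1, D.Z₁ q.1, D.Z₂ q.1], D.S q.1 * q.2 + D.Φ q.1) := by
    filter_upwards [hΩ.mem_nhds hp] with q hq
    exact (h.form q hq).2.2.2
  have hk : ∀ k : Fin 3, (fderiv ℝ φ p w).1 k = fderiv ℝ (fun q => (φ q).1 k) p w := by
    intro k
    have h1 : DifferentiableAt ℝ (fun q => (φ q).1) p := by fun_prop
    have h2 := (hasFDerivAt_apply (𝕜 := ℝ) k ((φ p).1)).comp p h1.hasFDerivAt
    erw [h2.fderiv]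
    rw [← fderiv_fst_comp hd w]; rfl
  have dS : ∀ {g : Indep → ℝ}, SmoothNear g p.1 → HasFDerivAt (fun q : Base => g q.1)
      ((fderiv ℝ g p.1).comp (ContinuousLinearMap.fst ℝ Indep ℝ)) p := by
    intro g hg
    exact (hg.self_of_nhds.differentiableAt (by simp)).hasFDerivAt.comp p hasFDerivAt_fst
  have comp : ∀ (k : Fin 3) (g : Indep → ℝ), SmoothNear g p.1 →
      (∀ᶠ q in 𝓝 p, (φ q).1 k = g q.1) → (fderiv ℝ φ p w).1 k = fderiv ℝ g p.1 w.1 := by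
    intro k g hg he
    rw [hk, EventuallyEq.fderiv_eq (f := fun q : Base => g q.1) he, (dS hg).fderiv]; rfl
  refine ⟨comp 0 _ hr.smooth_Z₀ (hform.mono fun q hq => by rw [hq]; rfl),
    comp 1 _ hr.smooth_Z₁ (hform.mono fun q hq => by rw [hq]; rfl),
    comp 2 _ hr.smooth_Z₂ (hform.mono fun q hq => by rw [hq]; rfl), ?_⟩
  have he : (fun q => (φ q).2) =ᶠ[𝓝 p] fun q => D.S q.1 * q.2 + D.Φ q.1 :=
    hform.mono fun q hq => by simp only [hq]
  rw [← fderiv_snd_comp hd w, he.fderiv_eq]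
  have := (((dS hr.smooth_S).mul hasFDerivAt_snd).add (dS hr.smooth_Φ)).fderiv
  erw [this]
  simp

theorem Coef.Regular.eq_zero {c : Coef} (h : c.Regular) {a b : ℝ} (h1 : c.p * a + c.q * b = 0)
    (h2 : c.r * a + c.s * b = 0) : a = 0 ∧ b = 0 := by
  obtain ⟨k1, k2, k3⟩ := conformal_columns h.orth h.norm
  constructor
  · apply mul_left_cancel₀ h.factor
    linear_combination c.p * h1 + c.r * h2 - a * k2 - b * k1
  · apply mul_left_cancel₀ h.factor
    linear_combination c.q * h1 + c.s * h2 - b * k3 - a * k1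

theorem Data.RegularAt.coef_regular {D : Data} {z : Indep} (h : D.RegularAt z) :
    (D.coef z).Regular :=
  ⟨h.orth.self_of_nhds, h.norm.self_of_nhds, h.factor.self_of_nhds, h.S_ne, h.A_ne⟩

/-- The differential of the new independent variables is block triangular, with the blocks `T_t` and
a conformal matrix. Every graph is therefore mapped to a graph, and the prolongation is defined at
every jet over `Ω`. -/
theorem Represents.fst_eq_zero {D : Data} {Ω : Set Base} {φ : Base → Base} (h : Represents D Ω φ)
    (hΩ : IsOpen Ω) {p : Base} (hp : p ∈ Ω) {w : Base} (hw : (fderiv ℝ φ p w).1 = 0) :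
    w.1 = 0 := by
  have hr := h.regularAt hΩ hp
  obtain ⟨h0, h1, h2, -⟩ := h.fderiv_apply hΩ hp w
  rw [hw] at h0 h1 h2
  simp only [Pi.zero_apply] at h0 h1 h2
  have e0 : pd 0 D.Z₀ p.1 = deriv D.T (p.1 0) := pd_comp_coord_zero hr.diff_T 0
  obtain ⟨c1, c2, -⟩ := hr.const.self_of_nhds
  rw [fderiv_eq_sum_pd, c1, c2, e0, zero_mul, zero_mul, add_zero, add_zero] at h0
  have w0 := (mul_eq_zero.1 h0.symm).resolve_left hr.T_ne
  rw [fderiv_eq_sum_pd, w0, mul_zero, zero_add] at h1 h2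
  obtain ⟨w1, w2⟩ := hr.coef_regular.eq_zero (a := w.1 1) (b := w.1 2) h1.symm h2.symm
  funext k
  fin_cases k
  · exact w0
  · exact w1
  · exact w2

theorem LocallyExplicit.fderiv_injective {Ω : Set Base} {φ : Base → Base}
    (h : LocallyExplicit Ω φ) {p : Base} (hp : p ∈ Ω) : ∀ w, fderiv ℝ φ p w = 0 → w = 0 := by
  obtain ⟨D, U, hU, hpU, hD⟩ := h p hp
  intro w hw
  have h1 := hD.fst_eq_zero hU hpU (w := w) (by rw [hw]; rfl)
  obtain ⟨-, -, -, h2⟩ := hD.fderiv_apply hU hpU w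
  rw [hw, h1] at h2
  simp only [Prod.snd_zero, map_zero, mul_zero, add_zero] at h2
  exact Prod.ext h1 ((mul_eq_zero.1 h2.symm).resolve_left (hD.regularAt hU hpU).S_ne)

theorem LocallyExplicit.contDiffAt {Ω : Set Base} {φ : Base → Base} (h : LocallyExplicit Ω φ)
    {p : Base} (hp : p ∈ Ω) : ContDiffAt ℝ ∞ φ p := by
  obtain ⟨D, U, hU, hpU, hD⟩ := h p hp
  exact hD.contDiffAt hU hpU

theorem LocallyExplicit.isPointTransformation {Ω : Set Base} {φ : Base → Base}
    (h : LocallyExplicit Ω φ) (hinj : InjOn φ Ω) : IsPointTransformation Ω φ := by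
  refine ⟨fun p hp => (h.contDiffAt hp).contDiffWithinAt, hinj, fun p hp => ?_⟩
  have h1 : Function.Injective (fderiv ℝ φ p : Base →ₗ[ℝ] Base) :=
    (injective_iff_map_eq_zero _).2 (h.fderiv_injective hp)
  have h2 : IsUnit (fderiv ℝ φ p : Base →ₗ[ℝ] Base) :=
    (Module.End.isUnit_iff _).2 ⟨h1, LinearMap.surjective_of_injective h1⟩
  exact ((LinearMap.isUnit_iff_isUnit_det _).1 h2).ne_zero

theorem LocallyExplicit.mono {Ω Ω' : Set Base} {φ : Base → Base} (h : LocallyExplicit Ω φ)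
    (hs : Ω' ⊆ Ω) : LocallyExplicit Ω' φ := fun p hp => h p (hs hp)

theorem LocallyExplicit.exists_prolongs {Ω : Set Base} (hΩ : IsOpen Ω) {φ : Base → Base}
    (h : LocallyExplicit Ω φ) {j : Jet} (hj : j.pt ∈ Ω) : ∃ j', Prolongs φ j j' := by
  obtain ⟨D, U, hU, hpU, hD⟩ := h j.pt hj
  obtain ⟨φ', hφ', hφφ'⟩ := exists_contDiff_eventuallyEq (f := φ) (x := j.pt) (by
    filter_upwards [hΩ.mem_nhds hj] with q hq using h.contDiffAt hq)
  obtain ⟨u, hu, huj⟩ := exists_jet_eq j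
  have hpt : (j.1, u j.1) = j.pt := by
    conv_rhs => rw [← huj]
    rfl
  obtain ⟨Y, v, hY, hv, -, -, -, h4⟩ := exists_prolongation hφ' hu (z₀ := j.1) (by
    intro w hw
    rw [fderiv_baseMap hφ' hu, hpt, hφφ'.fderiv_eq] at hw
    exact hD.fst_eq_zero hU hpU hw)
  refine ⟨jet v (φ' (j.1, u j.1)).1, ?_⟩
  have h5 := Prolongs.of_contDiff hu hv rfl h4
  rw [huj] at h5
  exact h5.congr hφφ'.symm

/-- The old arguments are the `pull` of the new ones, with coefficients depending on the base point
only, and `pull` is injective. -/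
theorem LocallyExplicit.args_eq_of_prolongs {Ω : Set Base} {φ : Base → Base}
    (h : LocallyExplicit Ω φ) {j₁ j₂ j₁' j₂' : Jet} (hj : j₁.pt ∈ Ω) (he : j₁.args = j₂.args)
    (h₁ : Prolongs φ j₁ j₁') (h₂ : Prolongs φ j₂ j₂') : j₁'.args = j₂'.args := by
  have hpt : j₁.pt = j₂.pt := congrArg Prod.fst he
  have hz : j₁.1 = j₂.1 := congrArg (fun p : Base => p.1) hpt
  obtain ⟨a1, a2, a3, -⟩ := h.prolongs hj h₁
  obtain ⟨b1, b2, b3, -⟩ := h.prolongs (hpt ▸ hj) h₂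
  refine Prod.ext ?_ ?_
  · exact a1.trans (by rw [hpt]; exact b1.symm)
  · rw [he, b3, ← hpt, ← hz] at a3
    have := congrArg ((dataAt φ j₁.pt).coef j₁.1).push a3
    rw [a2.push_pull, a2.push_pull] at this
    exact this.symm

theorem Data.RegularAt.trans_surjective {D : Data} {a : Args} (h : D.RegularAt a.1.1) :
    Function.Surjective (D.trans a) := by
  intro y
  refine ⟨(y - D.trans a 0) / (D.A a.1.1 / pd 0 D.Z₀ a.1.1), ?_⟩
  have := D.trans_sub a ((y - D.trans a 0) / (D.A a.1.1 / pd 0 D.Z₀ a.1.1)) 0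
  rw [sub_zero, mul_div_cancel₀ _ h.slope_ne] at this
  linarith

theorem argsJet_pt (a : Args) (r s : ℝ) : (argsJet a r s).pt = a.1 := rfl

theorem lastComponent_argsJet (φ : Base → Base) (a : Args) (r s s' : ℝ) :
    lastComponent φ (argsJet a r s) s' = (dataAt φ a.1).trans a s' := by
  rw [lastComponent, argsJet_args, argsJet_pt]

/-- The image of the first equation of an admissible transformation is the second one. -/
theorem IsAdmissible.isImage {f f' : VortEq} {φ : Base → Base} (h : IsAdmissible f f' φ) :
    IsImage φ (lastComponent φ) f f' := by
  have hl := h.locallyExplicit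
  have key : ∀ j j' : Jet, j.pt ∈ f.base → Prolongs φ j j' → ∀ s,
      (j.args ∈ f.dom ∧ s = f.F j.args) ↔
        (j'.args ∈ f'.dom ∧ lastComponent φ j s = f'.F j'.args) := by
    intro j j' hj hP s
    -- A jet with the arguments of `j` but with `ζ_t = s` arbitrary. Its image has the same
    -- arguments as `j'`, so admissibility becomes a statement about the graphs of `F` and `F̃`.
    have hj₂ : (argsJet j.args 0 s).pt = j.pt := argsJet_pt _ _ _
    obtain ⟨j₂', hP₂⟩ := hl.exists_prolongs f.isOpen_base (j := argsJet j.args 0 s)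
      (by rw [hj₂]; exact hj)
    have he := hl.args_eq_of_prolongs hj (argsJet_args _ _ _).symm hP hP₂
    have hm := h.maps _ _ (by rw [hj₂]; exact hj) hP₂
    obtain ⟨-, -, -, hv⟩ := hl.prolongs (by rw [hj₂]; exact hj) hP₂
    rw [lastComponent_argsJet, argsJet_vortT] at hv
    simp only [VortEq.locus, mem_ofPred_eq, argsJet_args, argsJet_vortT, hv, ← he] at hm
    exact hm
  refine ⟨h.base_eq, fun j j' hj hP => ⟨fun hd => ?_, fun hd => ?_⟩, fun j j' hd hP => ?_⟩
  · exact ((key j j' hj hP _).1 ⟨hd, rfl⟩).1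
  -- The value `s` of `ζ_t` whose image lies on the second equation; the equivalence `key` then
  -- returns the arguments to the domain of `F`.
  · obtain ⟨s, hs⟩ := Data.RegularAt.trans_surjective (a := j.args)
      (hl.regularAt hj) (f'.F j'.args)
    exact ((key j j' hj hP s).2 ⟨hd, hs⟩).1
  · exact ((key j j' ⟨_, hd, rfl⟩ hP _).1 ⟨hd, rfl⟩).2.symm

/-! ### The image of an equation -/

section Push

variable {φ : Base → Base} {U : Set Base}

theorem LocallyExplicit.contDiffAt_invFunOn (h : LocallyExplicit U φ) (hU : IsOpen U)
    (hinj : InjOn φ U) {p : Base} (hp : p ∈ U) :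
    ContDiffAt ℝ ∞ (Function.invFunOn φ U) (φ p) ∧ φ '' U ∈ 𝓝 (φ p) := by
  obtain ⟨g, hg, hgp, -, hg2⟩ := exists_local_inverse (f := φ) (x := p)
    (by filter_upwards [hU.mem_nhds hp] with q hq using h.contDiffAt hq) (h.fderiv_injective hp)
  have hev : ∀ᶠ y in 𝓝 (φ p), g y ∈ U :=
    hg.continuous.continuousAt.eventually_mem (by rw [hgp]; exact hU.mem_nhds hp)
  constructor
  · refine hg.contDiffAt.congr_of_eventuallyEq ?_
    filter_upwards [hev, hg2] with y h1 h2
    conv_lhs => rw [← h2]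
    exact hinj.leftInvOn_invFunOn h1
  · filter_upwards [hev, hg2] with y h1 h2
    exact ⟨g y, h1, h2⟩

/-- The old arguments in terms of the new ones. -/
noncomputable def pullArgs (φ : Base → Base) (U : Set Base) (a : Args) : Args :=
  (Function.invFunOn φ U a.1,
    ((dataAt φ (Function.invFunOn φ U a.1)).coef (Function.invFunOn φ U a.1).1).pull a.2)

/-- The value of the new arbitrary element in terms of the old one and the new arguments. -/
noncomputable def pushValue (φ : Base → Base) (U : Set Base) (F : Args → ℝ) (a : Args) : ℝ :=
  (dataAt φ (Function.invFunOn φ U a.1)).trans (pullArgs φ U a) (F (pullArgs φ U a))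

theorem LocallyExplicit.contDiffAt_pullArgs (h : LocallyExplicit U φ) (hU : IsOpen U)
    (hinj : InjOn φ U) {a : Args} (ha : a.1 ∈ φ '' U) : ContDiffAt ℝ ∞ (pullArgs φ U) a := by
  obtain ⟨p, hp, hpa⟩ := ha
  obtain ⟨D, V, hV, hpV, hD⟩ := h p hp
  obtain ⟨hχ, -⟩ := h.contDiffAt_invFunOn hU hinj hp
  have hχp : Function.invFunOn φ U (φ p) = p := hinj.leftInvOn_invFunOn hp
  rw [hpa] at hχ hχp
  have hχ' : ContDiffAt ℝ ∞ (fun b : Args => Function.invFunOn φ U b.1) a :=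
    hχ.comp a contDiffAt_fst
  have hev : ∀ᶠ b : Args in 𝓝 a, Function.invFunOn φ U b.1 ∈ V :=
    hχ'.continuousAt.eventually_mem (by rw [hχp]; exact hV.mem_nhds hpV)
  refine ContDiffAt.congr_of_eventuallyEq (f := fun b : Args => (Function.invFunOn φ U b.1,
    (D.coef (Function.invFunOn φ U b.1).1).pull b.2)) (hχ'.prodMk ?_) ?_
  · have h1 := (hD.regularAt hV hpV).contDiffAt_pull a.2
    have h2 : ContDiffAt ℝ ∞
        (fun b : Args => ((Function.invFunOn φ U b.1).1, b.2)) a := by fun_prop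
    exact ContDiffAt.comp (f := fun b : Args => ((Function.invFunOn φ U b.1).1, b.2)) a
      (by rw [hχp]; exact h1) h2
  · filter_upwards [hev] with b hb
    rw [pullArgs, (hD.dataAt_eq hV hb).1]

theorem LocallyExplicit.contDiffAt_pushValue (h : LocallyExplicit U φ) (hU : IsOpen U)
    (hinj : InjOn φ U) {a : Args} (ha : a.1 ∈ φ '' U) {F : Args → ℝ}
    (hF : ContDiffAt ℝ ∞ F (pullArgs φ U a)) : ContDiffAt ℝ ∞ (pushValue φ U F) a := by
  have hpull := h.contDiffAt_pullArgs hU hinj ha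
  obtain ⟨p, hp, hpa⟩ := ha
  obtain ⟨D, V, hV, hpV, hD⟩ := h p hp
  have hχp : Function.invFunOn φ U (φ p) = p := hinj.leftInvOn_invFunOn hp
  rw [hpa] at hχp
  have hev : ∀ᶠ b : Args in 𝓝 a, (pullArgs φ U b).1 ∈ V :=
    hpull.fst.continuousAt.eventually_mem (by
      change V ∈ 𝓝 (Function.invFunOn φ U a.1); rw [hχp]; exact hV.mem_nhds hpV)
  refine ContDiffAt.congr_of_eventuallyEq
    (f := fun b : Args => D.trans (pullArgs φ U b) (F (pullArgs φ U b))) ?_ ?_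
  · have h1 : D.RegularAt (pullArgs φ U a).1.1 := by
      change D.RegularAt (Function.invFunOn φ U a.1).1
      rw [hχp]; exact hD.regularAt hV hpV
    exact ContDiffAt.comp (f := fun b : Args => (pullArgs φ U b, F (pullArgs φ U b))) a
      (h1.contDiffAt_trans _) (hpull.prodMk (hF.comp a hpull))
  · filter_upwards [hev] with b hb
    exact (hD.dataAt_eq hV hb).2 _ rfl _

/-- The image of an equation under an explicit transformation. -/
noncomputable def VortEq.push (f : VortEq) (φ : Base → Base) (h : LocallyExplicit f.base φ)
    (hinj : InjOn φ f.base) : VortEq where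
  dom := {a | a.1 ∈ φ '' f.base ∧ pullArgs φ f.base a ∈ f.dom}
  F := pushValue φ f.base f.F
  isOpen_dom := by
    rw [isOpen_iff_mem_nhds]
    rintro a ⟨ha, hd⟩
    have h1 := (h.contDiffAt_pullArgs f.isOpen_base hinj ha).continuousAt.eventually_mem
      (f.isOpen_dom.mem_nhds hd)
    have h2 : ∀ᶠ b : Args in 𝓝 a, b.1 ∈ φ '' f.base := by
      obtain ⟨p, hp, hpa⟩ := ha
      have := (h.contDiffAt_invFunOn f.isOpen_base hinj hp).2
      rw [hpa] at this
      exact continuousAt_fst.eventually_mem this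
    filter_upwards [h1, h2] with b k1 k2 using ⟨k2, k1⟩
  smooth := by
    rintro a ⟨ha, hd⟩
    exact (h.contDiffAt_pushValue f.isOpen_base hinj ha
      (f.smooth.contDiffAt (f.isOpen_dom.mem_nhds hd))).contDiffWithinAt

variable {f : VortEq}

theorem pullArgs_of_prolongs (h : LocallyExplicit U φ) (hinj : InjOn φ U) {j j' : Jet}
    (hj : j.pt ∈ U) (hP : Prolongs φ j j') : pullArgs φ U j'.args = j.args := by
  obtain ⟨h1, h2, h3, -⟩ := h.prolongs hj hP
  have hχ : Function.invFunOn φ U j'.args.1 = j.pt := by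
    change Function.invFunOn φ U j'.pt = j.pt
    rw [h1]; exact hinj.leftInvOn_invFunOn hj
  refine Prod.ext hχ ?_
  rw [h3, pullArgs, hχ]; rfl

theorem VortEq.push_base (h : LocallyExplicit f.base φ) (hinj : InjOn φ f.base) :
    (f.push φ h hinj).base = φ '' f.base := by
  apply Subset.antisymm
  · rintro _ ⟨a, ha, rfl⟩
    exact ha.1
  · rintro _ ⟨p, hp, rfl⟩
    obtain ⟨a, ha, rfl⟩ := hp
    have hp : a.1 ∈ f.base := ⟨a, ha, rfl⟩
    obtain ⟨j', hP⟩ := h.exists_prolongs f.isOpen_base (j := argsJet a 0 0) hp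
    have hpt := (h.prolongs (j := argsJet a 0 0) hp hP).1
    rw [argsJet_pt] at hpt
    refine ⟨j'.args, ⟨?_, ?_⟩, hpt⟩
    · exact ⟨a.1, hp, hpt.symm⟩
    · rw [pullArgs_of_prolongs (j := argsJet a 0 0) h hinj hp hP, argsJet_args]; exact ha

theorem VortEq.push_isImage (h : LocallyExplicit f.base φ) (hinj : InjOn φ f.base) :
    IsImage φ (lastComponent φ) f (f.push φ h hinj) := by
  refine ⟨f.push_base h hinj, fun j j' hj hP => ?_, fun j j' hd hP => ?_⟩
  · have hpt : j'.args.1 ∈ φ '' f.base := ⟨j.pt, hj, (h.prolongs hj hP).1.symm⟩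
    change j.args ∈ f.dom ↔ j'.args.1 ∈ φ '' f.base ∧ pullArgs φ f.base j'.args ∈ f.dom
    rw [pullArgs_of_prolongs h hinj hj hP, and_iff_right hpt]
  · have hj : j.pt ∈ f.base := ⟨_, hd, rfl⟩
    have hpull := pullArgs_of_prolongs h hinj hj hP
    have hχ : Function.invFunOn φ f.base j'.args.1 = j.pt := congrArg (fun a : Args => a.1) hpull
    change pushValue φ f.base f.F j'.args = _
    rw [pushValue, hpull, hχ]; rfl

/-- The quantities `ζ_t` and `F` are transformed by the same injective affine function, so they
coincide before the transformation exactly when they coincide after it. -/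
theorem IsImage.isAdmissible {f' : VortEq} (h : LocallyExplicit f.base φ) (hinj : InjOn φ f.base)
    (hI : IsImage φ (lastComponent φ) f f') : IsAdmissible f f' φ := by
  refine ⟨h.isPointTransformation hinj, hI.base_eq, fun j j' hj hP => ?_⟩
  have h1 := hI.dom_iff j j' hj hP
  obtain ⟨-, -, -, h2⟩ := h.prolongs hj hP
  simp only [VortEq.locus, mem_ofPred_eq, ← h1]
  refine and_congr_right fun hd => ?_
  rw [hI.value j j' hd hP, h2]
  exact (Data.RegularAt.trans_injective (a := j.args) (h.regularAt hj)).eq_iff.symm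

end Push

/-! ### Membership of explicit transformations in equivalence groups. -/

theorem contDiff_jet_d (a b c : Fin 5) (h : (a : ℕ) + (b : ℕ) + (c : ℕ) ≤ 4) :
    ContDiff ℝ ∞ fun j : Jet => j.d a b c h := by
  unfold Jet.d; fun_prop

theorem contDiff_jet_args : ContDiff ℝ ∞ Jet.args := by
  refine ContDiff.prodMk (contDiff_fst.prodMk (contDiff_jet_d _ _ _ _)) ?_
  rw [contDiff_pi]
  intro k
  fin_cases k
  · exact contDiff_jet_d _ _ _ _
  · exact contDiff_jet_d _ _ _ _
  all_goals exact (contDiff_jet_d _ _ _ _).add (contDiff_jet_d _ _ _ _)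

/-- An explicit transformation belongs to the equivalence group of any class that is invariant under
explicit transformations. -/
theorem LocallyExplicit.isEquivalence {S : Set VortEq} {Ω : Set Base} {φ : Base → Base}
    (hS : ∀ f ∈ S, ∀ f' : VortEq, LocallyExplicit f.base φ →
      IsImage φ (lastComponent φ) f f' → f' ∈ S)
    (h : LocallyExplicit Ω φ) (hinj : InjOn φ Ω) {E : Jet → ℝ → ℝ}
    (hE : ∀ j : Jet, j.pt ∈ Ω → ∀ s, E j s = lastComponent φ j s) :
    IsEquivalence S Ω φ E := by
  have hE' : ∀ j : Jet, j.pt ∈ Ω → E j = (dataAt φ j.pt).trans j.args :=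
    fun j hj => funext fun s => hE j hj s
  refine ⟨h.isPointTransformation hinj, ?_, ?_, ?_, ?_⟩
  · rintro ⟨j, s⟩ ⟨⟨hj, hj'⟩, -⟩
    change j.pt ∈ Ω at hj
    obtain ⟨D, V, hV, hpV, hD⟩ := h j.pt hj
    -- Smoothness is checked for the fixed functions `D`, which give the same values as `E` near
    -- this jet.
    have h1 : ContDiffAt ℝ ∞ (fun q : Jet × ℝ => D.trans q.1.args q.2) (j, s) :=
      ContDiffAt.comp (f := fun q : Jet × ℝ => (q.1.args, q.2)) (j, s)
        (Data.RegularAt.contDiffAt_trans (a := j.args) (hD.regularAt hV hpV) s)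
        ((contDiff_jet_args.comp contDiff_fst).prodMk contDiff_snd).contDiffAt
    refine h1.contDiffWithinAt.congr_of_eventuallyEq_of_mem ?_ ⟨⟨hj, hj'⟩, mem_univ _⟩
    have hc : Continuous fun q : Jet × ℝ => q.1.pt :=
      ((contDiff_fst.comp contDiff_jet_args).comp contDiff_fst).continuous
    have hev : ∀ᶠ q : Jet × ℝ in 𝓝 (j, s), q.1.pt ∈ V :=
      hc.continuousAt.eventually_mem (hV.mem_nhds hpV)
    filter_upwards [hev.filter_mono nhdsWithin_le_nhds, self_mem_nhdsWithin] with q hq hq'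
    rw [hE q.1 hq'.1.1]
    exact (hD.dataAt_eq hV hq).2 _ rfl _
  · rintro j ⟨hj, -⟩
    rw [hE' j hj]
    exact Data.RegularAt.trans_injective (a := j.args) (h.regularAt hj)
  · rintro j ⟨hj, -⟩ s
    rw [hE' j hj, (Data.hasDerivAt_trans _ _ _).deriv]
    exact (h.regularAt hj).slope_ne
  · intro f hf hb
    have hl := h.mono hb
    have hi := f.push_isImage hl (hinj.mono hb)
    refine ⟨f.push φ hl (hinj.mono hb), hS f hf _ hl hi, ⟨hi.base_eq, hi.dom_iff, ?_⟩,
      hi.isAdmissible hl (hinj.mono hb)⟩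
    intro j j' hd hP
    rw [hi.value j j' hd hP, hE j (hb ⟨_, hd, rfl⟩)]

/-! ### Invariance of the class of the equations that are not removable -/

/-- The linear part of `Coef.push`. -/
noncomputable def Coef.lin (c : Coef) (v : Fin 8 → ℝ) : Fin 8 → ℝ := c.push v - c.push 0

theorem Coef.push_add_smul (c : Coef) (w v : Fin 8 → ℝ) (s : ℝ) :
    c.push (w + s • v) = c.push w + s • c.lin v := by
  funext k
  fin_cases k <;> simp only [Coef.lin, Coef.push, Fin.isValue, Matrix.cons_val, Fin.zero_eta,
    Fin.mk_one, Fin.reduceFinMk, Pi.add_apply, Pi.smul_apply, Pi.sub_apply, Pi.zero_apply,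
    smul_eq_mul] <;> ring

/-- The affine map `push` is triangular in the order of derivatives: `ψ_x, ψ_y, ζ` are transformed
among themselves, without the higher derivatives. -/
theorem Coef.lin_of_first {c : Coef} {v : Fin 8 → ℝ} (hv : ∀ k : Fin 8, k < 3 → v k = 0) :
    ∀ k : Fin 8, k < 3 → c.lin v k = 0 := by
  have h0 := hv 0 (by decide)
  have h1 := hv 1 (by decide)
  have h2 := hv 2 (by decide)
  intro k hk
  fin_cases k <;> first
    | exact absurd hk (by decide)
    | (simp only [Coef.lin, Coef.push, Fin.isValue, Matrix.cons_val, Fin.zero_eta,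
        Fin.mk_one, Fin.reduceFinMk, Pi.sub_apply, Pi.zero_apply, h0, h1, h2]
       ring)

theorem Coef.lin_of_second {c : Coef} {v : Fin 8 → ℝ} (hv : ∀ k : Fin 8, k < 5 → v k = 0) :
    ∀ k : Fin 8, k < 5 → c.lin v k = 0 := by
  have h0 := hv 0 (by decide)
  have h1 := hv 1 (by decide)
  have h2 := hv 2 (by decide)
  have h3 := hv 3 (by decide)
  have h4 := hv 4 (by decide)
  intro k hk
  fin_cases k <;> first
    | exact absurd hk (by decide)
    | (simp only [Coef.lin, Coef.push, Fin.isValue, Matrix.cons_val, Fin.zero_eta,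
        Fin.mk_one, Fin.reduceFinMk, Pi.sub_apply, Pi.zero_apply, h0, h1, h2, h3, h4]
       ring)

/-- The linear part of `Data.trans` in the arguments. -/
noncomputable def Data.transLin (D : Data) (z : Indep) (v : Fin 8 → ℝ) : ℝ :=
  D.trans ((z, 0), v) 0 - D.trans ((z, 0), 0) 0

theorem Data.trans_add_smul (D : Data) (b v : Args) (hv : v.1.1 = 0) (s y : ℝ) :
    D.trans (b + s • v) y
      = D.A b.1.1 / pd 0 D.Z₀ b.1.1 * y + D.trans b 0 + s * D.transLin b.1.1 v.2 := by
  have hz : (b + s • v).1.1 = b.1.1 := by simp [hv]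
  have hw : (b + s • v).2 = b.2 + s • v.2 := rfl
  simp only [Data.transLin, Data.trans, hz, hw, Pi.add_apply, Pi.smul_apply, smul_eq_mul,
    Pi.zero_apply]
  ring

theorem Data.transLin_of_second {D : Data} {z : Indep} {v : Fin 8 → ℝ}
    (hv : ∀ k : Fin 8, k < 5 → v k = 0) : D.transLin z v = 0 := by
  have h2 := hv 2 (by decide)
  have h3 := hv 3 (by decide)
  have h4 := hv 4 (by decide)
  simp only [Data.transLin, Data.trans, h2, h3, h4, Pi.zero_apply, sub_self]

/-- `F` is, near `a`, of the form `a¹ ζ_x + a² ζ_y + b`, in terms of directional derivatives. -/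
structure RemovableAt (F : Args → ℝ) (a : Args) : Prop where
  second : ∀ w : Fin 8 → ℝ, (∀ k : Fin 8, k < 5 → w k = 0) → fderiv ℝ F a (0, w) = 0
  mixed : ∀ w : Fin 8 → ℝ, (∀ k : Fin 8, k < 3 → w k = 0) → ∀ v : Args, v.1.1 = 0 →
    fderiv ℝ (fun b => fderiv ℝ F b (0, w)) a v = 0

theorem vector_eq_sum (L : Args →L[ℝ] ℝ) {v : Args} (hv : v.1.1 = 0) :
    L v = v.1.2 * L ((0, 1), 0) + ∑ k : Fin 8, v.2 k * L (0, Pi.single k 1) := by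
  have e : v = v.1.2 • (((0 : Indep), (1 : ℝ)), (0 : Fin 8 → ℝ))
      + ∑ k : Fin 8, v.2 k • ((0 : Base), (Pi.single k 1 : Fin 8 → ℝ)) := by
    refine Prod.ext (Prod.ext ?_ ?_) ?_
    · simp [hv, Prod.fst_sum]
    · simp [Prod.fst_sum]
    · funext i
      simp [Prod.snd_sum, Finset.sum_apply, Pi.single_apply]
  conv_lhs => rw [e]
  simp only [map_add, map_smul, map_sum, smul_eq_mul]

theorem vector_eq_sum' (L : Args →L[ℝ] ℝ) (w : Fin 8 → ℝ) :
    L (0, w) = ∑ k : Fin 8, w k * L (0, Pi.single k 1) := by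
  rw [vector_eq_sum L (by rfl)]; simp

theorem contDiffAt_fderiv_apply {f : VortEq} {a : Args} (ha : a ∈ f.dom) (w : Args) :
    ContDiffAt ℝ ∞ (fun b => fderiv ℝ f.F b w) a :=
  ((f.smooth.contDiffAt (f.isOpen_dom.mem_nhds ha)).fderiv_right (m := ∞)
    (by simp)).clm_apply contDiffAt_const

/-- Coordinate directions are mixed by `lin`, so the class is described by directional derivatives
over the subspaces that `lin` preserves. -/
theorem notMem_nonremovableClass {f : VortEq} :
    f ∉ nonremovableClass ↔ ∀ a ∈ f.dom, RemovableAt f.F a := by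
  constructor
  · intro h
    have h5 : ∀ a ∈ f.dom, ∀ k : Fin 8, 5 ≤ k → dvert k f.F a = 0 := by
      intro a ha k hk
      by_contra hne
      exact h ⟨a, ha, Or.inl ⟨k, hk, hne⟩⟩
    have hmix : ∀ a ∈ f.dom, ∀ i : Fin 8, (i = 3 ∨ i = 4) →
        dpsi (dvert i f.F) a = 0 ∧ ∀ k : Fin 8, dvert k (dvert i f.F) a = 0 := by
      intro a ha i hi
      constructor
      · by_contra hne
        exact h ⟨a, ha, Or.inr ⟨i, hi, Or.inl hne⟩⟩
      · intro k
        by_contra hne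
        exact h ⟨a, ha, Or.inr ⟨i, hi, Or.inr ⟨k, hne⟩⟩⟩
    intro a ha
    refine ⟨fun w hw => ?_, fun w hw v hv => ?_⟩
    · rw [vector_eq_sum']
      refine Finset.sum_eq_zero fun k _ => ?_
      by_cases hk : k < 5
      · rw [hw k hk, zero_mul]
      · have := h5 a ha k (not_lt.1 hk)
        rw [dvert] at this
        rw [this, mul_zero]
    · have e : (fun b => fderiv ℝ f.F b (0, w)) =ᶠ[𝓝 a]
          fun b => w 3 * dvert 3 f.F b + w 4 * dvert 4 f.F b := by
        filter_upwards [f.isOpen_dom.mem_nhds ha] with b hb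
        rw [vector_eq_sum', Fin.sum_univ_eight]
        have k5 := h5 b hb 5 (by decide)
        have k6 := h5 b hb 6 (by decide)
        have k7 := h5 b hb 7 (by decide)
        simp only [dvert] at k5 k6 k7 ⊢
        rw [hw 0 (by decide), hw 1 (by decide), hw 2 (by decide), k5, k6, k7]
        ring
      have d : ∀ i : Fin 8, DifferentiableAt ℝ (dvert i f.F) a := fun i =>
        (contDiffAt_fderiv_apply ha _).differentiableAt (by simp)
      have z : ∀ i : Fin 8, (i = 3 ∨ i = 4) → fderiv ℝ (dvert i f.F) a v = 0 := by
        intro i hi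
        obtain ⟨k1, k2⟩ := hmix a ha i hi
        rw [vector_eq_sum _ hv]
        simp only [dpsi] at k1
        rw [k1, mul_zero, zero_add]
        refine Finset.sum_eq_zero fun k _ => ?_
        have := k2 k
        rw [dvert] at this
        rw [this, mul_zero]
      rw [e.fderiv_eq, fderiv_fun_add ((d 3).const_mul _) ((d 4).const_mul _),
        fderiv_const_mul (d 3), fderiv_const_mul (d 4)]
      simp [z 3 (Or.inl rfl), z 4 (Or.inr rfl)]
  · rintro h ⟨a, ha, ⟨k, hk, hne⟩ | ⟨i, hi, hne⟩⟩
    · refine hne ((h a ha).second _ fun l hl => ?_)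
      rw [Pi.single_apply, if_neg]
      rintro rfl; exact absurd hk (not_le.2 hl)
    · have hw : ∀ l : Fin 8, l < 3 → (Pi.single i 1 : Fin 8 → ℝ) l = 0 := by
        intro l hl
        rw [Pi.single_apply, if_neg]
        rintro rfl
        rcases hi with rfl | rfl <;> exact absurd hl (by decide)
      rcases hne with hne | ⟨k, hne⟩
      · exact hne ((h a ha).mixed _ hw _ rfl)
      · exact hne ((h a ha).mixed _ hw _ rfl)

theorem hasDerivAt_line {E : Type*} [NormedAddCommGroup E] [NormedSpace ℝ E] {F : E → ℝ} {a : E}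
    (hF : DifferentiableAt ℝ F a) (v : E) :
    HasDerivAt (fun s : ℝ => F (a + s • v)) (fderiv ℝ F a v) 0 := by
  have h1 : HasDerivAt (fun s : ℝ => a + s • v) v 0 := by
    simpa using ((hasDerivAt_id (0 : ℝ)).smul_const v).const_add a
  have h2 : HasFDerivAt F (fderiv ℝ F a) (a + (0 : ℝ) • v) := by
    simpa using hF.hasFDerivAt
  exact h2.comp_hasDerivAt (0 : ℝ) h1

section Invariance

variable {f f' : VortEq} {φ : Base → Base} {D : Data} {U : Set Base}

/-- The new arguments in terms of the old ones. -/
noncomputable def pushArgs (φ : Base → Base) (D : Data) (a : Args) : Args :=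
  (φ a.1, (D.coef a.1.1).push a.2)

theorem IsImage.pushArgs_mem (hI : IsImage φ (lastComponent φ) f f') (hD : Represents D U φ)
    (hU : IsOpen U) {a : Args} (ha : a ∈ f.dom) (haU : a.1 ∈ U) :
    pushArgs φ D a ∈ f'.dom ∧ f'.F (pushArgs φ D a) = D.trans a (f.F a) := by
  have hl : LocallyExplicit U φ := fun p hp => ⟨D, U, hU, hp, hD⟩
  obtain ⟨j', hP⟩ := hl.exists_prolongs hU (j := argsJet a 0 0) haU
  obtain ⟨h1, h2, h3, -⟩ := hD.prolongs (j := argsJet a 0 0) hU haU hP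
  have he : j'.args = pushArgs φ D a := by
    refine Prod.ext h1 ?_
    rw [argsJet_args] at h3
    rw [pushArgs, h3]
    exact (h2.push_pull _).symm
  have hd : (argsJet a 0 0).args ∈ f.dom := by rw [argsJet_args]; exact ha
  have k1 := (hI.dom_iff (argsJet a 0 0) j' ⟨a, ha, rfl⟩ hP).1 hd
  have k2 := hI.value (argsJet a 0 0) j' hd hP
  rw [he] at k1
  rw [he, lastComponent_argsJet, argsJet_args, (hD.dataAt_eq hU haU).2 a rfl] at k2
  exact ⟨k1, k2⟩

/-- Along directions that keep `t, x, y` fixed both `φ` and `push` are affine. -/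
theorem Represents.pushArgs_add_smul (hD : Represents D U φ) {a v : Args} (hv : v.1.1 = 0) {s : ℝ}
    (ha : a.1 ∈ U) (hs : (a + s • v).1 ∈ U) :
    pushArgs φ D (a + s • v) = pushArgs φ D a
      + s • (((0, D.S a.1.1 * v.1.2), (D.coef a.1.1).lin v.2) : Args) := by
  have hz : (a + s • v).1.1 = a.1.1 := by simp [hv]
  have e1 := (hD.form _ ha).2.2.2
  have e2 := (hD.form _ hs).2.2.2
  rw [hz] at e2
  refine Prod.ext ?_ ?_
  · change φ (a + s • v).1 = φ a.1 + s • ((0 : Indep), D.S a.1.1 * v.1.2)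
    rw [e1, e2]
    refine Prod.ext (by simp) ?_
    change D.Υ (a.1.1 0) * (a.1.2 + s * v.1.2) + D.Φ a.1.1
      = D.Υ (a.1.1 0) * a.1.2 + D.Φ a.1.1 + s * (D.Υ (a.1.1 0) * v.1.2)
    ring
  · change (D.coef (a + s • v).1.1).push (a.2 + s • v.2) = _
    rw [hz, Coef.push_add_smul]; rfl

/-- The identity between `F̃` at the new arguments and `trans` of `F` at the old ones is
differentiated along a vertical line. Over fixed `t, x, y`, `trans` is affine in the arguments and
in the value of `F`. -/
theorem IsImage.fderiv_vertical (hI : IsImage φ (lastComponent φ) f f') (hD : Represents D U φ)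
    (hU : IsOpen U) {a : Args} (ha : a ∈ f.dom) (haU : a.1 ∈ U) (w : Fin 8 → ℝ) :
    fderiv ℝ f'.F (pushArgs φ D a) (0, (D.coef a.1.1).lin w)
      = D.A a.1.1 / pd 0 D.Z₀ a.1.1 * fderiv ℝ f.F a (0, w) + D.transLin a.1.1 w := by
  obtain ⟨h1, h2⟩ := hI.pushArgs_mem hD hU ha haU
  have d1 : DifferentiableAt ℝ f.F a :=
    (f.smooth.contDiffAt (f.isOpen_dom.mem_nhds ha)).differentiableAt (by simp)
  have d2 : DifferentiableAt ℝ f'.F (pushArgs φ D a) :=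
    (f'.smooth.contDiffAt (f'.isOpen_dom.mem_nhds h1)).differentiableAt (by simp)
  have k1 := hasDerivAt_line d1 ((0 : Base), w)
  have k2 := hasDerivAt_line d2 ((0 : Base), (D.coef a.1.1).lin w)
  have hc : Continuous fun s : ℝ => a + s • ((0 : Base), w) := by fun_prop
  have hev : ∀ᶠ s : ℝ in 𝓝 0, a + s • ((0 : Base), w) ∈ f.dom :=
    hc.continuousAt.eventually_mem (by simpa using f.isOpen_dom.mem_nhds ha)
  have e : (fun s : ℝ => f'.F (pushArgs φ D a + s • ((0 : Base), (D.coef a.1.1).lin w))) =ᶠ[𝓝 0]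
      fun s => D.A a.1.1 / pd 0 D.Z₀ a.1.1 * f.F (a + s • ((0 : Base), w)) + D.trans a 0
        + s * D.transLin a.1.1 w := by
    filter_upwards [hev] with s hs
    have hsU : (a + s • ((0 : Base), w)).1 ∈ U := by simpa using haU
    have m := (hI.pushArgs_mem hD hU hs hsU).2
    rw [hD.pushArgs_add_smul rfl haU hsU, D.trans_add_smul a _ rfl] at m
    have hw : (((0 : Indep), D.S a.1.1 * (0 : ℝ)) : Base) = 0 := by rw [mul_zero]; rfl
    rw [← m]
    exact congrArg (fun q : Base => f'.F (pushArgs φ D a + s • (q, (D.coef a.1.1).lin w))) hw.symm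
  have k3 := (((k1.const_mul (D.A a.1.1 / pd 0 D.Z₀ a.1.1)).add_const (D.trans a 0)).add
    ((hasDerivAt_id (0 : ℝ)).mul_const (D.transLin a.1.1 w)))
  have := k2.unique (k3.congr_of_eventuallyEq e)
  rw [this]; simp

theorem IsImage.removableAt (hI : IsImage φ (lastComponent φ) f f') (hD : Represents D U φ)
    (hU : IsOpen U) {a : Args} (ha : a ∈ f.dom) (haU : a.1 ∈ U)
    (h : ∀ b ∈ f'.dom, RemovableAt f'.F b) : RemovableAt f.F a := by
  have hne := (hD.regularAt hU haU).slope_ne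
  have hb := (hI.pushArgs_mem hD hU ha haU).1
  refine ⟨fun w hw => ?_, fun w hw v hv => ?_⟩
  · have := hI.fderiv_vertical hD hU ha haU w
    rw [(h _ hb).second _ (Coef.lin_of_second hw), Data.transLin_of_second hw, add_zero] at this
    exact (mul_eq_zero.1 this.symm).resolve_left hne
  · let v' : Args := ((0, D.S a.1.1 * v.1.2), (D.coef a.1.1).lin v.2)
    have d1 : DifferentiableAt ℝ (fun b => fderiv ℝ f.F b (0, w)) a :=
      (contDiffAt_fderiv_apply ha _).differentiableAt (by simp)
    have d2 : DifferentiableAt ℝ (fun b => fderiv ℝ f'.F b (0, (D.coef a.1.1).lin w))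
        (pushArgs φ D a) := (contDiffAt_fderiv_apply hb _).differentiableAt (by simp)
    have k1 := hasDerivAt_line d1 v
    have k2 := hasDerivAt_line d2 v'
    rw [(h _ hb).mixed _ (Coef.lin_of_first hw) v' rfl] at k2
    have hc : Continuous fun s : ℝ => a + s • v := by fun_prop
    have hev : ∀ᶠ s : ℝ in 𝓝 0, a + s • v ∈ f.dom :=
      hc.continuousAt.eventually_mem (by simpa using f.isOpen_dom.mem_nhds ha)
    have hevU : ∀ᶠ s : ℝ in 𝓝 0, (a + s • v).1 ∈ U :=
      (continuous_fst.comp hc).continuousAt.eventually_mem (by simpa using hU.mem_nhds haU)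
    -- The slope and `transLin` depend on `t, x, y` only, hence are constant along `v`. A second
    -- differentiation leaves a nonzero multiple of the mixed derivative.
    have e : (fun s : ℝ => fderiv ℝ f'.F (pushArgs φ D a + s • v') (0, (D.coef a.1.1).lin w))
        =ᶠ[𝓝 0] fun s => D.A a.1.1 / pd 0 D.Z₀ a.1.1 * fderiv ℝ f.F (a + s • v) (0, w)
          + D.transLin a.1.1 w := by
      filter_upwards [hev, hevU] with s hs hsU
      have hz : (a + s • v).1.1 = a.1.1 := by simp [hv]
      have m := hI.fderiv_vertical hD hU hs hsU w
      rw [hD.pushArgs_add_smul hv haU hsU, hz] at m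
      exact m
    have k3 := (k1.const_mul (D.A a.1.1 / pd 0 D.Z₀ a.1.1)).add_const (D.transLin a.1.1 w)
    have := k2.unique (k3.congr_of_eventuallyEq e)
    exact (mul_eq_zero.1 this.symm).resolve_left hne

/-- The image of an equation that is not removable is not removable. -/
theorem IsImage.mem_nonremovableClass (hf : f ∈ nonremovableClass) (hl : LocallyExplicit f.base φ)
    (hI : IsImage φ (lastComponent φ) f f') : f' ∈ nonremovableClass := by
  by_contra hn
  rw [notMem_nonremovableClass] at hn
  refine notMem_nonremovableClass.2 (fun a ha => ?_) hf
  obtain ⟨D, U, hU, haU, hD⟩ := hl a.1 ⟨a, ha, rfl⟩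
  exact hI.removableAt hD hU ha haU hn

end Invariance

/-! ### The equivalence groups -/

/-- The equation `ζ_t = ζ_xx + c` over `Ω`. -/
noncomputable def linearEq (Ω : Set Base) (hΩ : IsOpen Ω) (c : ℝ) : VortEq where
  dom := Prod.fst ⁻¹' Ω
  F := fun a => a.2 5 + c
  isOpen_dom := hΩ.preimage continuous_fst
  smooth := by
    have : ContDiff ℝ ∞ fun a : Args => a.2 5 + c := by fun_prop
    exact this.contDiffOn

theorem linearEq_base {Ω : Set Base} (hΩ : IsOpen Ω) (c : ℝ) : (linearEq Ω hΩ c).base = Ω :=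
  image_preimage_eq Ω Prod.fst_surjective

theorem linearEq_mem_nonremovableClass {Ω : Set Base} (hΩ : IsOpen Ω) (c : ℝ) (hne : Ω.Nonempty) :
    linearEq Ω hΩ c ∈ nonremovableClass := by
  obtain ⟨p, hp⟩ := hne
  refine ⟨(p, 0), hp, Or.inl ⟨5, le_rfl, ?_⟩⟩
  have h1 : HasFDerivAt (fun a : Args => a.2 5 + c)
      ((ContinuousLinearMap.proj 5).comp (ContinuousLinearMap.snd ℝ Base (Fin 8 → ℝ)))
      (p, 0) :=
    ((ContinuousLinearMap.proj (R := ℝ) (φ := fun _ : Fin 8 => ℝ) 5).comp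
      (ContinuousLinearMap.snd ℝ Base (Fin 8 → ℝ))).hasFDerivAt.add_const c
  change fderiv ℝ (fun a : Args => a.2 5 + c) (p, 0) _ ≠ 0
  rw [h1.fderiv]
  simp

theorem Represents.newF_eq {D : Data} {Ω : Set Base} {φ : Base → Base} (h : Represents D Ω φ)
    (hΩ : IsOpen Ω) {j : Jet} (hj : j.pt ∈ Ω) (s : ℝ) :
    newF D.T D.Υ D.Z₁ D.Z₂ D.Φ j s = lastComponent φ j s := by
  rw [newF_eq_trans (h.regularAt hΩ hj).diff_T, lastComponent, (h.dataAt_eq hΩ hj).2 _ rfl]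

/-- The classes whose equivalence groups are computed: those that contain the equations
`ζ_t = ζ_xx + c` and are invariant under explicit transformations. -/
structure IsInvariantClass (S : Set VortEq) : Prop where
  linearEq_mem : ∀ (Ω : Set Base) (hΩ : IsOpen Ω) (c : ℝ), Ω.Nonempty → linearEq Ω hΩ c ∈ S
  image_mem : ∀ f ∈ S, ∀ (f' : VortEq) (φ : Base → Base), LocallyExplicit f.base φ →
    IsImage φ (lastComponent φ) f f' → f' ∈ S

/-- The local expressions glued in `lastComponent` give one group element over the whole base, with
no condition on its sections. -/
theorem IsInvariantClass.isNormalized {S : Set VortEq} (hS : IsInvariantClass S) :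
    IsNormalized S := fun _ _ _ _ φ h =>
  ⟨lastComponent φ, h.locallyExplicit.isEquivalence
    (fun f hf f' hl hI => hS.image_mem f hf f' φ hl hI) h.point.injOn (fun _ _ _ => rfl), h.isImage⟩

theorem IsInvariantClass.isEquivalence_iff {S : Set VortEq} (hS : IsInvariantClass S)
    {Ω : Set Base} (hΩ : IsBaseDomain Ω) (φ : Base → Base) (E : Jet → ℝ → ℝ) :
    IsEquivalence S Ω φ E ↔ IsExplicit Ω φ E := by
  rw [isExplicit_iff]
  constructor
  · intro h
    refine ⟨h.point.injOn, ?_⟩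
    -- Membership of the test equations is available only over nonempty `Ω`. Over the empty set any
    -- functions represent `φ`.
    rcases Ω.eq_empty_or_nonempty with rfl | hne
    · refine ⟨⟨0, 0, 0, 0, 0⟩, ⟨?_, ?_, ?_, ?_, ?_, fun p hp => hp.elim⟩, fun j hj => hj.elim⟩
      all_goals exact contDiffOn_const
    have hmaps : ∀ c : ℝ, ∃ f', IsImage φ E (linearEq Ω hΩ.isOpen c) f' ∧
        IsAdmissible (linearEq Ω hΩ.isOpen c) f' φ := by
      intro c
      obtain ⟨f', -, h'⟩ := h.maps _ (hS.linearEq_mem Ω hΩ.isOpen c hne)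
        (linearEq_base hΩ.isOpen c).subset
      exact ⟨f', h'⟩
    have hinf : ∀ p ∈ Ω, InfExplicit φ p := by
      obtain ⟨f', -, ha⟩ := hmaps 0
      intro p hp
      exact ha.infExplicit (by rw [linearEq_base]; exact hp)
    obtain ⟨D, hD⟩ := exists_represents hΩ h.point.smooth
      (fun p hp => h.point.fderiv_injective hp) hinf
    refine ⟨D, hD, fun j hj s => ?_⟩
    -- The constant is chosen so that the right-hand side takes the value `s` at `j`. Both `E` and
    -- `lastComponent` must then give the value of the image equation there.
    obtain ⟨f', hI, ha⟩ := hmaps (s - j.vortXX)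
    have hb : j.pt ∈ (linearEq Ω hΩ.isOpen (s - j.vortXX)).base := by
      rw [linearEq_base]; exact hj
    obtain ⟨j', hP⟩ := ha.locallyExplicit.exists_prolongs (VortEq.isOpen_base _) hb
    have hd : j.args ∈ (linearEq Ω hΩ.isOpen (s - j.vortXX)).dom := hj
    have hs : (linearEq Ω hΩ.isOpen (s - j.vortXX)).F j.args = s := add_sub_cancel _ _
    have h1 := hI.value j j' hd hP
    have h2 := ha.isImage.value j j' hd hP
    rw [hs] at h1 h2
    rw [hD.newF_eq hΩ.isOpen hj, ← h1, h2]
  · rintro ⟨hinj, D, hD, hE⟩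
    have hl : LocallyExplicit Ω φ := fun p hp => ⟨D, Ω, hΩ.isOpen, hp, hD⟩
    exact hl.isEquivalence (fun f hf f' hl hI => hS.image_mem f hf f' φ hl hI) hinj
      fun j hj s => (hE j hj s).trans (hD.newF_eq hΩ.isOpen hj s)

theorem isInvariantClass_fullClass : IsInvariantClass fullClass :=
  ⟨fun _ _ _ _ => mem_univ _, fun _ _ _ _ _ _ => mem_univ _⟩

theorem isInvariantClass_nonremovableClass : IsInvariantClass nonremovableClass :=
  ⟨fun _ hΩ c hne => linearEq_mem_nonremovableClass hΩ c hne,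
    fun _ hf _ _ hl hI => hI.mem_nonremovableClass hf hl⟩

/-- An admissible transformation over a domain with connected sections is induced by an explicit
transformation. -/
theorem IsAdmissible.exists_isExplicit {f f' : VortEq} {φ : Base → Base} (hb : IsBaseDomain f.base)
    (h : IsAdmissible f f' φ) : ∃ E : Jet → ℝ → ℝ, IsExplicit f.base φ E ∧ IsImage φ E f f' := by
  obtain ⟨D, hD⟩ := exists_represents hb h.point.smooth
    (fun p hp => h.point.fderiv_injective hp) fun p hp => h.infExplicit hp
  have hI := h.isImage
  refine ⟨newF D.T D.Υ D.Z₁ D.Z₂ D.Φ, isExplicit_iff.2 ⟨h.point.injOn, D, hD, fun _ _ _ => rfl⟩,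
    hI.base_eq, hI.dom_iff, fun j j' hd hP => ?_⟩
  rw [hI.value j j' hd hP, hD.newF_eq hb.isOpen ⟨_, hd, rfl⟩]

end Vorticity

theorem mainTheorem1 :
    (Vorticity.IsNormalized Vorticity.fullClass ∧
      ∀ Ω : Set Vorticity.Base, Vorticity.IsBaseDomain Ω →
        ∀ (φ : Vorticity.Base → Vorticity.Base) (E : Vorticity.Jet → ℝ → ℝ),
          Vorticity.IsEquivalence Vorticity.fullClass Ω φ E ↔ Vorticity.IsExplicit Ω φ E) ∧
    (Vorticity.IsNormalized Vorticity.nonremovableClass ∧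
      ∀ Ω : Set Vorticity.Base, Vorticity.IsBaseDomain Ω →
        ∀ (φ : Vorticity.Base → Vorticity.Base) (E : Vorticity.Jet → ℝ → ℝ),
          Vorticity.IsEquivalence Vorticity.nonremovableClass Ω φ E ↔
            Vorticity.IsExplicit Ω φ E) ∧
    (∀ f ∈ Vorticity.nontrivialClass, ∀ f' ∈ Vorticity.nontrivialClass,
      ∀ φ : Vorticity.Base → Vorticity.Base, Vorticity.IsBaseDomain f.base →
        Vorticity.IsAdmissible f f' φ →
          ∃ E : Vorticity.Jet → ℝ → ℝ,
            Vorticity.IsExplicit f.base φ E ∧ Vorticity.IsImage φ E f f') :=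
  ⟨⟨Vorticity.isInvariantClass_fullClass.isNormalized,
      fun _ hΩ φ E => Vorticity.isInvariantClass_fullClass.isEquivalence_iff hΩ φ E⟩,
    ⟨Vorticity.isInvariantClass_nonremovableClass.isNormalized,
      fun _ hΩ φ E => Vorticity.isInvariantClass_nonremovableClass.isEquivalence_iff hΩ φ E⟩,
    fun _ _ _ _ _ hb h => h.exists_isExplicit hb⟩
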